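/- Let $\Lambda=\mathbb Z^3$ with its determinant form, $\Lambda^\vee=\mathrm{Hom}(\Lambda,\mathbb Z)$, and let $\Lambda_{prim}$ be the set of primitive vectors of $\Lambda$. For $\delta\in\Lambda^\vee$ extend $\delta$ linearly to $x\in\mathbb C^3$. For linearly independent $a,b\in\Lambda_{prim}$ the direction vector of the wedge $(a,b)$ is the unique primitive $\gamma=\gamma_{a,b}\in\Lambda^\vee$ such that $\det(a,b,\cdot)=s\gamma$ for a positive integer $s$. Put $$C_{+-}(a,b)=\{\delta\in\Lambda^\vee:\delta(a)>0,\ \delta(b)\le 0\},\qquad C_{-+}(a,b)=\{\delta\in\Lambda^\vee:\delta(a)\le 0,\ \delta(b)>0\},$$ $$\Gamma_{a,b}(w,x)=\frac{\prod_{\delta\in C_{+-}(a,b)/\mathbb Z\gamma}\bigl(1-e^{-2\pi i(\delta(x)-w)/\gamma(x)}\bigr)}{\prod_{\delta\in C_{-+}(a,b)/\mathbb Z\gamma}\bigl(1-e^{2\pi i(\delta(x)-w)/\gamma(x)}\bigr)},$$ and $\Gamma_{a,a}=1$ (for $a=-b$ no definition is needed, the domain below being empty). For $a\in\Lambda_{prim}$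 let $H(a)=\{\alpha\in(\mathbb Q^3)^*:\alpha(a)=0\}$, a basis $(\alpha,\beta)$ of $H(a)$ being oriented if $\det(\alpha,\beta,\delta)>0$ whenever $\delta(a)>0$, and let $U_a^+$ be the set of $x\in\mathbb C^3$ with $\mathrm{Im}(\alpha(x)\overline{\beta(x)})>0$ for some oriented basis $(\alpha,\beta)$ of $H(a)$. Let $$P_3(w,x_1,x_2,x_3)=\frac{w^3}{x_1x_2x_3}-\frac{3(x_1+x_2+x_3)}{2x_1x_2x_3}w^2+\frac{x_1^2+x_2^2+x_3^2+3x_1x_2+3x_2x_3+3x_1x_3}{2x_1x_2x_3}w-\frac14(x_1+x_2+x_3)\Bigl(\frac1{x_1}+\frac1{x_2}+\frac1{x_3}\Bigr).$$ **Theorem.** The two products defining $\Gamma_{a,b}$ converge for all linearly independent $a,b\in\Lambda_{prim}$, $x\in U_a^+\cap U_b^+$ and $w\in\mathbb C$. The polynomial $P_3$ is the multiple Bernoulli polynomial $B_{3,3}$, where $B_{r,n}$ is defined by $e^{wt}\prod_{j=1}^r\frac{t}{e^{x_jt}-1}=\sum_{n\ge0}B_{r,n}(w,x_1,\dots,x_r)\frac{t^n}{n!}$.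 There is a family of polynomials $P_{a,b,c}(w,x)\in\mathbb Q(x_1,x_2,x_3)[w]$, $a,b,c\in\Lambda_{prim}$, of degree at most $3$ in $w$, with coefficients regular on $U_a^+\cap U_b^+\cap U_c^+$, such that for all $a,b,c\in\Lambda_{prim}$, $x\in U_a^+\cap U_b^+\cap U_c^+$ and all $w\in\mathbb C$ that are not a pole of one of the factors (the poles of $\Gamma_{a,b}(\cdot,x)$ lie in $\{\delta(x):\delta\in C_{-+}(a,b)\}$) $$\Gamma_{a,b}(w,x)\,\Gamma_{b,c}(w,x)\,\Gamma_{c,a}(w,x)=\exp\Bigl(-\frac{\pi i}{3}P_{a,b,c}(w,x)\Bigr),$$ and such that the following hold. (i) If $a,b,c$ are linearly dependent then $P_{a,b,c}=0$. (ii) If $\det(a,b,c)>0$, let $\alpha,\beta,\gamma$ be the direction vectors of the wedges $(b,c)$, $(c,a)$, $(a,b)$, and let $F(a,b,c)$ be the set of $\delta\in\Lambda^\vee$ with $0\le\delta(a)<\alpha(a)$, $0\le\delta(b)<\beta(b)$, $0\le\delta(c)<\gamma(c)$. Then $F(a,b,c)$ is finite and $$P_{a,b,c}(w,x)=\sum_{\delta\in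 F(a,b,c)}P_3\bigl(w+\delta(x),\alpha(x),\beta(x),\gamma(x)\bigr)=\frac{\det(\alpha,\beta,\gamma)}{\alpha(x)\beta(x)\gamma(x)}\,w^3+(\text{terms of degree}\le 2\text{ in }w).$$ (iii) $P_{a_1,a_2,a_3}=\mathrm{sign}(\sigma)\,P_{a_{\sigma(1)},a_{\sigma(2)},a_{\sigma(3)}}$ for all $a_1,a_2,a_3\in\Lambda_{prim}$ and $\sigma\in S_3$. Moreover $P_{ga,gb,gc}(w,x)=P_{a,b,c}(w,g^{-1}x)$ for all $g\in SL_3(\mathbb Z)$ and $a,b,c\in\Lambda_{prim}$. -/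

import Mathlib

open scoped Matrix Polynomial

noncomputable section

namespace EllGamma

/-- The lattice `Λ = ℤ³`. The dual lattice `Λ^∨ = Hom(Λ, ℤ)` is identified with the same type by
means of the dual basis; the pairing is `pair`. -/
abbrev Lattice3 : Type := Fin 3 → ℤ

/-- `pair δ x = δ(x) = ∑ δᵢ xᵢ`: the value of the linear form with coefficients `δ` at a point `x`
of `M³`. -/
def pair {R M : Type*} [SMul R M] [AddCommMonoid M] (δ : Fin 3 → R) (x : Fin 3 → M) : M :=
  ∑ i, δ i • x i

/-- Primitive vectors of the lattice; in particular `0` is not primitive. -/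
def IsPrim (v : Lattice3) : Prop :=
  ∀ (l : ℤ) (u : Lattice3), v = l • u → l = 1 ∨ l = -1

/-- The modulus of the wedge `(a, b)`: the largest integer dividing the form `det(a, b, ·)`, whose
coefficient vector is the cross product of `a` and `b`. -/
def modulus (a b : Lattice3) : ℤ := Finset.univ.gcd (crossProduct a b)

/-- The direction vector of the wedge `(a, b)`: the primitive form `γ` with
`det(a, b, ·) = s γ`, `s > 0`. -/
def dirVec (a b : Lattice3) : Lattice3 := fun i => crossProduct a b i / modulus a b

theorem det_eq_modulus_mul_pair_dirVec (a b x : Lattice3) :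
    (Matrix.of ![a, b, x]).det = modulus a b * pair (dirVec a b) x := by
  have h : ∀ i, modulus a b * dirVec a b i = crossProduct a b i := fun i =>
    Int.mul_ediv_cancel' (Finset.gcd_dvd (Finset.mem_univ i))
  have h' : modulus a b * pair (dirVec a b) x = ∑ i, crossProduct a b i * x i := by
    rw [pair, Finset.mul_sum]
    exact Finset.sum_congr rfl fun i _ => by rw [smul_eq_mul, ← mul_assoc, h]
  rw [h', Fin.sum_univ_three, Matrix.det_fin_three]
  simp [cross_apply]
  ring

theorem modulus_pos {a b : Lattice3} (hab : LinearIndependent ℤ ![a, b]) : 0 < modulus a b := by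
  have h0 : 0 ≤ modulus a b := by
    have h : normalize (modulus a b) = modulus a b := Finset.normalize_gcd
    rw [← Int.abs_eq_normalize] at h
    exact abs_eq_self.mp h
  refine lt_of_le_of_ne h0 fun h => ?_
  have h1 : ∀ i, crossProduct a b i = 0 := fun i =>
    Finset.gcd_eq_zero_iff.mp h.symm i (Finset.mem_univ i)
  have c0 := h1 0
  have c1 := h1 1
  have c2 := h1 2
  simp only [cross_apply, Matrix.cons_val] at c0 c1 c2
  rw [LinearIndependent.pair_iff] at hab
  have h2 : ∀ i, a i = 0 := by
    intro i
    refine neg_eq_zero.mp (hab (b i) (-a i) ?_).2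
    funext j
    simp only [Pi.add_apply, Pi.smul_apply, smul_eq_mul, Pi.zero_apply]
    fin_cases i <;> fin_cases j <;> simp <;> linarith
  have h3 := (hab 1 0 (by funext i; simp [h2 i])).1
  exact one_ne_zero h3

theorem isPrim_dirVec {a b : Lattice3} (hab : LinearIndependent ℤ ![a, b]) :
    IsPrim (dirVec a b) := by
  intro l u h
  have hs := modulus_pos hab
  have h1 : ∀ i, modulus a b * l ∣ crossProduct a b i := by
    intro i
    refine ⟨u i, ?_⟩
    have h2 : dirVec a b i = l * u i := by rw [h]; rfl
    rw [mul_assoc, ← h2]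
    exact (Int.mul_ediv_cancel' (Finset.gcd_dvd (Finset.mem_univ i))).symm
  have h3 : modulus a b * l ∣ modulus a b := Finset.dvd_gcd fun i _ => h1 i
  have h4 : l ∣ 1 := by
    refine Int.dvd_of_mul_dvd_mul_left (a := modulus a b) hs.ne' ?_
    simpa using h3
  exact Int.isUnit_iff.mp (isUnit_of_dvd_one h4)

/-- The cone `C_{+-}(a, b)` of forms `δ` with `δ(a) > 0` and `δ(b) ≤ 0`. -/
def conePM (a b : Lattice3) : Set Lattice3 := {δ | 0 < pair δ a ∧ pair δ b ≤ 0}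

/-- The cone `C_{-+}(a, b)` of forms `δ` with `δ(a) ≤ 0` and `δ(b) > 0`. -/
def coneMP (a b : Lattice3) : Set Lattice3 := {δ | pair δ a ≤ 0 ∧ 0 < pair δ b}

/-- The set `C / ℤγ` of classes modulo `γ` of the elements of a `γ`-invariant set `C` of forms. -/
def classes (C : Set Lattice3) (γ : Lattice3) : Set (Lattice3 ⧸ AddSubgroup.zmultiples γ) :=
  QuotientAddGroup.mk '' C

/-- The factor `1 - exp(-2πi (δ(x) - w) / γ(x))`, `γ` the direction vector of `(a, b)`, of the
numerator of `Γ_{a,b}`; it depends only on the class of `δ` modulo `γ`. -/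
def numFactor (a b : Lattice3) (w : ℂ) (x : Fin 3 → ℂ)
    (q : classes (conePM a b) (dirVec a b)) : ℂ :=
  1 - Complex.exp (-2 * Real.pi * Complex.I * (pair (Quotient.out q.1) x - w) /
    pair (dirVec a b) x)

/-- The factor `1 - exp(2πi (δ(x) - w) / γ(x))`, `γ` the direction vector of `(a, b)`, of the
denominator of `Γ_{a,b}`; it depends only on the class of `δ` modulo `γ`. -/
def denFactor (a b : Lattice3) (w : ℂ) (x : Fin 3 → ℂ)
    (q : classes (coneMP a b) (dirVec a b)) : ℂ :=
  1 - Complex.exp (2 * Real.pi * Complex.I * (pair (Quotient.out q.1) x - w) /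
    pair (dirVec a b) x)

open Classical in
/-- The gamma function `Γ_{a,b}(w, x)` of a wedge. It is `1` for `a = b`; the value for `a = -b`
plays no role, since the domain is then empty. -/
def wedgeGamma (a b : Lattice3) (w : ℂ) (x : Fin 3 → ℂ) : ℂ :=
  if LinearIndependent ℤ ![a, b] then
    (∏' q, numFactor a b w x q) / (∏' q, denFactor a b w x q)
  else 1

/-- The set `U⁺_a` of `x ∈ ℂ³` with `Im(α(x) * conj β(x)) > 0` for some oriented basis `(α, β)` of
the plane `H(a) = {α | α(a) = 0}` in the dual of `ℚ³`; the basis is oriented if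
`det(α, β, δ) > 0` whenever `δ(a) > 0`. -/
def U (a : Lattice3) : Set (Fin 3 → ℂ) :=
  {x | ∃ α β : Fin 3 → ℚ,
    pair α (fun i => (a i : ℚ)) = 0 ∧ pair β (fun i => (a i : ℚ)) = 0 ∧
    LinearIndependent ℚ ![α, β] ∧
    (∀ δ : Fin 3 → ℚ, 0 < pair δ (fun i => (a i : ℚ)) → 0 < (Matrix.of ![α, β, δ]).det) ∧
    0 < (pair α x * (starRingEnd ℂ) (pair β x)).im}

/-- `w` is not a pole of `Γ_{a,b}(·, x)`: the poles are the numbers `δ(x)` with `δ ∈ C_{-+}(a, b)`,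
a set that is invariant under translation by the direction vector. -/
def NotPole (a b : Lattice3) (w : ℂ) (x : Fin 3 → ℂ) : Prop :=
  ∀ δ ∈ coneMP a b, w ≠ pair δ x

/-- The field `ℚ(x) = ℚ(x₁, x₂, x₃)`. -/
abbrev RatFun : Type := FractionRing (MvPolynomial (Fin 3) ℚ)

/-- The generic point `x = (x₁, x₂, x₃)` with coordinates in `ℚ(x)`; so `pair δ coord` is the
linear form `δ(x)` as an element of `ℚ(x)`. -/
def coord : Fin 3 → RatFun :=
  fun i => algebraMap (MvPolynomial (Fin 3) ℚ) RatFun (MvPolynomial.X i)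

/-- The denominator of `f`, written in lowest terms, does not vanish at `x`. -/
def RegularAt (f : RatFun) (x : Fin 3 → ℂ) : Prop :=
  MvPolynomial.aeval x
    (IsFractionRing.den (MvPolynomial (Fin 3) ℚ) f : MvPolynomial (Fin 3) ℚ) ≠ 0

/-- The value at `x` of a rational function that is regular at `x`. -/
def ratEval (f : RatFun) (x : Fin 3 → ℂ) : ℂ :=
  MvPolynomial.aeval x (IsFractionRing.num (MvPolynomial (Fin 3) ℚ) f) /
    MvPolynomial.aeval x
      (IsFractionRing.den (MvPolynomial (Fin 3) ℚ) f : MvPolynomial (Fin 3) ℚ)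

/-- The value `p(w, x)` of `p ∈ ℚ(x)[w]`. -/
def polyEval (p : RatFun[X]) (w : ℂ) (x : Fin 3 → ℂ) : ℂ :=
  p.sum fun k c => ratEval c x * w ^ k

/-- The substitution `f(x) ↦ f(g x)` on polynomials, for `g ∈ SL₃(ℤ)`. -/
def polySubst (g : Matrix.SpecialLinearGroup (Fin 3) ℤ) :
    MvPolynomial (Fin 3) ℚ →ₐ[ℚ] MvPolynomial (Fin 3) ℚ :=
  MvPolynomial.aeval fun i => pair (fun j => g.1 i j) MvPolynomial.X

theorem polySubst_comp (g h : Matrix.SpecialLinearGroup (Fin 3) ℤ) (hgh : h * g = 1) :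
    (polySubst g).comp (polySubst h) = AlgHom.id ℚ _ := by
  refine MvPolynomial.algHom_ext fun i => ?_
  have hm : ∀ k, ∑ j, h.1 i j * g.1 j k = (1 : Matrix (Fin 3) (Fin 3) ℤ) i k := by
    intro k
    have h1 : h.1 * g.1 = 1 := by
      rw [← Matrix.SpecialLinearGroup.coe_one, ← hgh]; rfl
    rw [← h1, Matrix.mul_apply]
  simp only [AlgHom.comp_apply, polySubst, MvPolynomial.aeval_X, pair, map_sum, map_zsmul,
    Finset.smul_sum, smul_smul, AlgHom.id_apply]
  rw [Finset.sum_comm]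
  simp only [← Finset.sum_smul, hm]
  simp [Matrix.one_apply]

/-- The substitution `f(x) ↦ f(g x)` on rational functions, for `g ∈ SL₃(ℤ)`. -/
def ratSubst (g : Matrix.SpecialLinearGroup (Fin 3) ℤ) : RatFun ≃+* RatFun :=
  IsFractionRing.ringEquivOfRingEquiv
    (AlgEquiv.ofAlgHom (polySubst g) (polySubst g⁻¹)
      (polySubst_comp g g⁻¹ (inv_mul_cancel g))
      (polySubst_comp g⁻¹ g (mul_inv_cancel g))).toRingEquiv

/-- The multiple Bernoulli polynomial `B_{r,n}(w, x₁, …, x_r)`, a polynomial in `w` (for nonzero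
`xⱼ`), given by `e^{wt} ∏ⱼ t / (e^{xⱼ t} - 1) = ∑ₙ B_{r,n}(w, x) tⁿ / n!`. The series
`(e^{xt} - 1) / t` is `∑ₖ x^{k+1} tᵏ / (k+1)!`. -/
def multiBernoulli {F : Type*} [Field F] (r n : ℕ) (x : Fin r → F) : F[X] :=
  (n.factorial : F[X]) * PowerSeries.coeff n
    ((PowerSeries.mk fun k => Polynomial.C (1 / (k.factorial : F)) * Polynomial.X ^ k) *
      PowerSeries.map Polynomial.C
        (∏ j, (PowerSeries.mk fun k => x j ^ (k + 1) / ((k + 1).factorial : F))⁻¹))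

/-- The polynomial `P₃(w, x₁, x₂, x₃)` in `w`. -/
def P₃ {F : Type*} [Field F] (x₁ x₂ x₃ : F) : F[X] :=
  Polynomial.C (1 / (x₁ * x₂ * x₃)) * Polynomial.X ^ 3
  - Polynomial.C (3 * ((x₁ + x₂ + x₃) / (2 * x₁ * x₂ * x₃))) * Polynomial.X ^ 2
  + Polynomial.C ((x₁ ^ 2 + x₂ ^ 2 + x₃ ^ 2 + 3 * x₁ * x₂ + 3 * x₂ * x₃ + 3 * x₁ * x₃)
      / (2 * x₁ * x₂ * x₃)) * Polynomial.X
  - Polynomial.C (1 / 4 * (x₁ + x₂ + x₃) * (1 / x₁ + 1 / x₂ + 1 / x₃))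

/-- The lattice points `F(a, b, c)` of the half-open parallelepiped spanned by the direction
vectors of `(b, c)`, `(c, a)`, `(a, b)`. -/
def parallelepiped (a b c : Lattice3) : Set Lattice3 :=
  {δ | (0 ≤ pair δ a ∧ pair δ a < pair (dirVec b c) a) ∧
    (0 ≤ pair δ b ∧ pair δ b < pair (dirVec c a) b) ∧
    (0 ≤ pair δ c ∧ pair δ c < pair (dirVec a b) c)}

end EllGamma

end

/-!
Let `ξ₀, ξ₁, ξ₂` be the direction vectors dual to linearly independent `a, b, c`. Grouping the
classes of each cone by the lattice points `δ` of the parallelepiped spanned by the `ξⱼ` turns the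
three gamma functions into products over `δ` of triples of double products with the periods
`yⱼ = ξⱼ(x)`, and one triple at a time remains. Expanding its logarithm, one finds `2πi` times the
sum of the residues of `e^{wt} / (t ∏ⱼ (e^{yⱼt} - 1))` at the points `t = 2πik / yⱼ`, `k ≠ 0`.
The residue at `t = 0` is `B_{3,3}(w, y) / 3!`, and for `w` in the interior of the zonotope
`∑ⱼ [0, 1] yⱼ` the integrals over suitable growing circles tend to zero, so that all residues sum
to zero. The identity extends to all `w` by analyticity. If `a, b, c` are coplanar, the cone of
one of the wedges is cut into the cones of the other two, and the three gamma functions multiply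
to `1`.
-/

noncomputable section

namespace EllGamma

/-! ### A residue theorem on discs -/

section ResidueTheorem

open Filter Topology Metric Set

theorem tendsto_sub_mul_nhdsNE_zero {g : ℂ → ℂ} {p : ℂ} (hg : ContinuousAt g p) :
    Tendsto (fun z => (z - p) * g z) (𝓝[≠] p) (𝓝 0) := by
  have h : ContinuousAt (fun z => (z - p) * g z) p := by fun_prop
  have h' := h.tendsto
  rw [sub_self, zero_mul] at h'
  exact h'.mono_left nhdsWithin_le_nhds

theorem tendsto_limUnder_of_tendsto_sub_mul_zero {g : ℂ → ℂ} {p : ℂ}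
    (hd : ∀ᶠ z in 𝓝[≠] p, DifferentiableAt ℂ g z)
    (hlim : Tendsto (fun z => (z - p) * g z) (𝓝[≠] p) (𝓝 0)) :
    Tendsto g (𝓝[≠] p) (𝓝 (limUnder (𝓝[≠] p) g)) := by
  refine Complex.tendsto_limUnder_of_differentiable_on_punctured_nhds_of_isLittleO hd ?_
  rw [Asymptotics.isLittleO_iff_tendsto' ?_]
  · refine Tendsto.congr (fun z => ?_)
      (by simpa using hlim.sub (tendsto_sub_mul_nhdsNE_zero continuousAt_const :
        Tendsto (fun z => (z - p) * g p) (𝓝[≠] p) (𝓝 0)))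
    rw [div_inv_eq_mul]
    ring
  · filter_upwards [self_mem_nhdsWithin] with z hz h
    exact absurd (sub_eq_zero.mp (inv_eq_zero.mp h)) hz

theorem circleIntegral_eq_zero_of_removable {g : ℂ → ℂ} {S : Finset ℂ} {c : ℂ} {R : ℝ}
    (hR : 0 ≤ R) (hS : ∀ p ∈ S, p ∈ ball c R)
    (hd : ∀ z ∈ closedBall c R, z ∉ S → DifferentiableAt ℂ g z)
    (hlim : ∀ p ∈ S, Tendsto (fun z => (z - p) * g z) (𝓝[≠] p) (𝓝 0)) :
    (∮ z in C(c, R), g z) = 0 := by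
  classical
  set h : ℂ → ℂ := fun z => if z ∈ S then limUnder (𝓝[≠] z) g else g z
  have hgh : ∀ z ∉ S, h z = g z := fun z hz => if_neg hz
  have hevS : ∀ z, ∀ᶠ z' in 𝓝[≠] z, z' ∉ S := fun z => by
    filter_upwards [nhdsWithin_le_nhds ((S.erase z).finite_toSet.isClosed.isOpen_compl.mem_nhds
      (by simp)), self_mem_nhdsWithin] with z' hz' hne hmem
    exact hz' (Finset.mem_coe.mpr (Finset.mem_erase.mpr ⟨hne, hmem⟩))
  have hdh : ∀ z ∈ closedBall c R, z ∉ S → DifferentiableAt ℂ h z := fun z hz hzS =>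
    (hd z hz hzS).congr_of_eventuallyEq <| by
      filter_upwards [S.finite_toSet.isClosed.isOpen_compl.mem_nhds hzS] with z' hz'
      exact hgh z' hz'
  have hcont : ContinuousOn h (closedBall c R) := fun z hz => by
    refine ContinuousAt.continuousWithinAt ?_
    by_cases hzS : z ∈ S
    · rw [← continuousWithinAt_compl_self, ContinuousWithinAt, show h z = _ from if_pos hzS]
      refine (tendsto_limUnder_of_tendsto_sub_mul_zero ?_ (hlim z hzS)).congr' ?_
      · filter_upwards [hevS z, nhdsWithin_le_nhds (isOpen_ball.mem_nhds (hS z hzS))]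
          with z' hz' hball
        exact hd z' (ball_subset_closedBall hball) hz'
      · filter_upwards [hevS z] with z' hz'
        exact (hgh z' hz').symm
    · exact (hdh z hz hzS).continuousAt
  rw [circleIntegral.integral_congr hR (g := h)]
  · exact Complex.circleIntegral_eq_zero_of_differentiable_on_off_countable hR
      S.finite_toSet.countable hcont
      fun z hz => hdh z (ball_subset_closedBall hz.1) hz.2
  · intro z hz
    refine (hgh z fun hzS => ?_).symm
    exact (mem_ball.mp (hS z hzS)).ne (mem_sphere.mp hz)

theorem circleIntegral_eval_sub_inv (P : ℂ[X]) {c p : ℂ} {R : ℝ} (hp : p ∈ ball c R) :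
    (∮ z in C(c, R), P.eval (z - p)⁻¹) = 2 * Real.pi * Complex.I * P.coeff 1 := by
  have hzpow : ∀ (k : ℕ) (z : ℂ), ((z - p)⁻¹) ^ k = (z - p) ^ (-(k : ℤ)) := fun k z => by
    rw [zpow_neg, inv_pow, zpow_natCast]
  have hsph : p ∉ sphere c |R| := fun h => by
    have hp' := mem_ball.mp hp
    rw [mem_sphere, abs_of_pos (dist_nonneg.trans_lt hp')] at h
    exact hp'.ne h
  simp only [Polynomial.eval_eq_sum_range, hzpow]
  have hint : ∀ k : ℕ, CircleIntegrable (fun z => P.coeff k * (z - p) ^ (-(k : ℤ))) c R :=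
    fun k => IntervalIntegrable.const_mul
      (circleIntegrable_sub_zpow_iff.mpr (Or.inr (Or.inr hsph))) _
  rw [circleIntegral.integral_fun_sum fun k _ => hint k, Finset.sum_eq_single 1]
  · simp only [Nat.cast_one, zpow_neg_one]
    rw [circleIntegral.integral_const_mul, circleIntegral.integral_sub_inv_of_mem_ball hp, mul_comm]
  · intro k _ hk
    rw [circleIntegral.integral_const_mul, circleIntegral.integral_sub_zpow_of_ne (by omega),
      mul_zero]
  · intro h
    have hdeg : P.natDegree < 1 := by simpa using h
    simp [Polynomial.coeff_eq_zero_of_natDegree_lt hdeg, circleIntegral]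

/-- `P` is a principal part of `f` at `p`. The statement allows a constant term in `P`, which is
irrelevant, and forces the singularity of `f z - P (1 / (z - p))` at `p` to be removable. -/
def HasPrincipalPart (f : ℂ → ℂ) (p : ℂ) (P : ℂ[X]) : Prop :=
  Tendsto (fun z => (z - p) * (f z - P.eval (z - p)⁻¹)) (𝓝[≠] p) (𝓝 0)

theorem hasPrincipalPart_of_tendsto {f : ℂ → ℂ} {p r : ℂ}
    (h : Tendsto (fun z => (z - p) * f z) (𝓝[≠] p) (𝓝 r)) :
    HasPrincipalPart f p (Polynomial.C r * Polynomial.X) := by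
  refine Tendsto.congr' ?_ (by simpa using h.sub_const r)
  filter_upwards [self_mem_nhdsWithin] with z hz
  have hz' : z - p ≠ 0 := sub_ne_zero.mpr hz
  simp only [Polynomial.eval_mul, Polynomial.eval_C, Polynomial.eval_X]
  field_simp

theorem circleIntegral_eq_sum_coeff_one {ι : Type*} {f : ℂ → ℂ} {T : Finset ι} {p : ι → ℂ}
    {P : ι → ℂ[X]} {c : ℂ} {R : ℝ} (hR : 0 ≤ R) (hinj : InjOn p T) (hp : ∀ i ∈ T, p i ∈ ball c R)
    (hf : ∀ z ∈ closedBall c R, (∀ i ∈ T, z ≠ p i) → DifferentiableAt ℂ f z)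
    (hP : ∀ i ∈ T, HasPrincipalPart f (p i) (P i)) :
    (∮ z in C(c, R), f z) = 2 * Real.pi * Complex.I * ∑ i ∈ T, (P i).coeff 1 := by
  classical
  have hdiff : ∀ i, ∀ z, z ≠ p i → DifferentiableAt ℂ (fun z => (P i).eval (z - p i)⁻¹) z :=
    fun i z hz => (P i).differentiable.differentiableAt.comp z
      ((differentiableAt_id.sub_const _).inv (sub_ne_zero.mpr hz))
  have hsum : ∀ (T' : Finset ι) (z : ℂ), (∀ i ∈ T', z ≠ p i) →
      DifferentiableAt ℂ (fun z => ∑ i ∈ T', (P i).eval (z - p i)⁻¹) z := fun T' z hz =>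
    DifferentiableAt.fun_sum fun i hi => hdiff i z (hz i hi)
  have hsphere : ∀ z ∈ sphere c R, ∀ i ∈ T, z ≠ p i := fun z hz i hi h =>
    (mem_ball.mp (hp i hi)).ne (h ▸ mem_sphere.mp hz)
  have hzero : (∮ z in C(c, R), (f z - ∑ i ∈ T, (P i).eval (z - p i)⁻¹)) = 0 := by
    refine circleIntegral_eq_zero_of_removable (S := T.image p) hR
      (Finset.forall_mem_image.mpr hp) ?_ (Finset.forall_mem_image.mpr fun i hi => ?_)
    · intro z hz hzS
      have hz' : ∀ i ∈ T, z ≠ p i := fun i hi h => hzS (h ▸ Finset.mem_image_of_mem p hi)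
      exact (hf z hz hz').sub (hsum T z hz')
    · have hrest := tendsto_sub_mul_nhdsNE_zero (hsum (T.erase i) (p i) fun k hk h =>
        (Finset.mem_erase.mp hk).1 (hinj (Finset.mem_erase.mp hk).2 hi h.symm)).continuousAt
      refine Tendsto.congr (fun z => ?_) (by simpa using (hP i hi).sub hrest)
      rw [← Finset.add_sum_erase T _ hi]
      ring
  have hint : ∀ {g : ℂ → ℂ}, (∀ z ∈ sphere c R, DifferentiableAt ℂ g z) →
      CircleIntegrable g c R := fun hg =>
    ContinuousOn.circleIntegrable hR fun z hz => (hg z hz).continuousAt.continuousWithinAt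
  rw [circleIntegral.integral_sub
    (hint fun z hz => hf z (sphere_subset_closedBall hz) (hsphere z hz))
    (hint fun z hz => hsum T z (hsphere z hz)), sub_eq_zero, circleIntegral.integral_fun_sum
    fun i hi => hint fun z hz => hdiff i z (hsphere z hz i hi)] at hzero
  rw [hzero, Finset.mul_sum]
  exact Finset.sum_congr rfl fun i hi => circleIntegral_eval_sub_inv (P i) (hp i hi)

end ResidueTheorem

/-! ### Asymptotic expansions at the origin -/

section AsymptoticExpansion

open Filter Topology Asymptotics

variable {𝕜 : Type*} [NontriviallyNormedField 𝕜] {f g : 𝕜 → 𝕜} {A B : PowerSeries 𝕜}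

/-- The power series `A`, convergent or not, is the asymptotic expansion of `f` at the punctured
origin; the value `f 0` plays no role. -/
def HasAsymptoticExpansion (f : 𝕜 → 𝕜) (A : PowerSeries 𝕜) : Prop :=
  ∀ n : ℕ, (fun t => f t - (PowerSeries.trunc n A).eval t) =O[𝓝[≠] 0] fun t => t ^ n

theorem HasAsymptoticExpansion.isBigO_one (hf : HasAsymptoticExpansion f A) :
    f =O[𝓝[≠] 0] fun _ => (1 : 𝕜) := by
  simpa using hf 0

theorem isBigO_eval_trunc_mul_sub (A B : PowerSeries 𝕜) (n : ℕ) :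
    (fun t => (PowerSeries.trunc n A).eval t * (PowerSeries.trunc n B).eval t
      - (PowerSeries.trunc n (A * B)).eval t) =O[𝓝 (0 : 𝕜)] fun t => t ^ n := by
  have hdvd : Polynomial.X ^ n ∣
      PowerSeries.trunc n A * PowerSeries.trunc n B - PowerSeries.trunc n (A * B) := by
    refine Polynomial.X_pow_dvd_iff.mpr fun d hd => ?_
    rw [Polynomial.coeff_sub, PowerSeries.coeff_trunc, if_pos hd,
      PowerSeries.coeff_mul_eq_coeff_trunc_mul_trunc A B hd, ← Polynomial.coe_mul,
      Polynomial.coeff_coe, sub_self]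
  obtain ⟨Q, hQ⟩ := hdvd
  have hQ' : ∀ t : 𝕜, (PowerSeries.trunc n A).eval t * (PowerSeries.trunc n B).eval t
      - (PowerSeries.trunc n (A * B)).eval t = t ^ n * Q.eval t := fun t => by
    rw [← Polynomial.eval_mul, ← Polynomial.eval_sub, hQ, Polynomial.eval_mul,
      Polynomial.eval_pow, Polynomial.eval_X]
  simp only [hQ']
  simpa using (isBigO_refl (fun t : 𝕜 => t ^ n) (𝓝 0)).mul
    ((Q.continuous.tendsto 0).isBigO_one 𝕜)

theorem isBigO_eval_one (P : 𝕜[X]) : (fun t => P.eval t) =O[𝓝[≠] 0] fun _ => (1 : 𝕜) :=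
  ((P.continuous.tendsto 0).mono_left nhdsWithin_le_nhds).isBigO_one 𝕜

theorem HasAsymptoticExpansion.isBigO_mul_sub (hf : HasAsymptoticExpansion f A)
    (hg : g =O[𝓝[≠] 0] fun _ => (1 : 𝕜)) (n : ℕ)
    (hgB : (fun t => g t - (PowerSeries.trunc n B).eval t) =O[𝓝[≠] 0] fun t => t ^ n) :
    (fun t => f t * g t - (PowerSeries.trunc n (A * B)).eval t) =O[𝓝[≠] 0] fun t => t ^ n := by
  have hf' := (hf n).mul hg
  have hg' := (isBigO_eval_one (PowerSeries.trunc n A)).mul hgB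
  simp only [mul_one, one_mul] at hf' hg'
  refine ((hf'.add hg').add
    ((isBigO_eval_trunc_mul_sub A B n).mono nhdsWithin_le_nhds)).congr_left fun t => ?_
  ring

theorem HasAsymptoticExpansion.mul (hf : HasAsymptoticExpansion f A)
    (hg : HasAsymptoticExpansion g B) : HasAsymptoticExpansion (fun t => f t * g t) (A * B) :=
  fun n => hf.isBigO_mul_sub hg.isBigO_one n (hg n)

theorem hasAsymptoticExpansion_one : HasAsymptoticExpansion (fun _ : 𝕜 => 1) 1 := by
  rintro (_ | n)
  · simpa using isBigO_refl (fun _ : 𝕜 => (1 : 𝕜)) (𝓝[≠] 0)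
  · simpa using isBigO_zero (fun t : 𝕜 => t ^ (n + 1)) (𝓝[≠] 0)

theorem HasAsymptoticExpansion.prod {ι : Type*} (s : Finset ι) {f : ι → 𝕜 → 𝕜}
    {A : ι → PowerSeries 𝕜} (h : ∀ i ∈ s, HasAsymptoticExpansion (f i) (A i)) :
    HasAsymptoticExpansion (fun t => ∏ i ∈ s, f i t) (∏ i ∈ s, A i) := by
  induction s using Finset.cons_induction with
  | empty => simpa using hasAsymptoticExpansion_one
  | cons i s hi ih =>
    simp only [Finset.prod_cons]
    exact (h i (Finset.mem_cons_self i s)).mul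
      (ih fun j hj => h j (Finset.mem_cons_of_mem hj))

theorem HasAsymptoticExpansion.tendsto_constantCoeff (hf : HasAsymptoticExpansion f A) :
    Tendsto f (𝓝[≠] 0) (𝓝 (PowerSeries.constantCoeff A)) := by
  have hid : Tendsto (fun t : 𝕜 => t ^ 1) (𝓝[≠] 0) (𝓝 0) := by
    simpa using (continuous_pow (M := 𝕜) 1).tendsto' 0 0 (by simp) |>.mono_left nhdsWithin_le_nhds
  have h := ((hf 1).trans_tendsto hid).add_const (PowerSeries.constantCoeff A)
  simpa [PowerSeries.trunc_succ] using h

theorem HasAsymptoticExpansion.inv (hf : HasAsymptoticExpansion f A)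
    (hA : PowerSeries.constantCoeff A ≠ 0) :
    HasAsymptoticExpansion (fun t => (f t)⁻¹) A⁻¹ := by
  intro n
  have hfinv : (fun t => (f t)⁻¹) =O[𝓝[≠] 0] fun _ => (1 : 𝕜) :=
    (hf.tendsto_constantCoeff.inv₀ hA).isBigO_one 𝕜
  set P := PowerSeries.trunc n A⁻¹
  have hmul : (fun t => 1 - f t * P.eval t) =O[𝓝[≠] 0] fun t => t ^ n := by
    have h := hf.isBigO_mul_sub (B := A⁻¹) (isBigO_eval_one P) n (by simp [P, isBigO_zero])
    rw [PowerSeries.mul_inv_cancel A hA] at h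
    exact ((hasAsymptoticExpansion_one n).sub h).congr_left fun t => by ring
  refine (hfinv.mul hmul).congr' ?_ (by simp)
  filter_upwards [hf.tendsto_constantCoeff.eventually_ne hA] with t ht
  field_simp

theorem eval_trunc_eq_sum_range (A : PowerSeries 𝕜) (n : ℕ) (t : 𝕜) :
    (PowerSeries.trunc n A).eval t = ∑ k ∈ Finset.range n, PowerSeries.coeff k A * t ^ k :=
  PowerSeries.eval₂_trunc_eq_sum_range t (RingHom.id 𝕜) n A

theorem HasAsymptoticExpansion.sub_constantCoeff_div (hf : HasAsymptoticExpansion f A) :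
    HasAsymptoticExpansion (fun t => (f t - PowerSeries.constantCoeff A) / t)
      (PowerSeries.mk fun k => PowerSeries.coeff (k + 1) A) := by
  intro n
  refine ((hf (n + 1)).mul (isBigO_refl (fun t : 𝕜 => t⁻¹) _)).congr' ?_ ?_
  all_goals
    filter_upwards [self_mem_nhdsWithin] with t ht
    have ht' : t ≠ 0 := ht
  · rw [eval_trunc_eq_sum_range, eval_trunc_eq_sum_range, Finset.sum_range_succ']
    simp only [PowerSeries.coeff_mk, pow_succ, pow_zero, mul_one, ← mul_assoc, ← Finset.sum_mul,
      PowerSeries.coeff_zero_eq_constantCoeff]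
    field_simp
    ring
  · rw [pow_succ, mul_inv_cancel_right₀ ht']

end AsymptoticExpansion

section ComplexExpansion

open Filter Topology Asymptotics

theorem hasAsymptoticExpansion_exp_mul (w : ℂ) :
    HasAsymptoticExpansion (fun t => Complex.exp (w * t))
      (PowerSeries.mk fun k => w ^ k / (k.factorial : ℂ)) := by
  intro n
  have hw : Tendsto (fun t : ℂ => w * t) (𝓝[≠] 0) (𝓝 0) :=
    ((continuous_const_mul w).tendsto' 0 0 (mul_zero w)).mono_left nhdsWithin_le_nhds
  refine (((Complex.exp_sub_sum_range_isBigO_pow n).comp_tendsto hw).congr_left fun t => ?_).trans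
    ?_
  · simp only [Function.comp_apply, eval_trunc_eq_sum_range, PowerSeries.coeff_mk, mul_pow]
    congr 1
    exact Finset.sum_congr rfl fun k _ => by ring
  · simp only [Function.comp_def, mul_pow]
    exact isBigO_const_mul_self _ _ _

theorem hasAsymptoticExpansion_exp_mul_sub_one_div (x : ℂ) :
    HasAsymptoticExpansion (fun t => (Complex.exp (x * t) - 1) / t)
      (PowerSeries.mk fun k => x ^ (k + 1) / ((k + 1).factorial : ℂ)) := by
  simpa [← PowerSeries.coeff_zero_eq_constantCoeff_apply] using
    (hasAsymptoticExpansion_exp_mul x).sub_constantCoeff_div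

theorem HasAsymptoticExpansion.hasPrincipalPart {f : ℂ → ℂ} {A : PowerSeries ℂ}
    (hf : HasAsymptoticExpansion f A) (n : ℕ) :
    HasPrincipalPart (fun t => f t / t ^ (n + 1)) 0
      (Polynomial.reflect (n + 1) (PowerSeries.trunc (n + 1) A)) := by
  have h : (fun t => (f t - (PowerSeries.trunc (n + 1) A).eval t) / t ^ n)
      =O[𝓝[≠] 0] fun t => t := by
    refine ((hf (n + 1)).mul (isBigO_refl (fun t : ℂ => (t ^ n)⁻¹) _)).congr' ?_ ?_
    · simp only [div_eq_mul_inv]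
      rfl
    · filter_upwards [self_mem_nhdsWithin] with t ht
      have ht' : t ≠ 0 := ht
      rw [pow_succ', mul_assoc, mul_inv_cancel₀ (pow_ne_zero n ht'), mul_one]
  refine (h.trans_tendsto (tendsto_id.mono_left nhdsWithin_le_nhds)).congr' ?_
  filter_upwards [self_mem_nhdsWithin] with t ht
  have ht' : t ≠ 0 := ht
  let _ := invertibleOfNonzero ht'
  have hrefl := Polynomial.eval₂_reflect_mul_pow (RingHom.id ℂ) t (n + 1)
    (PowerSeries.trunc (n + 1) A) (PowerSeries.natDegree_trunc_lt A n).le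
  rw [invOf_eq_inv] at hrefl
  rw [sub_zero, Polynomial.eval, ← hrefl, Polynomial.eval, pow_succ]
  field_simp

theorem coeff_one_reflect_trunc {R : Type*} [Semiring R] (A : PowerSeries R) (n : ℕ) :
    (Polynomial.reflect (n + 1) (PowerSeries.trunc (n + 1) A)).coeff 1 =
      PowerSeries.coeff n A := by
  rw [Polynomial.coeff_reflect, Polynomial.revAt_le (by omega), Nat.add_sub_cancel,
    PowerSeries.coeff_trunc, if_pos n.lt_succ_self]

end ComplexExpansion

section Estimates

theorem min_le_norm_exp_sub_one {η : ℝ} {z : ℂ}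
    (hz : ∀ k : ℤ, η ≤ ‖z - 2 * Real.pi * Complex.I * k‖) :
    min (1 / 2) (2 / 3 * η) ≤ ‖Complex.exp z - 1‖ := by
  rcases le_total ‖Complex.exp z - 1‖ (1 / 2) with hsmall | hlarge
  · have hlog := Complex.norm_log_one_add_half_le_self hsmall
    rw [add_sub_cancel] at hlog
    obtain ⟨n, hn⟩ := Complex.exp_eq_exp_iff_exists_int.mp
      (Complex.exp_log (Complex.exp_ne_zero z)).symm
    have hη : η ≤ ‖Complex.log (Complex.exp z)‖ := by
      convert hz n using 2
      linear_combination -hn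
    exact (min_le_right _ _).trans (by linarith)
  · exact (min_le_left _ _).trans hlarge

theorem mul_exp_max_le_norm_exp_sub_one {η : ℝ} {z : ℂ}
    (hz : ∀ k : ℤ, η ≤ ‖z - 2 * Real.pi * Complex.I * k‖) :
    min (1 / 2) (2 / 3 * η) * Real.exp (max z.re 0) ≤ ‖Complex.exp z - 1‖ := by
  rcases le_total z.re 0 with hre | hre
  · rw [max_eq_right hre, Real.exp_zero, mul_one]
    exact min_le_norm_exp_sub_one hz
  · have hneg := min_le_norm_exp_sub_one (z := -z) (η := η) fun k => by
      rw [← norm_neg]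
      convert hz (-k) using 1
      push_cast
      ring_nf
    have hfactor : Complex.exp z - 1 = -(Complex.exp (-z) - 1) * Complex.exp z := by
      rw [neg_mul, sub_mul, ← Complex.exp_add, neg_add_cancel, Complex.exp_zero]
      ring
    rw [max_eq_left hre, hfactor, norm_mul, norm_neg, Complex.norm_exp]
    gcongr

theorem exists_ge_forall_le_abs_sub_mul {ι : Type*} [Finite ι] {c : ι → ℝ} (hc : ∀ j, 0 < c j) :
    ∃ d > 0, ∀ R₀ : ℝ, ∃ R ≥ R₀, ∀ j, ∀ k : ℤ, d ≤ |R - c j * k| := by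
  cases nonempty_fintype ι
  cases isEmpty_or_nonempty ι
  · exact ⟨1, one_pos, fun R₀ => ⟨R₀, le_rfl, isEmptyElim⟩⟩
  obtain ⟨j₀, hj₀⟩ := Finite.exists_min c
  obtain ⟨s, hs, hsc⟩ : ∃ s > 0, ∀ j, (Fintype.card ι + 1) * s ≤ c j :=
    ⟨c j₀ / (Fintype.card ι + 1), div_pos (hc j₀) (by positivity), fun j => by
      rw [mul_div_cancel₀ _ (by positivity)]
      exact hj₀ j⟩
  refine ⟨s / 2, half_pos hs, fun R₀ => ?_⟩
  -- Two of the `|ι| + 1` candidates `R₀ + i s` would be close to multiples of the same `c j`, which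
  -- are at least `(|ι| + 1) s` apart.
  by_contra! hcon
  have hclose : ∀ i : Fin (Fintype.card ι + 1), ∃ j, ∃ k : ℤ, |R₀ + i * s - c j * k| < s / 2 :=
    fun i => hcon (R₀ + i * s) (le_add_of_nonneg_right (by positivity))
  choose J K hJK using hclose
  obtain ⟨i, i', hne, hJ⟩ := Fintype.exists_ne_map_eq_of_card_lt J (by simp)
  wlog hlt : i < i' generalizing i i'
  · exact this i' i hne.symm hJ.symm (lt_of_le_of_ne (not_lt.mp hlt) hne.symm)
  obtain ⟨hi₁, hi₂⟩ := abs_lt.mp (hJK i)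
  obtain ⟨hi'₁, hi'₂⟩ := abs_lt.mp (hJK i')
  rw [hJ] at hi₁ hi₂
  have hstep : (i : ℝ) + 1 ≤ i' := by exact_mod_cast hlt
  have hcard : (i' : ℝ) ≤ Fintype.card ι := by exact_mod_cast Nat.lt_succ_iff.mp i'.isLt
  have hK : (0 : ℝ) < K i' - K i := by
    nlinarith [hc (J i'), mul_le_mul_of_nonneg_right hstep hs.le]
  have hK' : (1 : ℝ) ≤ K i' - K i := by
    have hK₀ : K i < K i' := by exact_mod_cast sub_pos.mp hK
    have hK₁ : (K i : ℝ) + 1 ≤ K i' := by exact_mod_cast hK₀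
    linarith
  nlinarith [hc (J i'), hsc (J i'), mul_le_mul_of_nonneg_right hcard hs.le,
    mul_nonneg (Nat.cast_nonneg (α := ℝ) i) hs.le, mul_le_mul_of_nonneg_left hK' (hc (J i')).le]

end Estimates

/-! ### The residue theorem for the generating function of the multiple Bernoulli polynomials -/

theorem eval_multiBernoulli {F : Type*} [Field F] (r n : ℕ) (x : Fin r → F) (w : F) :
    (multiBernoulli r n x).eval w = n.factorial * PowerSeries.coeff n
      ((PowerSeries.mk fun k => w ^ k / (k.factorial : F)) *
        ∏ j, (PowerSeries.mk fun k => x j ^ (k + 1) / ((k + 1).factorial : F))⁻¹) := by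
  rw [multiBernoulli, Polynomial.eval_mul, Polynomial.eval_natCast,
    ← Polynomial.coe_evalRingHom w, ← PowerSeries.coeff_map, map_mul]
  congr 3
  · ext k
    simp [div_eq_inv_mul]
  · ext k
    simp only [PowerSeries.coeff_map, Polynomial.coe_evalRingHom, Polynomial.eval_C]

section Kernel

open Filter Topology Metric Set

variable {r : ℕ}

/-- The generating function `e^{wt} / ∏ⱼ (e^{yⱼ t} - 1)` of the multiple Bernoulli polynomials,
divided by `t`, so that its residue at the origin is `B_{r,r}(w, y) / r!`. -/
def bernoulliKernel (y : Fin r → ℂ) (w t : ℂ) : ℂ :=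
  Complex.exp (w * t) / (t * ∏ j, (Complex.exp (y j * t) - 1))

/-- The zeros of `e^{xt} - 1` for `x ≠ 0`. -/
def expPole (x : ℂ) (k : ℤ) : ℂ := 2 * Real.pi * Complex.I * k / x

/-- The residue of `bernoulliKernel y w` at the simple pole `2πik / yⱼ`, `k ≠ 0`. It vanishes for
`k = 0`, because `1 / 0 = 0`. -/
def kernelResidue (y : Fin r → ℂ) (w : ℂ) (i : Fin r × ℤ) : ℂ :=
  Complex.exp (w * expPole (y i.1) i.2) / (expPole (y i.1) i.2 * y i.1 *
    ∏ j ∈ Finset.univ.erase i.1, (Complex.exp (y j * expPole (y i.1) i.2) - 1))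

theorem kernelResidue_zero_right (y : Fin r → ℂ) (w : ℂ) (j : Fin r) :
    kernelResidue y w (j, 0) = 0 := by
  simp [kernelResidue, expPole]

theorem exp_mul_eq_one_iff {x : ℂ} (hx : x ≠ 0) {t : ℂ} :
    Complex.exp (x * t) = 1 ↔ ∃ k : ℤ, t = expPole x k := by
  simp only [Complex.exp_eq_one_iff, expPole, eq_div_iff hx]
  exact exists_congr fun k => by rw [mul_comm x t, mul_comm (k : ℂ)]

theorem expPole_ne_zero {x : ℂ} (hx : x ≠ 0) {k : ℤ} (hk : k ≠ 0) : expPole x k ≠ 0 :=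
  div_ne_zero (mul_ne_zero Complex.two_pi_I_ne_zero (Int.cast_ne_zero.mpr hk)) hx

theorem norm_expPole (x : ℂ) (k : ℤ) : ‖expPole x k‖ = 2 * Real.pi / ‖x‖ * |(k : ℝ)| := by
  simp [expPole, abs_of_pos Real.pi_pos]
  ring

theorem hasPrincipalPart_bernoulliKernel_zero {y : Fin r → ℂ} (hy : ∀ j, y j ≠ 0) (w : ℂ) :
    ∃ P : ℂ[X], HasPrincipalPart (bernoulliKernel y w) 0 P ∧
      P.coeff 1 = (multiBernoulli r r y).eval w / r.factorial := by
  have hexp := (hasAsymptoticExpansion_exp_mul w).mul <| HasAsymptoticExpansion.prod Finset.univ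
    fun j _ => (hasAsymptoticExpansion_exp_mul_sub_one_div (y j)).inv (by simpa using hy j)
  have hkernel : (fun t => (Complex.exp (w * t) *
      ∏ j, ((Complex.exp (y j * t) - 1) / t)⁻¹) / t ^ (r + 1)) = bernoulliKernel y w := by
    funext t
    simp only [bernoulliKernel, inv_div, Finset.prod_div_distrib, Finset.prod_const,
      Finset.card_univ, Fintype.card_fin, pow_succ]
    rcases eq_or_ne t 0 with rfl | ht
    · simp
    · field_simp
  refine ⟨_, hkernel ▸ hexp.hasPrincipalPart r, ?_⟩
  rw [coeff_one_reflect_trunc, eval_multiBernoulli,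
    mul_div_cancel_left₀ _ (Nat.cast_ne_zero.mpr r.factorial_ne_zero)]

theorem differentiableAt_bernoulliKernel {y : Fin r → ℂ} (hy : ∀ j, y j ≠ 0) (w : ℂ) {t : ℂ}
    (ht : t ≠ 0) (hpole : ∀ j k, t ≠ expPole (y j) k) :
    DifferentiableAt ℂ (bernoulliKernel y w) t := by
  have hprod : ∏ j, (Complex.exp (y j * t) - 1) ≠ 0 := Finset.prod_ne_zero_iff.mpr fun j _ =>
    sub_ne_zero.mpr fun h => ((exp_mul_eq_one_iff (hy j)).mp h).elim (hpole j)
  unfold bernoulliKernel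
  fun_prop (disch := exact mul_ne_zero ht hprod)

theorem exp_mul_expPole_ne_one {x x' : ℂ} (h : (x * (starRingEnd ℂ) x').im ≠ 0) {k : ℤ}
    (hk : k ≠ 0) : Complex.exp (x' * expPole x k) ≠ 1 := by
  intro hone
  have hx : x ≠ 0 := fun hx => h (by simp [hx])
  obtain ⟨m, hm⟩ := Complex.exp_eq_one_iff.mp hone
  have hprop : (k : ℂ) * x' = m * x := by
    rw [expPole] at hm
    field_simp at hm
    linear_combination hm
  have him : (k : ℝ) * (x * (starRingEnd ℂ) x').im = 0 := by
    have hconj := congrArg (fun z => (x * (starRingEnd ℂ) z).im) hprop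
    simp only [map_mul, map_intCast, Complex.mul_im, Complex.mul_re, Complex.conj_re,
      Complex.conj_im, Complex.intCast_re, Complex.intCast_im] at hconj ⊢
    linear_combination hconj
  exact h ((mul_eq_zero.mp him).resolve_left (Int.cast_ne_zero.mpr hk))

theorem hasPrincipalPart_bernoulliKernel_expPole {y : Fin r → ℂ} (hy : ∀ j, y j ≠ 0)
    (hindep : Pairwise fun i j => (y i * (starRingEnd ℂ) (y j)).im ≠ 0) (w : ℂ) (j : Fin r)
    {k : ℤ} (hk : k ≠ 0) :
    HasPrincipalPart (bernoulliKernel y w) (expPole (y j) k)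
      (Polynomial.C (kernelResidue y w (j, k)) * Polynomial.X) := by
  refine hasPrincipalPart_of_tendsto ?_
  set p := expPole (y j) k with hp
  have hslope : Tendsto (fun t => (Complex.exp (y j * t) - 1) / (t - p)) (𝓝[≠] p) (𝓝 (y j)) := by
    have hone : Complex.exp (y j * p) = 1 := (exp_mul_eq_one_iff (hy j)).mpr ⟨k, hp⟩
    have hderiv : HasDerivAt (fun t => Complex.exp (y j * t)) (y j) p := by
      simpa [hone] using ((hasDerivAt_id p).const_mul (y j)).cexp
    refine hderiv.tendsto_slope.congr fun t => ?_
    rw [slope_def_field, hone]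
  have hrest : ∏ i ∈ Finset.univ.erase j, (Complex.exp (y i * p) - 1) ≠ 0 :=
    Finset.prod_ne_zero_iff.mpr fun i hi => sub_ne_zero.mpr <|
      exp_mul_expPole_ne_one (hindep (Finset.ne_of_mem_erase hi).symm) hk
  have hnum : Tendsto (fun t => Complex.exp (w * t) /
      (t * ∏ i ∈ Finset.univ.erase j, (Complex.exp (y i * t) - 1))) (𝓝[≠] p)
      (𝓝 (Complex.exp (w * p) / (p * ∏ i ∈ Finset.univ.erase j, (Complex.exp (y i * p) - 1)))) := by
    refine Tendsto.mono_left (ContinuousAt.tendsto ?_) nhdsWithin_le_nhds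
    fun_prop (disch := exact mul_ne_zero (expPole_ne_zero (hy j) hk) hrest)
  have hres : kernelResidue y w (j, k) = Complex.exp (w * p) /
      (p * ∏ i ∈ Finset.univ.erase j, (Complex.exp (y i * p) - 1)) / y j := by
    rw [kernelResidue, ← hp, div_div]
    ring
  rw [hres]
  refine (hnum.div hslope (hy j)).congr fun t => ?_
  rw [Pi.div_apply, bernoulliKernel, ← Finset.mul_prod_erase Finset.univ _ (Finset.mem_univ j)]
  simp only [div_eq_mul_inv, mul_inv, inv_inv]
  ring

theorem finite_setOf_norm_expPole_lt {ι : Type*} [Finite ι] {y : ι → ℂ} (hy : ∀ j, y j ≠ 0)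
    (R : ℝ) : {i : ι × ℤ | ‖expPole (y i.1) i.2‖ < R}.Finite := by
  set N : ι → ℤ := fun j => ⌈R / (2 * Real.pi / ‖y j‖)⌉
  refine Set.Finite.subset (finite_iUnion fun j =>
    (finite_singleton j).prod (finite_Icc (-N j) (N j))) fun ⟨j, k⟩ hjk => ?_
  have hpos : 0 < 2 * Real.pi / ‖y j‖ := div_pos Real.two_pi_pos (norm_pos_iff.mpr (hy j))
  rw [mem_ofPred_eq, norm_expPole, ← lt_div_iff₀' hpos] at hjk
  have hk : |k| ≤ N j := by
    exact_mod_cast (hjk.trans_le (Int.le_ceil _)).le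
  exact mem_iUnion.mpr ⟨j, rfl, abs_le.mp hk⟩

/-- The poles of `bernoulliKernel y w` other than the origin that lie in the disc of radius `R`,
together with the indices `(j, 0)`, which stand for the origin and carry no residue. -/
def polesInBall {y : Fin r → ℂ} (hy : ∀ j, y j ≠ 0) (R : ℝ) : Finset (Fin r × ℤ) :=
  (finite_setOf_norm_expPole_lt hy R).toFinset

theorem mem_polesInBall {y : Fin r → ℂ} (hy : ∀ j, y j ≠ 0) {R : ℝ} {i : Fin r × ℤ} :
    i ∈ polesInBall hy R ↔ ‖expPole (y i.1) i.2‖ < R := by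
  simp [polesInBall]

theorem tendsto_polesInBall {y : Fin r → ℂ} (hy : ∀ j, y j ≠ 0) :
    Tendsto (polesInBall hy) atTop atTop :=
  tendsto_atTop_finset_of_monotone
    (fun _ _ hR _ hi => (mem_polesInBall hy).mpr (((mem_polesInBall hy).mp hi).trans_le hR))
    fun _ => (exists_gt _).imp fun _ => (mem_polesInBall hy).mpr

theorem injOn_elim_expPole {y : Fin r → ℂ} (hy : ∀ j, y j ≠ 0)
    (hindep : Pairwise fun i j => (y i * (starRingEnd ℂ) (y j)).im ≠ 0)
    {T : Finset (Fin r × ℤ)} (hT : ∀ i ∈ T, i.2 ≠ 0) :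
    InjOn (fun o : Option (Fin r × ℤ) => o.elim 0 fun i => expPole (y i.1) i.2)
      (Finset.insertNone T) := by
  have hne : ∀ i ∈ T, expPole (y i.1) i.2 ≠ 0 := fun i hi => expPole_ne_zero (hy i.1) (hT i hi)
  rintro (_ | ⟨j, k⟩) ho (_ | ⟨j', k'⟩) ho' h
  · rfl
  · exact absurd h.symm (hne _ (Finset.some_mem_insertNone.mp ho'))
  · exact absurd h (hne _ (Finset.some_mem_insertNone.mp ho))
  · simp only [Option.elim] at h
    rcases eq_or_ne j j' with rfl | hj
    · rw [expPole, expPole, div_left_inj' (hy j), mul_right_inj' Complex.two_pi_I_ne_zero,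
        Int.cast_inj] at h
      rw [h]
    · exact absurd ((exp_mul_eq_one_iff (hy j')).mpr ⟨k', h⟩)
        (exp_mul_expPole_ne_one (hindep hj) (hT _ (Finset.some_mem_insertNone.mp ho)))

theorem circleIntegral_bernoulliKernel {y : Fin r → ℂ} (hy : ∀ j, y j ≠ 0)
    (hindep : Pairwise fun i j => (y i * (starRingEnd ℂ) (y j)).im ≠ 0) (w : ℂ) {R : ℝ}
    (hR : 0 < R) (hpole : ∀ j k, ‖expPole (y j) k‖ ≠ R) :
    (∮ t in C(0, R), bernoulliKernel y w t) = 2 * Real.pi * Complex.I *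
      ((multiBernoulli r r y).eval w / r.factorial +
        ∑ i ∈ polesInBall hy R, kernelResidue y w i) := by
  obtain ⟨P, hP, hP₁⟩ := hasPrincipalPart_bernoulliKernel_zero hy w
  set T := {i ∈ polesInBall hy R | i.2 ≠ 0}
  have hT : ∀ i ∈ T, ‖expPole (y i.1) i.2‖ < R ∧ i.2 ≠ 0 := fun i hi =>
    (Finset.mem_filter.mp hi).imp_left (mem_polesInBall hy).mp
  have hsum : ∑ i ∈ polesInBall hy R, kernelResidue y w i = ∑ i ∈ T, kernelResidue y w i := by
    refine (Finset.sum_filter_of_ne ?_).symm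
    rintro ⟨j, k⟩ _ hres rfl
    exact hres (kernelResidue_zero_right y w j)
  rw [circleIntegral_eq_sum_coeff_one (T := Finset.insertNone T)
    (p := fun o : Option (Fin r × ℤ) => o.elim 0 fun i => expPole (y i.1) i.2)
    (P := fun o : Option (Fin r × ℤ) =>
      o.elim P fun i => Polynomial.C (kernelResidue y w i) * Polynomial.X)
    hR.le (injOn_elim_expPole hy hindep fun i hi => (hT i hi).2), Finset.sum_insertNone, hsum]
  · simp [hP₁]
  · exact Finset.forall_mem_insertNone.mpr
      ⟨mem_ball_self hR, fun i hi => mem_ball_zero_iff.mpr (hT i hi).1⟩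
  · intro t ht hne
    rw [Finset.forall_mem_insertNone] at hne
    refine differentiableAt_bernoulliKernel hy w hne.1 fun j k h => ?_
    have hk : k ≠ 0 := fun hk => hne.1 (by rw [h, hk]; simp [expPole])
    have hlt : ‖expPole (y j) k‖ < R :=
      lt_of_le_of_ne (h ▸ mem_closedBall_zero_iff.mp ht) (hpole j k)
    exact hne.2 (j, k) (Finset.mem_filter.mpr ⟨(mem_polesInBall hy).mpr hlt, hk⟩) h
  · exact Finset.forall_mem_insertNone.mpr ⟨hP, fun i hi =>
      hasPrincipalPart_bernoulliKernel_expPole hy hindep w i.1 (hT i hi).2⟩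

end Kernel

section Zonotope

open Filter Topology Metric Set

variable {r : ℕ}

/-- `w` lies in the interior of the zonotope `∑ⱼ [0, 1] yⱼ`. The condition is expressed through the
support function `t ↦ ∑ⱼ max (Re (yⱼ t)) 0` of the zonotope; it says that `bernoulliKernel y w`
decays exponentially away from its poles. -/
def MemZonotopeInterior (y : Fin r → ℂ) (w : ℂ) : Prop :=
  ∃ δ > 0, ∀ t : ℂ, δ * ‖t‖ ≤ ∑ j, max (y j * t).re 0 - (w * t).re

theorem exists_norm_bernoulliKernel_le {y : Fin r → ℂ} (hy : ∀ j, y j ≠ 0) {d : ℝ} (hd : 0 < d) :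
    ∃ M > 0, ∀ w t : ℂ, (∀ j k, d ≤ |‖t‖ - ‖expPole (y j) k‖|) →
      ‖bernoulliKernel y w t‖ ≤
        M / ‖t‖ * Real.exp (-(∑ j, max (y j * t).re 0 - (w * t).re)) := by
  set m : Fin r → ℝ := fun j => min (1 / 2) (2 / 3 * (‖y j‖ * d))
  have hm : ∀ j, 0 < m j := fun j => by
    have := norm_pos_iff.mpr (hy j)
    positivity
  refine ⟨(∏ j, m j)⁻¹, inv_pos.mpr (Finset.prod_pos fun j _ => hm j), fun w t ht => ?_⟩
  have hfactor : ∀ j, m j * Real.exp (max (y j * t).re 0) ≤ ‖Complex.exp (y j * t) - 1‖ :=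
    fun j => mul_exp_max_le_norm_exp_sub_one fun k => by
      have hk : y j * t - 2 * Real.pi * Complex.I * k = y j * (t - expPole (y j) k) := by
        rw [mul_sub, expPole, mul_div_cancel₀ _ (hy j)]
      rw [hk, norm_mul]
      gcongr
      exact (ht j k).trans (abs_norm_sub_norm_le _ _)
  have hprod : (∏ j, m j) * Real.exp (∑ j, max (y j * t).re 0) ≤
      ∏ j, ‖Complex.exp (y j * t) - 1‖ := by
    rw [Real.exp_sum, ← Finset.prod_mul_distrib]
    exact Finset.prod_le_prod (fun j _ => by have := hm j; positivity) fun j _ => hfactor j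
  have hpos : 0 < ∏ j, m j := Finset.prod_pos fun j _ => hm j
  calc ‖bernoulliKernel y w t‖
      = Real.exp (w * t).re / ‖t‖ / ∏ j, ‖Complex.exp (y j * t) - 1‖ := by
        rw [bernoulliKernel, norm_div, norm_mul, norm_prod, Complex.norm_exp, div_div]
    _ ≤ Real.exp (w * t).re / ‖t‖ / ((∏ j, m j) * Real.exp (∑ j, max (y j * t).re 0)) := by
        gcongr
    _ = (∏ j, m j)⁻¹ / ‖t‖ * Real.exp (-(∑ j, max (y j * t).re 0 - (w * t).re)) := by
        rw [neg_sub, Real.exp_sub]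
        field_simp

theorem MemZonotopeInterior.frequently_norm_circleIntegral_le {y : Fin r → ℂ}
    (hy : ∀ j, y j ≠ 0) {w : ℂ} (hw : MemZonotopeInterior y w) :
    ∃ M δ : ℝ, 0 < δ ∧ ∃ᶠ R in atTop, (∀ j k, ‖expPole (y j) k‖ ≠ R) ∧
      ‖∮ t in C(0, R), bernoulliKernel y w t‖ ≤ M * Real.exp (-(δ * R)) := by
  obtain ⟨δ, hδ, hw⟩ := hw
  obtain ⟨d, hd, hradius⟩ := exists_ge_forall_le_abs_sub_mul (c := fun j => 2 * Real.pi / ‖y j‖)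
    fun j => div_pos Real.two_pi_pos (norm_pos_iff.mpr (hy j))
  obtain ⟨M, hM, hbound⟩ := exists_norm_bernoulliKernel_le hy hd
  refine ⟨2 * Real.pi * M, δ, hδ, frequently_atTop.mpr fun R₀ => ?_⟩
  obtain ⟨R, hR, hRd⟩ := hradius (max R₀ 1)
  have hR₁ : 0 < R := one_pos.trans_le ((le_max_right _ _).trans hR)
  have hRpole : ∀ j k, d ≤ |R - ‖expPole (y j) k‖| := fun j k => by
    simpa only [norm_expPole, Int.cast_abs] using hRd j |k|
  refine ⟨R, (le_max_left _ _).trans hR, fun j k h => ?_, ?_⟩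
  · have := hRpole j k
    rw [h, sub_self, abs_zero] at this
    exact hd.not_ge this
  · have hcircle : ∀ t ∈ sphere (0 : ℂ) R,
        ‖bernoulliKernel y w t‖ ≤ M / R * Real.exp (-(δ * R)) := fun t ht => by
      have ht' : ‖t‖ = R := mem_sphere_zero_iff_norm.mp ht
      refine (hbound w t (by simpa only [ht'] using hRpole)).trans ?_
      rw [ht']
      gcongr
      exact ht' ▸ hw t
    refine (circleIntegral.norm_integral_le_of_norm_le_const hR₁.le hcircle).trans_eq ?_
    field_simp

theorem MemZonotopeInterior.eq_neg_of_hasSum_kernelResidue {y : Fin r → ℂ} (hy : ∀ j, y j ≠ 0)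
    (hindep : Pairwise fun i j => (y i * (starRingEnd ℂ) (y j)).im ≠ 0) {w : ℂ}
    (hw : MemZonotopeInterior y w) {s : ℂ} (hs : HasSum (kernelResidue y w) s) :
    s = -((multiBernoulli r r y).eval w / r.factorial) := by
  obtain ⟨M, δ, hδ, hfreq⟩ := hw.frequently_norm_circleIntegral_le hy
  set B := (multiBernoulli r r y).eval w / r.factorial
  set I : ℝ → ℂ := fun R => 2 * Real.pi * Complex.I *
    (B + ∑ i ∈ polesInBall hy R, kernelResidue y w i)
  have hI : Tendsto (fun R => ‖I R‖ - M * Real.exp (-(δ * R))) atTop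
      (𝓝 (‖2 * Real.pi * Complex.I * (B + s)‖ - M * 0)) :=
    (((Tendsto.comp hs (tendsto_polesInBall hy)).const_add B).const_mul _).norm.sub
      ((Real.tendsto_exp_atBot.comp (tendsto_neg_atTop_atBot.comp
        (tendsto_id.const_mul_atTop hδ))).const_mul M)
  have hle : ∃ᶠ R in atTop, ‖I R‖ - M * Real.exp (-(δ * R)) ≤ 0 := by
    refine (hfreq.and_eventually (eventually_gt_atTop 0)).mono fun R ⟨⟨hpole, hR⟩, hR₀⟩ => ?_
    rw [circleIntegral_bernoulliKernel hy hindep w hR₀ hpole] at hR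
    exact sub_nonpos.mpr hR
  have hzero := le_of_tendsto_of_frequently hI hle
  rw [mul_zero, sub_zero, norm_le_zero_iff, mul_eq_zero, or_iff_right Complex.two_pi_I_ne_zero]
    at hzero
  exact eq_neg_of_add_eq_zero_right hzero

end Zonotope

section ZonotopeInterior

open Filter Topology Metric

variable {r : ℕ} {y : Fin r → ℂ} {w : ℂ}

theorem MemZonotopeInterior.eventually (hw : MemZonotopeInterior y w) :
    ∀ᶠ w' in 𝓝 w, MemZonotopeInterior y w' := by
  obtain ⟨δ, hδ, hw⟩ := hw
  filter_upwards [ball_mem_nhds w (half_pos hδ)] with w' hw'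
  refine ⟨δ / 2, half_pos hδ, fun t => ?_⟩
  have hdiff : (w' * t).re - (w * t).re ≤ δ / 2 * ‖t‖ := calc
    (w' * t).re - (w * t).re = ((w' - w) * t).re := by rw [sub_mul, Complex.sub_re]
    _ ≤ ‖w' - w‖ * ‖t‖ := (Complex.re_le_norm _).trans_eq (norm_mul _ _)
    _ ≤ δ / 2 * ‖t‖ := by
      gcongr
      exact (mem_ball_iff_norm.mp hw').le
  linarith [hw t]

theorem abs_im_mul_conj_mul_norm_le (x y t : ℂ) :
    |(x * (starRingEnd ℂ) y).im| * ‖t‖ ≤ (‖x‖ + ‖y‖) * (|(x * t).re| + |(y * t).re|) := by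
  have hid : (starRingEnd ℂ) y * (x * t).re - (starRingEnd ℂ) x * (y * t).re =
      Complex.I * ((x * (starRingEnd ℂ) y).im * t) := by
    apply Complex.ext <;> simp <;> ring
  calc |(x * (starRingEnd ℂ) y).im| * ‖t‖
      = ‖(starRingEnd ℂ) y * (x * t).re - (starRingEnd ℂ) x * (y * t).re‖ := by
        rw [hid, norm_mul, Complex.norm_I, one_mul, norm_mul, Complex.norm_real, Real.norm_eq_abs]
    _ ≤ ‖y‖ * |(x * t).re| + ‖x‖ * |(y * t).re| := by
        refine (norm_sub_le _ _).trans_eq ?_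
        simp only [norm_mul, RCLike.norm_conj, Complex.norm_real, Real.norm_eq_abs]
    _ ≤ (‖x‖ + ‖y‖) * (|(x * t).re| + |(y * t).re|) := by
        nlinarith [mul_nonneg (norm_nonneg x) (abs_nonneg (x * t).re),
          mul_nonneg (norm_nonneg y) (abs_nonneg (y * t).re)]

theorem memZonotopeInterior_half_sum {i j : Fin r} (h : (y i * (starRingEnd ℂ) (y j)).im ≠ 0) :
    MemZonotopeInterior y ((∑ k, y k) / 2) := by
  have hij : i ≠ j := by
    rintro rfl
    simp [Complex.mul_conj] at h
  have hi : y i ≠ 0 := fun hi => h (by simp [hi])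
  have hpos : 0 < ‖y i‖ + ‖y j‖ := add_pos_of_pos_of_nonneg (norm_pos_iff.mpr hi) (norm_nonneg _)
  refine ⟨|(y i * (starRingEnd ℂ) (y j)).im| / (‖y i‖ + ‖y j‖) / 2,
    half_pos (div_pos (abs_pos.mpr h) hpos), fun t => ?_⟩
  have hhalf : ∑ k, max (y k * t).re 0 - ((∑ k, y k) / 2 * t).re = (∑ k, |(y k * t).re|) / 2 := by
    rw [div_mul_eq_mul_div, Finset.sum_mul, Complex.div_ofNat_re, Complex.re_sum, Finset.sum_div,
      Finset.sum_div, ← Finset.sum_sub_distrib]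
    refine Finset.sum_congr rfl fun k _ => ?_
    rcases le_total 0 (y k * t).re with hk | hk
    · rw [max_eq_left hk, abs_of_nonneg hk, sub_half]
    · rw [max_eq_right hk, abs_of_nonpos hk, zero_sub, neg_div]
  have hpair : |(y i * t).re| + |(y j * t).re| ≤ ∑ k, |(y k * t).re| := by
    rw [← Finset.sum_pair (f := fun k => |(y k * t).re|) hij]
    exact Finset.sum_le_sum_of_subset_of_nonneg (Finset.subset_univ _) fun _ _ _ => abs_nonneg _
  rw [hhalf, div_mul_eq_mul_div]
  gcongr
  refine le_trans ?_ hpair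
  rw [div_mul_eq_mul_div, div_le_iff₀' hpos]
  exact abs_im_mul_conj_mul_norm_le _ _ _

theorem MemZonotopeInterior.im_div_lt (hw : MemZonotopeInterior y w) {x : ℂ} (hx : x ≠ 0) :
    (w / x).im < ∑ j, max (y j / x).im 0 := by
  obtain ⟨δ, hδ, hw⟩ := hw
  have hre : ∀ z : ℂ, (z * (-Complex.I / x)).re = (z / x).im := fun z => by
    rw [mul_div_assoc', mul_neg, neg_div, mul_div_right_comm, Complex.neg_re, Complex.mul_I_re,
      neg_neg]
  have ht : 0 < ‖-Complex.I / x‖ :=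
    norm_pos_iff.mpr (div_ne_zero (neg_ne_zero.mpr Complex.I_ne_zero) hx)
  have := hw (-Complex.I / x)
  simp only [hre] at this
  exact sub_pos.mp ((mul_pos hδ ht).trans_le this)

end ZonotopeInterior

/-! ### Double products -/

section GammaProd

open Filter Topology Metric

theorem one_sub_ne_zero_of_norm_lt_one {z : ℂ} (hz : ‖z‖ < 1) : 1 - z ≠ 0 := by
  rw [sub_ne_zero]
  rintro rfl
  exact hz.ne norm_one

/-- Expanding every logarithm and summing over `i` first. -/
theorem exists_hasSum_hasProd_one_sub {ι : Type*} {a : ι → ℂ} (ha : Summable fun i => ‖a i‖)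
    (ha₁ : ∀ i, ‖a i‖ < 1) {c : ℕ → ℂ} (hc : ∀ k, HasSum (fun i => a i ^ (k + 1)) (c k)) :
    ∃ s, HasSum (fun k : ℕ => -(c k / (k + 1))) s ∧
      HasProd (fun i => 1 - a i) (Complex.exp s) := by
  obtain ⟨G, hG⟩ : ∃ G : ι × ℕ → ℂ, ∀ i k, G (i, k) = -(a i ^ (k + 1) / (k + 1)) :=
    ⟨fun x => -(a x.1 ^ (x.2 + 1) / (x.2 + 1)), fun _ _ => rfl⟩
  have hlog : ∀ i, HasSum (fun k => G (i, k)) (Complex.log (1 - a i)) := fun i => by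
    simpa only [hG, neg_neg] using (Complex.hasSum_taylorSeries_neg_log' (ha₁ i)).neg
  have hnorm : ∀ i, HasSum (fun k => ‖G (i, k)‖) (-Real.log (1 - ‖a i‖)) := fun i => by
    simp only [hG, norm_neg, norm_div, norm_pow, ← Nat.cast_add_one, Complex.norm_natCast]
    push_cast
    exact Real.hasSum_pow_div_log_of_abs_lt_one (by rw [abs_norm]; exact ha₁ i)
  have hsum : Summable G := by
    refine Summable.of_norm ((summable_prod_of_nonneg fun _ => norm_nonneg _).mpr
      ⟨fun i => (hnorm i).summable, ?_⟩)
    simp only [fun i => (hnorm i).tsum_eq, sub_eq_add_neg]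
    exact (Real.summable_log_one_add_of_summable ha.neg).neg
  have hcol : ∀ k, HasSum (fun i => G (i, k)) (-(c k / (k + 1))) := fun k => by
    simpa only [hG] using ((hc k).div_const _).neg
  obtain ⟨s, hs⟩ := hsum
  have hswap : HasSum (fun x : ℕ × ι => G (x.2, x.1)) s :=
    (Equiv.prodComm ℕ ι).hasSum_iff.mpr hs
  exact ⟨s, hswap.prod_fiberwise hcol, Complex.hasProd_of_hasSum_log
    (fun i => one_sub_ne_zero_of_norm_lt_one (ha₁ i)) (hs.prod_fiberwise hlog)⟩

theorem summable_pow_mul_pow {r s : ℝ} (hr0 : 0 ≤ r) (hr : r < 1) (hs0 : 0 ≤ s) (hs : s < 1) :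
    Summable fun p : ℕ × ℕ => r ^ p.1 * s ^ p.2 :=
  (summable_geometric_of_lt_one hr0 hr).mul_of_nonneg (summable_geometric_of_lt_one hs0 hs)
    (fun _ => pow_nonneg hr0 _) fun _ => pow_nonneg hs0 _

theorem hasSum_pow_mul_pow {q r : ℂ} (hq : ‖q‖ < 1) (hr : ‖r‖ < 1) :
    HasSum (fun p : ℕ × ℕ => q ^ p.1 * r ^ p.2) ((1 - q)⁻¹ * (1 - r)⁻¹) := by
  refine (hasSum_geometric_of_norm_lt_one hq).mul (hasSum_geometric_of_norm_lt_one hr)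
    (Summable.of_norm ?_)
  simpa only [norm_mul, norm_pow] using
    summable_pow_mul_pow (norm_nonneg q) hq (norm_nonneg r) hr

theorem exists_hasSum_hasProd_one_sub_mul_pow_mul_pow {z q r : ℂ} (hz : ‖z‖ < 1) (hq : ‖q‖ < 1)
    (hr : ‖r‖ < 1) :
    ∃ s, HasSum (fun k : ℕ =>
        -(z ^ (k + 1) / ((k + 1) * (1 - q ^ (k + 1)) * (1 - r ^ (k + 1))))) s ∧
      HasProd (fun p : ℕ × ℕ => 1 - z * q ^ p.1 * r ^ p.2) (Complex.exp s) := by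
  have hle : ∀ p : ℕ × ℕ, ‖z * q ^ p.1 * r ^ p.2‖ ≤ ‖z‖ := fun p => by
    rw [norm_mul, norm_mul, norm_pow, norm_pow, mul_assoc]
    exact mul_le_of_le_one_right (norm_nonneg _) (mul_le_one₀ (pow_le_one₀ (norm_nonneg _) hq.le)
      (by positivity) (pow_le_one₀ (norm_nonneg _) hr.le))
  have hsum : Summable fun p : ℕ × ℕ => ‖z * q ^ p.1 * r ^ p.2‖ := by
    simpa only [norm_mul, norm_pow, mul_assoc] using
      (summable_pow_mul_pow (norm_nonneg q) hq (norm_nonneg r) hr).mul_left ‖z‖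
  have hpow : ∀ {t : ℂ}, ‖t‖ < 1 → ∀ k : ℕ, ‖t ^ (k + 1)‖ < 1 := fun ht k => by
    rw [norm_pow]
    exact pow_lt_one₀ (norm_nonneg _) ht k.succ_ne_zero
  have hcol : ∀ k : ℕ, HasSum (fun p : ℕ × ℕ => (z * q ^ p.1 * r ^ p.2) ^ (k + 1))
      (z ^ (k + 1) * ((1 - q ^ (k + 1))⁻¹ * (1 - r ^ (k + 1))⁻¹)) := fun k => by
    simp only [mul_pow, ← pow_right_comm _ (k + 1), mul_assoc]
    exact (hasSum_pow_mul_pow (hpow hq k) (hpow hr k)).mul_left _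
  obtain ⟨s, hs, hprod⟩ :=
    exists_hasSum_hasProd_one_sub hsum (fun p => (hle p).trans_lt hz) hcol
  refine ⟨s, hs.congr_fun fun k => ?_, hprod⟩
  field_simp

/-- The double product `∏_{m,n ≥ 0} (1 - exp(2πi (w - (m + 1) u + n v) / x))`, a single factor of
the elliptic gamma function with periods `u, v, x`. -/
def gammaProd (u v x w : ℂ) : ℂ :=
  ∏' p : ℕ × ℕ, (1 - Complex.exp (2 * Real.pi * Complex.I * (w - (p.1 + 1) * u + p.2 * v) / x))

theorem exp_gammaProd (u v x w : ℂ) (m n : ℕ) :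
    Complex.exp (2 * Real.pi * Complex.I * (w - (m + 1) * u + n * v) / x) =
      Complex.exp (2 * Real.pi * Complex.I * ((w - u) / x)) *
        Complex.exp (2 * Real.pi * Complex.I * -(u / x)) ^ m *
        Complex.exp (2 * Real.pi * Complex.I * (v / x)) ^ n := by
  rw [← Complex.exp_nat_mul, ← Complex.exp_nat_mul, ← Complex.exp_add, ← Complex.exp_add]
  ring_nf

theorem norm_exp_two_pi_I_mul (z : ℂ) :
    ‖Complex.exp (2 * Real.pi * Complex.I * z)‖ = Real.exp (-(2 * Real.pi * z.im)) := by
  rw [Complex.norm_exp]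
  congr 1
  simp

theorem norm_exp_two_pi_I_mul_lt_one {z : ℂ} (hz : 0 < z.im) :
    ‖Complex.exp (2 * Real.pi * Complex.I * z)‖ < 1 := by
  rw [norm_exp_two_pi_I_mul, Real.exp_lt_one_iff, neg_lt_zero]
  exact mul_pos Real.two_pi_pos hz

theorem norm_exp_two_pi_I_mul_sub_div_le {u x w : ℂ} {R : ℝ} (hw : ‖w‖ ≤ R) :
    ‖Complex.exp (2 * Real.pi * Complex.I * ((w - u) / x))‖ ≤
      Real.exp (2 * Real.pi * ((R + ‖u‖) / ‖x‖)) := by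
  rw [norm_exp_two_pi_I_mul, Real.exp_le_exp, ← mul_neg]
  gcongr
  calc -((w - u) / x).im ≤ ‖(w - u) / x‖ := (neg_le_abs _).trans (Complex.abs_im_le_norm _)
    _ ≤ (R + ‖u‖) / ‖x‖ := by
      rw [norm_div]
      gcongr
      exact (norm_sub_le _ _).trans (by gcongr)

theorem differentiable_gammaProd {u v x : ℂ} (hu : (u / x).im < 0) (hv : 0 < (v / x).im) :
    Differentiable ℂ (gammaProd u v x) := by
  intro w₀
  set s := ball (0 : ℂ) (‖w₀‖ + 1)
  have hprod := Summable.hasProdLocallyUniformlyOn_one_add (K := s)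
    (f := fun (p : ℕ × ℕ) (w : ℂ) =>
      -Complex.exp (2 * Real.pi * Complex.I * (w - (p.1 + 1) * u + p.2 * v) / x))
    isOpen_ball
    ((summable_pow_mul_pow (norm_nonneg _)
      (norm_exp_two_pi_I_mul_lt_one (z := -(u / x)) (by simpa using hu)) (norm_nonneg _)
      (norm_exp_two_pi_I_mul_lt_one hv)).mul_left
        (Real.exp (2 * Real.pi * ((‖w₀‖ + 1 + ‖u‖) / ‖x‖))))
    (Eventually.of_forall fun p w hw => by
      rw [norm_neg, exp_gammaProd, norm_mul, norm_mul, norm_pow, norm_pow, mul_assoc]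
      gcongr
      exact norm_exp_two_pi_I_mul_sub_div_le (mem_ball_zero_iff.mp hw).le)
    (fun p => Continuous.continuousOn (by fun_prop))
  rw [hasProdLocallyUniformlyOn_iff_tendstoLocallyUniformlyOn] at hprod
  have hdiff : DifferentiableOn ℂ (gammaProd u v x) s :=
    hprod.differentiableOn (Eventually.of_forall fun _ =>
      Differentiable.differentiableOn (by fun_prop)) isOpen_ball
  exact hdiff.differentiableAt (isOpen_ball.mem_nhds (by simp))

theorem exists_hasSum_gammaProd_eq_exp {u v x w : ℂ} (hu : (u / x).im < 0) (hv : 0 < (v / x).im)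
    (hw : 0 < ((w - u) / x).im) :
    ∃ s, HasSum (fun k : ℕ => Complex.exp (w * expPole x (k + 1)) /
        ((k + 1) * ((Complex.exp (u * expPole x (k + 1)) - 1) *
          (Complex.exp (v * expPole x (k + 1)) - 1)))) s ∧
      gammaProd u v x w = Complex.exp s := by
  obtain ⟨s, hs, hprod⟩ := exists_hasSum_hasProd_one_sub_mul_pow_mul_pow
    (norm_exp_two_pi_I_mul_lt_one hw)
    (norm_exp_two_pi_I_mul_lt_one (z := -(u / x)) (by simpa using hu))
    (norm_exp_two_pi_I_mul_lt_one hv)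
  refine ⟨s, hs.congr_fun fun k => ?_, ?_⟩
  · have hexp : ∀ z : ℂ, Complex.exp (2 * Real.pi * Complex.I * (z / x)) ^ (k + 1) =
        Complex.exp (z * expPole x (k + 1)) := fun z => by
      rw [← Complex.exp_nat_mul, expPole]
      push_cast
      ring_nf
    rw [← neg_div x u, hexp, hexp, hexp, sub_mul w, neg_mul, Complex.exp_sub, Complex.exp_neg]
    set U := Complex.exp (u * expPole x (k + 1))
    set V := Complex.exp (v * expPole x (k + 1))
    have hU : U ≠ 0 := Complex.exp_ne_zero _
    have hden : (k + 1) * ((U - 1) * (V - 1)) = -(U * ((k + 1) * (1 - U⁻¹) * (1 - V))) := by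
      field_simp
      ring
    rw [hden, div_neg, div_div]
  · simpa only [gammaProd, exp_gammaProd] using hprod.tprod_eq

end GammaProd

section ThreeTerm

open Filter Topology

theorem hasSum_prod_of_forall_hasSum {ι κ : Type*} [Fintype ι] {f : ι × κ → ℂ} {s : ι → ℂ}
    (h : ∀ i, HasSum (fun k => f (i, k)) (s i)) : HasSum f (∑ i, s i) := by
  classical
  have hrow : ∀ i, HasSum (fun x : ι × κ => if x.1 = i then f x else 0) (s i) := fun i => by
    rw [← (Prod.mk_right_injective i).hasSum_iff]
    · simpa only [Function.comp_def, if_true] using h i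
    · exact fun x hx => if_neg fun hxi => hx ⟨x.2, Prod.ext hxi.symm rfl⟩
  simpa only [Finset.sum_ite_eq, Finset.mem_univ, if_true] using
    hasSum_sum fun i (_ : i ∈ Finset.univ) => hrow i

theorem two_pi_I_mul_kernelResidue (y : Fin 3 → ℂ) (w : ℂ) {j : Fin 3} (hj : y j ≠ 0) (k : ℤ) :
    2 * Real.pi * Complex.I * kernelResidue y w (j, k) =
      Complex.exp (w * expPole (y j) k) / (k * ((Complex.exp (y (j + 1) * expPole (y j) k) - 1) *
        (Complex.exp (y (j + 2) * expPole (y j) k) - 1))) := by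
  have herase : ∀ j : Fin 3, Finset.univ.erase j = {j + 1, j + 2} := by decide
  have hne : ∀ j : Fin 3, j + 1 ≠ j + 2 := by decide
  have hpole : expPole (y j) k * y j = 2 * Real.pi * Complex.I * k := div_mul_cancel₀ _ hj
  rw [kernelResidue, herase, Finset.prod_pair (hne j), hpole, mul_assoc _ (k : ℂ), mul_div_assoc',
    mul_div_mul_left _ _ Complex.two_pi_I_ne_zero]

theorem exists_hasSum_kernelResidue_of_im {y : Fin 3 → ℂ} {w : ℂ} {j : Fin 3}
    (hu : (y (j + 1) / y j).im < 0) (hv : 0 < (y (j + 2) / y j).im)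
    (hwu : 0 < ((w - y (j + 1)) / y j).im) (hwv : ((w - y (j + 2)) / y j).im < 0) :
    ∃ s s', HasSum (fun k : ℤ => 2 * Real.pi * Complex.I * kernelResidue y w (j, k)) (s - s') ∧
      gammaProd (y (j + 1)) (y (j + 2)) (y j) w = Complex.exp s ∧
      gammaProd (y (j + 2)) (y (j + 1)) (-y j) w = Complex.exp s' := by
  have hj : y j ≠ 0 := fun h => by simp [h] at hu
  have hneg : ∀ z : ℂ, (z / -y j).im = -(z / y j).im := fun z => by rw [div_neg, Complex.neg_im]
  obtain ⟨s, hs, hexp⟩ := exists_hasSum_gammaProd_eq_exp hu hv hwu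
  obtain ⟨s', hs', hexp'⟩ := exists_hasSum_gammaProd_eq_exp (u := y (j + 2)) (v := y (j + 1))
    (x := -y j) (w := w) (by rwa [hneg, neg_lt_zero]) (by rwa [hneg, neg_pos])
    (by rwa [hneg, neg_pos])
  refine ⟨s, s', ?_, hexp, hexp'⟩
  have hpos : HasSum (fun k : ℕ =>
      2 * Real.pi * Complex.I * kernelResidue y w (j, (k : ℤ) + 1)) s := by
    refine hs.congr_fun fun k => ?_
    rw [two_pi_I_mul_kernelResidue y w hj]
    push_cast
    rfl
  have hpole : ∀ k : ℤ, expPole (-y j) k = expPole (y j) (-k) := fun k => by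
    simp only [expPole, Int.cast_neg, div_neg, mul_neg, neg_div]
  have hneg' : HasSum (fun k : ℕ =>
      2 * Real.pi * Complex.I * kernelResidue y w (j, -((k : ℤ) + 1))) (-s') := by
    refine hs'.neg.congr_fun fun k => ?_
    rw [two_pi_I_mul_kernelResidue y w hj, ← Nat.cast_add_one, hpole, ← div_neg, ← neg_mul]
    push_cast
    rw [mul_comm (Complex.exp (y (j + 2) * _) - 1)]
  have hint := HasSum.of_add_one_of_neg_add_one
    (f := fun k : ℤ => 2 * Real.pi * Complex.I * kernelResidue y w (j, k)) hpos hneg'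
  rwa [kernelResidue_zero_right, mul_zero, add_zero, ← sub_eq_add_neg] at hint

theorem im_div_eq (u v : ℂ) : (u / v).im = (u * (starRingEnd ℂ) v).im / Complex.normSq v := by
  rw [Complex.div_im]
  simp
  ring

theorem im_mul_conj_swap (u v : ℂ) : (v * (starRingEnd ℂ) u).im = -(u * (starRingEnd ℂ) v).im := by
  simp
  ring

/-- Three periods such that `Im (yⱼ / yⱼ₊₁) > 0` for all cyclic indices `j`. -/
def IsCyclicallyOriented (y : Fin 3 → ℂ) : Prop :=
  ∀ j, 0 < (y j * (starRingEnd ℂ) (y (j + 1))).im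

namespace IsCyclicallyOriented

variable {y : Fin 3 → ℂ}

theorem ne_zero (h : IsCyclicallyOriented y) (j : Fin 3) : y j ≠ 0 :=
  fun hj => (h j).ne' (by simp [hj])

theorem im_div_neg (h : IsCyclicallyOriented y) (j : Fin 3) : (y (j + 1) / y j).im < 0 := by
  rw [im_div_eq, im_mul_conj_swap]
  exact div_neg_of_neg_of_pos (neg_lt_zero.mpr (h j)) (Complex.normSq_pos.mpr (h.ne_zero j))

theorem im_div_pos (h : IsCyclicallyOriented y) (j : Fin 3) : 0 < (y (j + 2) / y j).im := by
  have hsucc : ∀ j : Fin 3, j + 2 + 1 = j := by decide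
  have hpos := h (j + 2)
  rw [hsucc j] at hpos
  rw [im_div_eq]
  exact div_pos hpos (Complex.normSq_pos.mpr (h.ne_zero j))

theorem pairwise_im_mul_conj_ne_zero (h : IsCyclicallyOriented y) :
    Pairwise fun i j => (y i * (starRingEnd ℂ) (y j)).im ≠ 0 := by
  intro i j hij
  have hsucc : j = i + 1 ∨ i = j + 1 := by revert i j; decide
  rcases hsucc with rfl | rfl
  · exact (h i).ne'
  · rw [im_mul_conj_swap]
    exact neg_ne_zero.mpr (h j).ne'

theorem im_sub_div_of_memZonotopeInterior (h : IsCyclicallyOriented y) {w : ℂ}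
    (hw : MemZonotopeInterior y w) (j : Fin 3) :
    0 < ((w - y (j + 1)) / y j).im ∧ ((w - y (j + 2)) / y j).im < 0 := by
  have hsum : ∀ f : Fin 3 → ℝ, ∑ i, f i = f j + f (j + 1) + f (j + 2) := fun f => by
    rw [Fin.sum_univ_three]
    fin_cases j <;> simp <;> ring
  have hself : (y j / y j).im = 0 := by rw [div_self (h.ne_zero j), Complex.one_im]
  have hu := h.im_div_neg j
  have hv := h.im_div_pos j
  have hlt := hw.im_div_lt (h.ne_zero j)
  have hgt := hw.im_div_lt (neg_ne_zero.mpr (h.ne_zero j))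
  rw [hsum, hself, max_eq_right hu.le, max_eq_left hv.le] at hlt
  simp only [div_neg, Complex.neg_im] at hgt
  rw [hsum, hself, max_eq_left (neg_nonneg.mpr hu.le), max_eq_right (neg_nonpos.mpr hv.le)] at hgt
  simp only [sub_div, Complex.sub_im]
  constructor <;> linarith [max_self (0 : ℝ), neg_zero (G := ℝ) ▸ max_self (0 : ℝ)]

theorem prod_gammaProd_of_memZonotopeInterior (h : IsCyclicallyOriented y) {w : ℂ}
    (hw : MemZonotopeInterior y w) :
    ∏ j, gammaProd (y (j + 1)) (y (j + 2)) (y j) w =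
      (∏ j, gammaProd (y (j + 2)) (y (j + 1)) (-y j) w) *
        Complex.exp (-(Real.pi * Complex.I / 3) * (multiBernoulli 3 3 y).eval w) := by
  choose s s' hs hexp hexp' using fun j => exists_hasSum_kernelResidue_of_im (h.im_div_neg j)
    (h.im_div_pos j) (h.im_sub_div_of_memZonotopeInterior hw j).1
    (h.im_sub_div_of_memZonotopeInterior hw j).2
  have hres : HasSum (kernelResidue y w) ((∑ j, (s j - s' j)) / (2 * Real.pi * Complex.I)) := by
    simpa only [mul_div_cancel_left₀ _ Complex.two_pi_I_ne_zero] using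
      (hasSum_prod_of_forall_hasSum
        (f := fun i => 2 * Real.pi * Complex.I * kernelResidue y w i) hs).div_const
          (2 * Real.pi * Complex.I)
  have hsum := hw.eq_neg_of_hasSum_kernelResidue h.ne_zero h.pairwise_im_mul_conj_ne_zero hres
  rw [div_eq_iff Complex.two_pi_I_ne_zero, Finset.sum_sub_distrib, sub_eq_iff_eq_add'] at hsum
  simp only [hexp, hexp', ← Complex.exp_sum]
  rw [hsum, Complex.exp_add]
  congr 2
  push_cast [Nat.factorial]
  ring

theorem prod_gammaProd (h : IsCyclicallyOriented y) (w : ℂ) :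
    ∏ j, gammaProd (y (j + 1)) (y (j + 2)) (y j) w =
      (∏ j, gammaProd (y (j + 2)) (y (j + 1)) (-y j) w) *
        Complex.exp (-(Real.pi * Complex.I / 3) * (multiBernoulli 3 3 y).eval w) := by
  have hL : Differentiable ℂ fun w => ∏ j, gammaProd (y (j + 1)) (y (j + 2)) (y j) w :=
    Differentiable.fun_finsetProd fun j _ =>
      differentiable_gammaProd (h.im_div_neg j) (h.im_div_pos j)
  have hR : Differentiable ℂ fun w => (∏ j, gammaProd (y (j + 2)) (y (j + 1)) (-y j) w) *
      Complex.exp (-(Real.pi * Complex.I / 3) * (multiBernoulli 3 3 y).eval w) :=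
    (Differentiable.fun_finsetProd fun j _ => differentiable_gammaProd
      (by simpa [div_neg] using h.im_div_pos j) (by simpa [div_neg] using h.im_div_neg j)).mul
      ((Polynomial.differentiable _).const_mul _).cexp
  have hcenter : MemZonotopeInterior y ((∑ k, y k) / 2) :=
    memZonotopeInterior_half_sum (h 0).ne'
  exact congrFun (AnalyticOnNhd.eq_of_eventuallyEq
    (Complex.analyticOnNhd_univ_iff_differentiable.mpr hL)
    (Complex.analyticOnNhd_univ_iff_differentiable.mpr hR)
    (hcenter.eventually.mono fun _ => h.prod_gammaProd_of_memZonotopeInterior)) w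

end IsCyclicallyOriented

end ThreeTerm

/-! ### The multiple Bernoulli polynomial `B₃₃` -/

section Bernoulli

variable {F : Type*} [Field F]

theorem inv_mk_pow_div_factorial [CharZero F] {x : F} (hx : x ≠ 0) :
    (PowerSeries.mk fun k => x ^ (k + 1) / ((k + 1).factorial : F))⁻¹ =
      PowerSeries.mk fun k => (bernoulli k : F) / k.factorial * x ^ k / x := by
  set A : PowerSeries F := PowerSeries.mk fun k => x ^ (k + 1) / ((k + 1).factorial : F) with hA
  set B : PowerSeries F := PowerSeries.rescale x (bernoulliPowerSeries F) with hB
  have hconst : PowerSeries.constantCoeff A ≠ 0 := by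
    simpa [hA, ← PowerSeries.coeff_zero_eq_constantCoeff_apply] using hx
  have hAX : PowerSeries.rescale x (PowerSeries.exp F - 1) = A * PowerSeries.X := by
    ext (_ | k)
    · rw [PowerSeries.coeff_zero_mul_X, PowerSeries.coeff_rescale]
      simp
    · simp [hA, PowerSeries.coeff_succ_mul_X, PowerSeries.coeff_one, PowerSeries.coeff_exp,
        div_eq_mul_inv]
  have hBA : B * A = PowerSeries.C x := by
    have hX := congrArg (PowerSeries.rescale x) (bernoulliPowerSeries_mul_exp_sub_one F)
    rw [map_mul, hAX, PowerSeries.rescale_X, ← mul_assoc] at hX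
    exact mul_right_cancel₀ PowerSeries.X_ne_zero hX
  have hBx : (PowerSeries.mk fun k => (bernoulli k : F) / k.factorial * x ^ k / x) =
      PowerSeries.C x⁻¹ * B := by
    ext k
    simp only [hB, bernoulliPowerSeries, PowerSeries.coeff_mk, PowerSeries.coeff_C_mul,
      PowerSeries.coeff_rescale, map_div₀, map_natCast, eq_ratCast]
    ring
  rw [hBx, PowerSeries.inv_eq_iff_mul_eq_one hconst, mul_assoc, hBA, ← map_mul,
    inv_mul_cancel₀ hx, map_one]

theorem P₃_eq_multiBernoulli [CharZero F] {y : Fin 3 → F} (hy : ∀ i, y i ≠ 0) :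
    P₃ (y 0) (y 1) (y 2) = multiBernoulli 3 3 y := by
  have h₀ := hy 0
  have h₁ := hy 1
  have h₂ := hy 2
  have hb₁ : (bernoulli 1 : F) = -1 / 2 := by rw [bernoulli_one]; norm_num
  have hb₂ : (bernoulli 2 : F) = 1 / 6 := by rw [bernoulli_two]; norm_num
  have hb₃ : (bernoulli 3 : F) = 0 := by
    rw [bernoulli_eq_zero_of_odd (by decide) (by norm_num), Rat.cast_zero]
  refine Polynomial.funext fun w => ?_
  rw [eval_multiBernoulli, Fin.prod_univ_three, inv_mk_pow_div_factorial h₀,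
    inv_mk_pow_div_factorial h₁, inv_mk_pow_div_factorial h₂]
  simp only [P₃, PowerSeries.coeff_mul, Finset.Nat.sum_antidiagonal_eq_sum_range_succ_mk,
    Finset.sum_range_succ, Finset.sum_range_zero, PowerSeries.coeff_mk, bernoulli_zero,
    zero_add, Nat.reduceSub, hb₁, hb₂, hb₃, Rat.cast_one,
    Polynomial.eval_add, Polynomial.eval_sub, Polynomial.eval_mul, Polynomial.eval_C,
    Polynomial.eval_pow, Polynomial.eval_X, Nat.factorial, Nat.sub_self, Nat.sub_zero]
  field_simp
  ring

end Bernoulli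

/-! ### Values of rational functions -/

section Evaluation

/-- The rational function `f` is regular at `x` with value `v`. -/
def EvalsTo (x : Fin 3 → ℂ) (f : RatFun) (v : ℂ) : Prop :=
  RegularAt f x ∧ ratEval f x = v

theorem evalsTo_of_mul_eq {f : RatFun} {n d : MvPolynomial (Fin 3) ℚ} {x : Fin 3 → ℂ}
    (h : f * algebraMap _ RatFun d = algebraMap _ RatFun n) (hd : MvPolynomial.aeval x d ≠ 0) :
    EvalsTo x f (MvPolynomial.aeval x n / MvPolynomial.aeval x d) := by
  set N := IsFractionRing.num (MvPolynomial (Fin 3) ℚ) f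
  set D := (IsFractionRing.den (MvPolynomial (Fin 3) ℚ) f : MvPolynomial (Fin 3) ℚ)
  have hfD : f * algebraMap _ RatFun D = algebraMap _ RatFun N := by
    have hspec := IsLocalization.mk'_spec (M := nonZeroDivisors (MvPolynomial (Fin 3) ℚ)) RatFun
      N (IsFractionRing.den _ f)
    rwa [IsFractionRing.mk'_num_den] at hspec
  have hcross : N * d = n * D := by
    apply IsFractionRing.injective (MvPolynomial (Fin 3) ℚ) RatFun
    rw [map_mul, map_mul, ← hfD, ← h]
    ring
  have hdvd : D ∣ d :=
    (IsFractionRing.num_den_reduced (MvPolynomial (Fin 3) ℚ) f).symm.dvd_of_dvd_mul_left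
      (hcross ▸ dvd_mul_left D n)
  have hDx : MvPolynomial.aeval x D ≠ 0 :=
    ne_zero_of_dvd_ne_zero hd (map_dvd (MvPolynomial.aeval x) hdvd)
  refine ⟨hDx, ?_⟩
  rw [ratEval, div_eq_div_iff hDx hd, ← map_mul, ← map_mul, hcross]

theorem evalsTo_iff {x : Fin 3 → ℂ} {f : RatFun} {v : ℂ} :
    EvalsTo x f v ↔ ∃ n d : MvPolynomial (Fin 3) ℚ,
      f * algebraMap _ RatFun d = algebraMap _ RatFun n ∧
      MvPolynomial.aeval x d ≠ 0 ∧ v = MvPolynomial.aeval x n / MvPolynomial.aeval x d := by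
  constructor
  · rintro ⟨hreg, hv⟩
    refine ⟨_, _, ?_, hreg, hv.symm⟩
    have hspec := IsLocalization.mk'_spec (M := nonZeroDivisors (MvPolynomial (Fin 3) ℚ)) RatFun
      (IsFractionRing.num _ f) (IsFractionRing.den _ f)
    rwa [IsFractionRing.mk'_num_den] at hspec
  · rintro ⟨n, d, h, hd, rfl⟩
    exact evalsTo_of_mul_eq h hd

theorem evalsTo_algebraMap (x : Fin 3 → ℂ) (p : MvPolynomial (Fin 3) ℚ) :
    EvalsTo x (algebraMap _ RatFun p) (MvPolynomial.aeval x p) :=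
  evalsTo_iff.mpr ⟨p, 1, by simp, by simp, by simp⟩

namespace EvalsTo

variable {x : Fin 3 → ℂ} {f g : RatFun} {u v : ℂ}

theorem zero : EvalsTo x 0 0 := by
  simpa using evalsTo_algebraMap x 0

theorem one : EvalsTo x 1 1 := by
  simpa using evalsTo_algebraMap x 1

theorem add (hf : EvalsTo x f u) (hg : EvalsTo x g v) : EvalsTo x (f + g) (u + v) := by
  obtain ⟨n, d, h, hd, rfl⟩ := evalsTo_iff.mp hf
  obtain ⟨n', d', h', hd', rfl⟩ := evalsTo_iff.mp hg
  refine evalsTo_iff.mpr ⟨n * d' + n' * d, d * d', ?_, ?_, ?_⟩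
  · rw [map_mul, map_add, map_mul, map_mul, ← h, ← h']
    ring
  · rw [map_mul]
    exact mul_ne_zero hd hd'
  · rw [map_add, map_mul, map_mul, map_mul]
    field_simp

theorem mul (hf : EvalsTo x f u) (hg : EvalsTo x g v) : EvalsTo x (f * g) (u * v) := by
  obtain ⟨n, d, h, hd, rfl⟩ := evalsTo_iff.mp hf
  obtain ⟨n', d', h', hd', rfl⟩ := evalsTo_iff.mp hg
  refine evalsTo_iff.mpr ⟨n * n', d * d', ?_, ?_, ?_⟩
  · rw [map_mul, map_mul, ← h, ← h']
    ring
  · rw [map_mul]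
    exact mul_ne_zero hd hd'
  · rw [map_mul, map_mul]
    field_simp

theorem neg (hf : EvalsTo x f u) : EvalsTo x (-f) (-u) := by
  have hneg : EvalsTo x (-1) (-1) := by simpa using evalsTo_algebraMap x (-1)
  simpa only [neg_one_mul] using hneg.mul hf

theorem inv (hf : EvalsTo x f u) (hu : u ≠ 0) : EvalsTo x f⁻¹ u⁻¹ := by
  obtain ⟨n, d, h, -, rfl⟩ := evalsTo_iff.mp hf
  have hn : MvPolynomial.aeval x n ≠ 0 := fun h0 => hu (by rw [h0, zero_div])
  have hinj := IsFractionRing.injective (MvPolynomial (Fin 3) ℚ) RatFun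
  have hf0 : f ≠ 0 := by
    rintro rfl
    rw [zero_mul, eq_comm, map_eq_zero_iff _ hinj] at h
    exact hn (by rw [h, map_zero])
  exact evalsTo_iff.mpr ⟨d, n, by rw [← h, inv_mul_cancel_left₀ hf0], hn, by rw [inv_div]⟩

theorem div (hf : EvalsTo x f u) (hg : EvalsTo x g v) (hv : v ≠ 0) :
    EvalsTo x (f / g) (u / v) := by
  rw [div_eq_mul_inv, div_eq_mul_inv]
  exact hf.mul (hg.inv hv)

end EvalsTo

/-- The graph of evaluation at `x`, as a subring: sums, powers and integer multiples of values
of rational functions then come from the subring structure. -/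
def evalGraph (x : Fin 3 → ℂ) : Subring (RatFun × ℂ) where
  carrier := {z | EvalsTo x z.1 z.2}
  mul_mem' hf hg := EvalsTo.mul hf hg
  one_mem' := EvalsTo.one
  add_mem' hf hg := EvalsTo.add hf hg
  zero_mem' := EvalsTo.zero
  neg_mem' hf := EvalsTo.neg hf

theorem mem_evalGraph {x : Fin 3 → ℂ} {z : RatFun × ℂ} :
    z ∈ evalGraph x ↔ EvalsTo x z.1 z.2 :=
  Iff.rfl

theorem evalsTo_pair_coord (x : Fin 3 → ℂ) (δ : Lattice3) :
    EvalsTo x (pair δ coord) (pair δ x) := by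
  have hcoord (i : Fin 3) : (coord i, x i) ∈ evalGraph x := by
    simpa [mem_evalGraph, coord] using evalsTo_algebraMap x (MvPolynomial.X i)
  simpa [pair, mem_evalGraph, Prod.fst_sum, Prod.snd_sum] using
    sum_mem fun i (_ : i ∈ Finset.univ) => zsmul_mem (hcoord i) (δ i)

/-- The coefficients of `p` are regular at `x`, and evaluating them yields `q`; equivalently, the
pair `(p, q)` lifts to a polynomial over the graph of evaluation. -/
def PolyEvalsTo (x : Fin 3 → ℂ) (p : RatFun[X]) (q : ℂ[X]) : Prop :=
  ∃ r : (evalGraph x)[X],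
    r.map ((RingHom.fst _ _).comp (evalGraph x).subtype) = p ∧
    r.map ((RingHom.snd _ _).comp (evalGraph x).subtype) = q

namespace PolyEvalsTo

variable {x : Fin 3 → ℂ} {p p' : RatFun[X]} {q q' : ℂ[X]}

theorem coeff (h : PolyEvalsTo x p q) (k : ℕ) : EvalsTo x (p.coeff k) (q.coeff k) := by
  obtain ⟨r, rfl, rfl⟩ := h
  rw [Polynomial.coeff_map, Polynomial.coeff_map]
  exact mem_evalGraph.mp (r.coeff k).2

theorem polyEval_eq (h : PolyEvalsTo x p q) (w : ℂ) : polyEval p w x = q.eval w := by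
  have hzero : ratEval (0 : RatFun) x = 0 := (evalGraph x).zero_mem.2
  set n := max p.natDegree q.natDegree + 1
  rw [polyEval, Polynomial.sum_over_range' p (by simp [hzero]) n (by omega),
    Polynomial.eval_eq_sum_range' (n := n) (by omega)]
  exact Finset.sum_congr rfl fun k _ => by rw [(h.coeff k).2]

theorem C {f : RatFun} {u : ℂ} (h : EvalsTo x f u) :
    PolyEvalsTo x (Polynomial.C f) (Polynomial.C u) :=
  ⟨Polynomial.C ⟨(f, u), h⟩, Polynomial.map_C _, Polynomial.map_C _⟩

theorem X : PolyEvalsTo x Polynomial.X Polynomial.X :=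
  ⟨Polynomial.X, Polynomial.map_X _, Polynomial.map_X _⟩

theorem add : PolyEvalsTo x p q → PolyEvalsTo x p' q' → PolyEvalsTo x (p + p') (q + q') := by
  rintro ⟨r, rfl, rfl⟩ ⟨r', rfl, rfl⟩
  exact ⟨r + r', Polynomial.map_add _, Polynomial.map_add _⟩

theorem sub : PolyEvalsTo x p q → PolyEvalsTo x p' q' → PolyEvalsTo x (p - p') (q - q') := by
  rintro ⟨r, rfl, rfl⟩ ⟨r', rfl, rfl⟩
  exact ⟨r - r', Polynomial.map_sub _, Polynomial.map_sub _⟩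

theorem mul : PolyEvalsTo x p q → PolyEvalsTo x p' q' → PolyEvalsTo x (p * p') (q * q') := by
  rintro ⟨r, rfl, rfl⟩ ⟨r', rfl, rfl⟩
  exact ⟨r * r', Polynomial.map_mul _, Polynomial.map_mul _⟩

theorem pow (n : ℕ) : PolyEvalsTo x p q → PolyEvalsTo x (p ^ n) (q ^ n) := by
  rintro ⟨r, rfl, rfl⟩
  exact ⟨r ^ n, Polynomial.map_pow _ n, Polynomial.map_pow _ n⟩

theorem comp :
    PolyEvalsTo x p q → PolyEvalsTo x p' q' → PolyEvalsTo x (p.comp p') (q.comp q') := by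
  rintro ⟨r, rfl, rfl⟩ ⟨r', rfl, rfl⟩
  exact ⟨r.comp r', Polynomial.map_comp _ _ _, Polynomial.map_comp _ _ _⟩

theorem sum {ι : Type*} (s : Finset ι) {p : ι → RatFun[X]} {q : ι → ℂ[X]}
    (h : ∀ i, PolyEvalsTo x (p i) (q i)) : PolyEvalsTo x (∑ i ∈ s, p i) (∑ i ∈ s, q i) := by
  choose r hp hq using h
  exact ⟨∑ i ∈ s, r i, by simp only [Polynomial.map_sum, hp], by simp only [Polynomial.map_sum, hq]⟩

end PolyEvalsTo

theorem polyEvalsTo_P₃ {x : Fin 3 → ℂ} {f₁ f₂ f₃ : RatFun} {y₁ y₂ y₃ : ℂ}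
    (h₁ : EvalsTo x f₁ y₁) (h₂ : EvalsTo x f₂ y₂) (h₃ : EvalsTo x f₃ y₃)
    (n₁ : y₁ ≠ 0) (n₂ : y₂ ≠ 0) (n₃ : y₃ ≠ 0) :
    PolyEvalsTo x (P₃ f₁ f₂ f₃) (P₃ y₁ y₂ y₃) := by
  have e₁ : EvalsTo x 1 1 := EvalsTo.one
  have hnat (n : ℕ) : EvalsTo x n n := by
    simpa only [mem_evalGraph, Prod.fst_natCast, Prod.snd_natCast] using
      natCast_mem (evalGraph x) n
  have e₂ : EvalsTo x 2 2 := mod_cast hnat 2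
  have e₃ : EvalsTo x 3 3 := mod_cast hnat 3
  have e₄ : EvalsTo x 4 4 := mod_cast hnat 4
  have hsq {f : RatFun} {y : ℂ} (h : EvalsTo x f y) : EvalsTo x (f ^ 2) (y ^ 2) := by
    rw [sq, sq]
    exact h.mul h
  have hsum := (h₁.add h₂).add h₃
  have hprod := (h₁.mul h₂).mul h₃
  have htwice := ((e₂.mul h₁).mul h₂).mul h₃
  have nprod : y₁ * y₂ * y₃ ≠ 0 := mul_ne_zero (mul_ne_zero n₁ n₂) n₃
  have ntwice : 2 * y₁ * y₂ * y₃ ≠ 0 :=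
    mul_ne_zero (mul_ne_zero (mul_ne_zero two_ne_zero n₁) n₂) n₃
  have hquad := ((((hsq h₁).add (hsq h₂)).add (hsq h₃)).add ((e₃.mul h₁).mul h₂)).add
    ((e₃.mul h₂).mul h₃) |>.add ((e₃.mul h₁).mul h₃)
  have hrecip := ((e₁.div h₁ n₁).add (e₁.div h₂ n₂)).add (e₁.div h₃ n₃)
  have hquarter := e₁.div e₄ (by norm_num)
  rw [P₃, P₃]
  refine (((?_ : PolyEvalsTo x _ _).sub ?_).add ?_).sub ?_
  · exact (PolyEvalsTo.C (e₁.div hprod nprod)).mul (PolyEvalsTo.X.pow 3)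
  · exact (PolyEvalsTo.C (e₃.mul (hsum.div htwice ntwice))).mul (PolyEvalsTo.X.pow 2)
  · exact (PolyEvalsTo.C (hquad.div htwice ntwice)).mul PolyEvalsTo.X
  · exact PolyEvalsTo.C ((hquarter.mul hsum).mul hrecip)

end Evaluation

/-! ### Pairings, primitive vectors and direction vectors -/

section Pairing

theorem pair_eq {R M : Type*} [SMul R M] [AddCommMonoid M] (δ : Fin 3 → R) (x : Fin 3 → M) :
    pair δ x = δ 0 • x 0 + δ 1 • x 1 + δ 2 • x 2 :=
  Fin.sum_univ_three _

section Module

variable {R M : Type*} [Ring R] [AddCommGroup M] [Module R M] (δ ε : Fin 3 → R) (x : Fin 3 → M)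

theorem pair_zero : pair (0 : Fin 3 → R) x = 0 := by
  simp [pair]

theorem pair_add : pair (δ + ε) x = pair δ x + pair ε x := by
  simp [pair, add_smul, Finset.sum_add_distrib]

theorem pair_neg : pair (-δ) x = -pair δ x := by
  simp [pair]

theorem pair_sub : pair (δ - ε) x = pair δ x - pair ε x := by
  simp [pair, sub_smul]

theorem pair_smul (k : R) : pair (k • δ) x = k • pair δ x := by
  simp [pair, smul_smul, Finset.smul_sum]

end Module

theorem pair_eq_dotProduct {R : Type*} [Semiring R] (δ x : Fin 3 → R) : pair δ x = δ ⬝ᵥ x :=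
  rfl

theorem det_of_three {R : Type*} [CommRing R] (a b c : Fin 3 → R) :
    (Matrix.of ![a, b, c]).det = c ⬝ᵥ crossProduct a b := by
  rw [triple_product_permutation, triple_product_eq_det]
  rfl

theorem det_rotate {R : Type*} [CommRing R] (a b c : Fin 3 → R) :
    (Matrix.of ![b, c, a]).det = (Matrix.of ![a, b, c]).det := by
  rw [det_of_three, det_of_three, triple_product_permutation, triple_product_permutation]

/-- Both sides are the triple product expansion of `a × ((u × v) × a)`. -/
theorem dotProduct_self_smul_crossProduct {R : Type*} [CommRing R] {u v a : Fin 3 → R}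
    (hu : u ⬝ᵥ a = 0) (hv : v ⬝ᵥ a = 0) :
    (a ⬝ᵥ a) • crossProduct u v = (crossProduct u v ⬝ᵥ a) • a := by
  have h := cross_cross_eq_smul_sub_smul' a (crossProduct u v) a
  rw [cross_cross_eq_smul_sub_smul, hu, hv, zero_smul, zero_smul, sub_zero, map_zero] at h
  exact sub_eq_zero.mp h.symm

end Pairing

section Primitive

theorem isPrim_iff_exists_dotProduct_eq_one {v : Lattice3} :
    IsPrim v ↔ ∃ u : Lattice3, v ⬝ᵥ u = 1 := by
  constructor
  · intro hv
    obtain ⟨g, hg⟩ := Finset.gcd_eq_sum_mul Finset.univ v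
    choose u hu using fun i => Finset.gcd_dvd (f := v) (Finset.mem_univ i)
    rcases hv (Finset.univ.gcd v) u (funext hu) with h | h
    · exact ⟨g, hg.symm.trans h⟩
    · exact ⟨-g, by rw [dotProduct_neg, ← neg_eq_iff_eq_neg.mpr h, hg]; rfl⟩
  · rintro ⟨u, hu⟩ l w rfl
    exact Int.isUnit_iff.mp (isUnit_of_dvd_one ⟨w ⬝ᵥ u, by rw [← hu, smul_dotProduct]; rfl⟩)

theorem IsPrim.ne_zero {v : Lattice3} (hv : IsPrim v) : v ≠ 0 := by
  obtain ⟨u, hu⟩ := isPrim_iff_exists_dotProduct_eq_one.mp hv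
  rintro rfl
  simp at hu

variable {a b : Lattice3}

theorem modulus_smul_dirVec (a b : Lattice3) : modulus a b • dirVec a b = crossProduct a b :=
  funext fun i => Int.mul_ediv_cancel' (Finset.gcd_dvd (Finset.mem_univ i))

theorem dirVec_congr {a b c d : Lattice3} {p q : ℤ} (hp : 0 < p) (hq : 0 < q)
    (h : p • crossProduct a b = q • crossProduct c d) : dirVec a b = dirVec c d := by
  have hmodulus : p * modulus a b = q * modulus c d := by
    have hgcd := congrArg Finset.univ.gcd h
    rwa [show p • crossProduct a b = fun i => p * crossProduct a b i from rfl,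
      show q • crossProduct c d = fun i => q * crossProduct c d i from rfl,
      Finset.gcd_mul_left, Finset.gcd_mul_left, Int.normalize_of_nonneg hp.le,
      Int.normalize_of_nonneg hq.le] at hgcd
  funext i
  have hi : p * crossProduct a b i = q * crossProduct c d i := congrFun h i
  rw [dirVec, ← Int.mul_ediv_mul_of_pos _ _ hp, hi, hmodulus, Int.mul_ediv_mul_of_pos _ _ hq,
    dirVec]

theorem modulus_swap (a b : Lattice3) : modulus b a = modulus a b := by
  have h : crossProduct b a = fun i => -1 * crossProduct a b i := by
    funext i
    rw [← cross_anticomm, Pi.neg_apply, neg_one_mul]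
  rw [modulus, h, Finset.gcd_mul_left, show normalize (-1 : ℤ) = 1 from rfl, one_mul, modulus]

theorem dirVec_swap (a b : Lattice3) : dirVec b a = -dirVec a b := by
  funext i
  rw [Pi.neg_apply, dirVec, dirVec, modulus_swap, ← cross_anticomm, Pi.neg_apply]
  exact Int.neg_ediv_of_dvd (Finset.gcd_dvd (Finset.mem_univ i))

theorem pair_dirVec_eq_zero {c : Lattice3} (h : c ⬝ᵥ crossProduct a b = 0) :
    pair (dirVec a b) c = 0 := by
  by_cases hm : modulus a b = 0
  · have hzero : dirVec a b = 0 := funext fun i => by rw [dirVec, hm, Int.ediv_zero, Pi.zero_apply]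
    rw [hzero, pair_eq_dotProduct, zero_dotProduct]
  · rw [← det_of_three, det_eq_modulus_mul_pair_dirVec] at h
    exact (mul_eq_zero.mp h).resolve_left hm

theorem pair_dirVec_left (a b : Lattice3) : pair (dirVec a b) a = 0 :=
  pair_dirVec_eq_zero (dot_self_cross a b)

theorem pair_dirVec_right (a b : Lattice3) : pair (dirVec a b) b = 0 :=
  pair_dirVec_eq_zero (dot_cross_self a b)

theorem modulus_smul_cross_dirVec (a b δ : Lattice3) :
    modulus a b • crossProduct δ (dirVec a b) = pair δ b • a - pair δ a • b := by
  rw [← map_smul, modulus_smul_dirVec, cross_cross_eq_smul_sub_smul', pair_eq_dotProduct,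
    pair_eq_dotProduct, dotProduct_comm δ a]

/-- The form `δ` is parallel to `γ = dirVec a b`, and `γ ⬝ᵥ u = 1` for some `u`, so that
`δ = (δ ⬝ᵥ u) γ`. -/
theorem exists_zsmul_dirVec_eq {δ : Lattice3} (hab : LinearIndependent ℤ ![a, b])
    (ha : pair δ a = 0) (hb : pair δ b = 0) : ∃ k : ℤ, k • dirVec a b = δ := by
  obtain ⟨u, hu⟩ := isPrim_iff_exists_dotProduct_eq_one.mp (isPrim_dirVec hab)
  have hcross : crossProduct δ (dirVec a b) = 0 := by
    have h := modulus_smul_cross_dirVec a b δ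
    rw [ha, hb, zero_smul, zero_smul, sub_zero] at h
    exact (smul_eq_zero.mp h).resolve_left (modulus_pos hab).ne'
  have h := cross_cross_eq_smul_sub_smul' u δ (dirVec a b)
  rw [hcross, map_zero, dotProduct_comm u, hu, one_smul] at h
  exact ⟨δ ⬝ᵥ u, (sub_eq_zero.mp h.symm).symm⟩

end Primitive

/-! ### The domains `U a` -/

section Domain

/-- The cross product `Im x × Re x`; the form `δ × ε` takes on it the value `Im(δ(x) conj ε(x))`,
so that membership of `x` in `U a` becomes positivity of the pairing with `a`. -/
def imCross (x : Fin 3 → ℂ) : Fin 3 → ℝ :=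
  crossProduct (fun i => (x i).im) (fun i => (x i).re)

theorem im_pair_mul_conj {R : Type*} [CommRing R] [Algebra R ℝ] [Algebra R ℂ]
    [IsScalarTower R ℝ ℂ] (δ ε : Fin 3 → R) (x : Fin 3 → ℂ) :
    (pair δ x * (starRingEnd ℂ) (pair ε x)).im = pair (crossProduct δ ε) (imCross x) := by
  simp only [pair_eq, imCross, cross_apply, Matrix.cons_val, Algebra.smul_def,
    IsScalarTower.algebraMap_apply R ℝ ℂ, Complex.coe_algebraMap, Complex.mul_re, Complex.mul_im,
    Complex.conj_re, Complex.conj_im, Complex.add_re, Complex.add_im, Complex.ofReal_re,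
    Complex.ofReal_im, zero_mul, sub_zero, add_zero, map_sub, map_mul]
  ring

theorem pair_imCross_pos {a : Lattice3} (ha : a ≠ 0) {x : Fin 3 → ℂ} (hx : x ∈ U a) :
    0 < pair a (imCross x) := by
  obtain ⟨α, β, hα, hβ, -, horiented, him⟩ := hx
  set A : Fin 3 → ℚ := fun i => a i with hA
  have hAA : 0 < A ⬝ᵥ A := by
    have hA0 : A ≠ 0 := fun h => ha (funext fun i => by simpa [hA] using congrFun h i)
    simpa using Matrix.dotProduct_star_self_pos_iff.mpr hA0
  have hdet : 0 < crossProduct α β ⬝ᵥ A := by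
    have h := horiented A hAA
    rwa [det_of_three, dotProduct_comm] at h
  have hparallel := congrArg (pair · (imCross x)) (dotProduct_self_smul_crossProduct hα hβ)
  simp only [pair_smul, ← im_pair_mul_conj α β] at hparallel
  have hpos : 0 < (crossProduct α β ⬝ᵥ A) • pair A (imCross x) := hparallel ▸ smul_pos hAA him
  have hcast : pair A (imCross x) = pair a (imCross x) := by
    simp [pair, hA, Rat.smul_def]
  rw [← hcast]
  exact pos_of_smul_pos_left hpos hdet.le

theorem modulus_mul_im (a b δ : Lattice3) (x : Fin 3 → ℂ) :
    (modulus a b : ℝ) * (pair δ x * (starRingEnd ℂ) (pair (dirVec a b) x)).im =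
      pair δ b * pair a (imCross x) - pair δ a * pair b (imCross x) := by
  have h := congrArg (pair · (imCross x)) (modulus_smul_cross_dirVec a b δ)
  simp only [pair_sub, pair_smul, ← im_pair_mul_conj] at h
  simpa only [zsmul_eq_mul] using h

theorem pair_dirVec_ne_zero {a b : Lattice3} (hab : LinearIndependent ℤ ![a, b])
    {x : Fin 3 → ℂ} (ha : 0 < pair a (imCross x)) : pair (dirVec a b) x ≠ 0 := by
  intro hzero
  have hright : pair (crossProduct a (dirVec a b)) b ≠ 0 := by
    rw [pair_eq_dotProduct, dotProduct_comm, triple_product_permutation,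
      triple_product_permutation, ← cross_anticomm, ← modulus_smul_dirVec, dotProduct_neg,
      dotProduct_smul]
    exact neg_ne_zero.mpr (smul_ne_zero (modulus_pos hab).ne'
      (dotProduct_self_eq_zero.not.mpr (isPrim_dirVec hab).ne_zero))
  have h := modulus_mul_im a b (crossProduct a (dirVec a b)) x
  rw [hzero, pair_eq_dotProduct _ a, dotProduct_comm _ a, dot_self_cross] at h
  simp only [map_zero, mul_zero, Complex.zero_im, Int.cast_zero, zero_mul, sub_zero] at h
  exact mul_ne_zero (Int.cast_ne_zero.mpr hright) ha.ne' h.symm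

end Domain

/-! ### Products over classes of a cone -/

section ClassProducts

/-- The exponential `exp(-2πi (δ(x) - w) / γ(x))`, which depends only on the class of `δ`
modulo `γ`. -/
def expTerm (γ : Lattice3) (w : ℂ) (x : Fin 3 → ℂ) (δ : Lattice3) : ℂ :=
  Complex.exp (-2 * Real.pi * Complex.I * (pair δ x - w) / pair γ x)

/-- The factor `1 - g δ` attached to the class of `δ` modulo `γ`, for a function `g` of forms that
depends only on the class. -/
def classFactor (C : Set Lattice3) (γ : Lattice3) (g : Lattice3 → ℂ) (q : classes C γ) : ℂ :=
  1 - g (Quotient.out q.1)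

/-- The numerator of `Γ_{a,b}`; the denominator is the numerator of `Γ_{b,a}`. -/
def numProd (a b : Lattice3) (w : ℂ) (x : Fin 3 → ℂ) : ℂ :=
  ∏' q, numFactor a b w x q

theorem exists_out_eq (γ δ : Lattice3) : ∃ k : ℤ,
    Quotient.out (δ : Lattice3 ⧸ AddSubgroup.zmultiples γ) = δ + k • γ := by
  obtain ⟨⟨_, k, rfl⟩, hk⟩ := QuotientAddGroup.mk_out_eq_add (AddSubgroup.zmultiples γ) δ
  exact ⟨k, hk⟩

theorem pair_add_zsmul_of_eq_zero {γ a : Lattice3} (h : pair γ a = 0) (δ : Lattice3) (k : ℤ) :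
    pair (δ + k • γ) a = pair δ a := by
  rw [pair_add, pair_smul, h, smul_zero, add_zero]

theorem expTerm_add_zsmul {γ : Lattice3} {x : Fin 3 → ℂ} (hγ : pair γ x ≠ 0) (w : ℂ)
    (δ : Lattice3) (k : ℤ) : expTerm γ w x (δ + k • γ) = expTerm γ w x δ := by
  have hexponent : -2 * Real.pi * Complex.I * (pair δ x + k * pair γ x - w) / pair γ x =
      -2 * Real.pi * Complex.I * (pair δ x - w) / pair γ x - k * (2 * Real.pi * Complex.I) := by
    field_simp
    ring
  rw [expTerm, expTerm, pair_add, pair_smul, zsmul_eq_mul, hexponent]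
  exact Complex.exp_periodic.sub_int_mul_eq k

theorem expTerm_out {γ : Lattice3} {x : Fin 3 → ℂ} (hγ : pair γ x ≠ 0) (w : ℂ) (δ : Lattice3) :
    expTerm γ w x (Quotient.out (δ : Lattice3 ⧸ AddSubgroup.zmultiples γ)) = expTerm γ w x δ := by
  obtain ⟨k, hk⟩ := exists_out_eq γ δ
  rw [hk, expTerm_add_zsmul hγ]

theorem expTerm_neg (γ : Lattice3) (w : ℂ) (x : Fin 3 → ℂ) (δ : Lattice3) :
    expTerm (-γ) w x δ = Complex.exp (2 * Real.pi * Complex.I * (pair δ x - w) / pair γ x) := by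
  rw [expTerm, pair_neg, div_neg, ← neg_div]
  ring_nf

theorem multipliable_classFactor_neg (C : Set Lattice3) (γ : Lattice3) (g : Lattice3 → ℂ) :
    Multipliable (classFactor C (-γ) g) ↔ Multipliable (classFactor C γ g) := by
  unfold classFactor classes
  rw [AddSubgroup.zmultiples_neg]

theorem tprod_classFactor_neg (C : Set Lattice3) (γ : Lattice3) (g : Lattice3 → ℂ) :
    ∏' q, classFactor C (-γ) g q = ∏' q, classFactor C γ g q := by
  unfold classFactor classes
  rw [AddSubgroup.zmultiples_neg]

theorem coneMP_eq (a b : Lattice3) : coneMP a b = conePM b a :=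
  Set.ext fun _ => and_comm

theorem numFactor_eq_classFactor (a b : Lattice3) (w : ℂ) (x : Fin 3 → ℂ) :
    numFactor a b w x = classFactor (conePM a b) (dirVec a b) (expTerm (dirVec a b) w x) :=
  rfl

theorem numProd_eq_tprod (a b : Lattice3) (w : ℂ) (x : Fin 3 → ℂ) : numProd a b w x =
    ∏' q, classFactor (conePM a b) (dirVec a b) (expTerm (dirVec a b) w x) q :=
  rfl

theorem denFactor_eq_classFactor (a b : Lattice3) (w : ℂ) (x : Fin 3 → ℂ) :
    denFactor a b w x = classFactor (coneMP a b) (dirVec a b) (expTerm (dirVec b a) w x) := by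
  funext q
  rw [classFactor, dirVec_swap a b, expTerm_neg, denFactor]

theorem multipliable_denFactor_iff (a b : Lattice3) (w : ℂ) (x : Fin 3 → ℂ) :
    Multipliable (denFactor a b w x) ↔ Multipliable (numFactor b a w x) := by
  rw [denFactor_eq_classFactor, coneMP_eq, dirVec_swap b a, multipliable_classFactor_neg]
  rfl

theorem tprod_denFactor (a b : Lattice3) (w : ℂ) (x : Fin 3 → ℂ) :
    ∏' q, denFactor a b w x q = numProd b a w x := by
  rw [denFactor_eq_classFactor, coneMP_eq, dirVec_swap b a, tprod_classFactor_neg]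
  rfl

end ClassProducts

/-! ### Convergence -/

section Convergence

variable {a b : Lattice3} {x : Fin 3 → ℂ}

theorem norm_expTerm_dirVec (hab : LinearIndependent ℤ ![a, b]) (x : Fin 3 → ℂ) (w : ℂ)
    (δ : Lattice3) :
    ‖expTerm (dirVec a b) w x δ‖ =
      Real.exp (-(2 * Real.pi * (w / pair (dirVec a b) x).im)) *
        Real.exp (2 * Real.pi / (modulus a b * Complex.normSq (pair (dirVec a b) x)) *
          (pair δ b * pair a (imCross x) - pair δ a * pair b (imCross x))) := by
  have hs : (modulus a b : ℝ) ≠ 0 := mod_cast (modulus_pos hab).ne'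
  have hexponent : -2 * Real.pi * Complex.I * (pair δ x - w) / pair (dirVec a b) x =
      2 * Real.pi * Complex.I * (w / pair (dirVec a b) x - pair δ x / pair (dirVec a b) x) := by
    ring
  have him : (pair δ x / pair (dirVec a b) x).im =
      (pair δ b * pair a (imCross x) - pair δ a * pair b (imCross x)) /
        (modulus a b * Complex.normSq (pair (dirVec a b) x)) := by
    rw [← modulus_mul_im, im_div_eq, mul_div_mul_left _ _ hs]
  rw [expTerm, hexponent, norm_exp_two_pi_I_mul, Complex.sub_im, him, ← Real.exp_add]
  ring_nf

theorem add_zsmul_dirVec_mem_conePM {δ : Lattice3} (hδ : δ ∈ conePM a b) (k : ℤ) :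
    δ + k • dirVec a b ∈ conePM a b := by
  rwa [conePM, Set.mem_ofPred_eq, pair_add_zsmul_of_eq_zero (pair_dirVec_left a b),
    pair_add_zsmul_of_eq_zero (pair_dirVec_right a b)]

theorem out_mem_conePM (q : classes (conePM a b) (dirVec a b)) :
    Quotient.out q.1 ∈ conePM a b := by
  obtain ⟨_, δ, hδ, rfl⟩ := q
  obtain ⟨k, hk⟩ := exists_out_eq (dirVec a b) δ
  exact hk ▸ add_zsmul_dirVec_mem_conePM hδ k

theorem injective_toNat_pair_out (hab : LinearIndependent ℤ ![a, b]) :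
    Function.Injective fun q : classes (conePM a b) (dirVec a b) =>
      ((pair (Quotient.out q.1) a).toNat, (-pair (Quotient.out q.1) b).toNat) := by
  intro q q' h
  obtain ⟨hqa, hqb⟩ := out_mem_conePM q
  obtain ⟨hqa', hqb'⟩ := out_mem_conePM q'
  obtain ⟨ha, hb⟩ := Prod.ext_iff.mp h
  dsimp only at ha hb
  obtain ⟨k, hk⟩ := exists_zsmul_dirVec_eq (δ := -Quotient.out q.1 + Quotient.out q'.1) hab
    (by rw [pair_add, pair_neg]; omega) (by rw [pair_add, pair_neg]; omega)
  apply Subtype.ext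
  rw [← QuotientAddGroup.out_eq' q.1, ← QuotientAddGroup.out_eq' q'.1, QuotientAddGroup.eq]
  exact ⟨k, hk⟩

theorem summable_norm_expTerm (hab : LinearIndependent ℤ ![a, b])
    (ha : 0 < pair a (imCross x)) (hb : 0 < pair b (imCross x)) (w : ℂ) :
    Summable fun q : classes (conePM a b) (dirVec a b) =>
      ‖-expTerm (dirVec a b) w x (Quotient.out q.1)‖ := by
  obtain ⟨K, κ, hκ, hnorm⟩ : ∃ K κ : ℝ, 0 < κ ∧ ∀ δ, ‖expTerm (dirVec a b) w x δ‖ =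
      K * Real.exp (κ * (pair δ b * pair a (imCross x) - pair δ a * pair b (imCross x))) :=
    ⟨_, _, div_pos Real.two_pi_pos (mul_pos (mod_cast modulus_pos hab)
      (Complex.normSq_pos.mpr (pair_dirVec_ne_zero hab ha))), norm_expTerm_dirVec hab x w⟩
  have hlt : ∀ {N : ℝ}, 0 < N → Real.exp (-(κ * N)) < 1 := fun hN =>
    Real.exp_lt_one_iff.mpr (neg_neg_of_pos (mul_pos hκ hN))
  refine (((summable_pow_mul_pow (Real.exp_pos _).le (hlt hb) (Real.exp_pos _).le
    (hlt ha)).comp_injective (injective_toNat_pair_out hab)).mul_left K).congr fun q => ?_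
  obtain ⟨hqa, hqb⟩ := out_mem_conePM q
  have ha' : ((pair (Quotient.out q.1) a).toNat : ℝ) = (pair (Quotient.out q.1) a : ℤ) := mod_cast
    Int.toNat_of_nonneg hqa.le
  have hb' : ((-pair (Quotient.out q.1) b).toNat : ℝ) = -(pair (Quotient.out q.1) b : ℤ) := mod_cast
    Int.toNat_of_nonneg (neg_nonneg.mpr hqb)
  rw [norm_neg, hnorm, Function.comp_apply, ← Real.exp_nat_mul, ← Real.exp_nat_mul,
    ← Real.exp_add, ha', hb']
  ring_nf

theorem conePM_eq_empty (ha : 0 < pair a (imCross x)) (hb : 0 < pair b (imCross x))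
    (hab : ¬ LinearIndependent ℤ ![a, b]) : conePM a b = ∅ := by
  simp only [LinearIndependent.pair_iff, not_forall] at hab
  obtain ⟨s, t, h, hst⟩ := hab
  have hx : (s : ℝ) * pair a (imCross x) + t * pair b (imCross x) = 0 := by
    rw [← zsmul_eq_mul, ← zsmul_eq_mul, ← pair_smul, ← pair_smul, ← pair_add, h, pair_zero]
  have hs : s ≠ 0 := by
    rintro rfl
    simp only [Int.cast_zero, zero_mul, zero_add, mul_eq_zero, hb.ne', or_false] at hx
    exact hst ⟨rfl, mod_cast hx⟩
  have hst_neg : s * t < 0 := by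
    have hpos : 0 < (s : ℝ) * s * pair a (imCross x) :=
      mul_pos (mul_self_pos.mpr (mod_cast hs)) ha
    have hneg : (s * t : ℝ) < 0 := by
      refine neg_of_mul_neg_left ?_ hb.le
      linear_combination hpos + s * hx
    exact_mod_cast hneg
  refine Set.eq_empty_of_forall_notMem fun δ ⟨hδa, hδb⟩ => ?_
  have hδ : s * pair δ a + t * pair δ b = 0 := by
    have hδ := congrArg (δ ⬝ᵥ ·) h
    simp only [dotProduct_add, dotProduct_smul, dotProduct_zero, smul_eq_mul] at hδ
    exact hδ
  have hpos : 0 < s * s * pair δ a := mul_pos (mul_self_pos.mpr hs) hδa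
  have hnonneg : 0 ≤ s * t * pair δ b := mul_nonneg_of_nonpos_of_nonpos hst_neg.le hδb
  exact absurd (by linear_combination s * hδ) (add_pos_of_pos_of_nonneg hpos hnonneg).ne'

theorem multipliable_numFactor (ha : 0 < pair a (imCross x)) (hb : 0 < pair b (imCross x))
    (w : ℂ) : Multipliable (numFactor a b w x) := by
  by_cases hab : LinearIndependent ℤ ![a, b]
  · have h := multipliable_one_add_of_summable (summable_norm_expTerm hab ha hb w)
    simp only [← sub_eq_add_neg] at h
    exact h
  · have : IsEmpty (classes (conePM a b) (dirVec a b)) := by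
      rw [classes, conePM_eq_empty ha hb hab, Set.image_empty]
      infer_instance
    exact multipliable_empty

theorem multipliable_denFactor (ha : 0 < pair a (imCross x)) (hb : 0 < pair b (imCross x))
    (w : ℂ) : Multipliable (denFactor a b w x) :=
  (multipliable_denFactor_iff a b w x).mpr (multipliable_numFactor hb ha w)

theorem numProd_eq_one (h : conePM a b = ∅) (w : ℂ) (x : Fin 3 → ℂ) : numProd a b w x = 1 := by
  have : IsEmpty (classes (conePM a b) (dirVec a b)) := by
    rw [classes, h, Set.image_empty]
    infer_instance
  exact tprod_empty

theorem expTerm_ne_one {γ : Lattice3} (hγ : pair γ x ≠ 0) {w : ℂ} {δ : Lattice3}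
    (hw : ∀ k : ℤ, w ≠ pair (δ + k • γ) x) : expTerm γ w x δ ≠ 1 := by
  rw [expTerm, ne_eq, Complex.exp_eq_one_iff]
  rintro ⟨k, hk⟩
  rw [div_eq_iff hγ] at hk
  apply hw k
  rw [pair_add, pair_smul, zsmul_eq_mul]
  apply mul_left_cancel₀ Complex.two_pi_I_ne_zero
  linear_combination hk

theorem numProd_ne_zero (ha : 0 < pair a (imCross x)) (hb : 0 < pair b (imCross x)) {w : ℂ}
    (hw : ∀ δ ∈ conePM a b, w ≠ pair δ x) : numProd a b w x ≠ 0 := by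
  by_cases hab : LinearIndependent ℤ ![a, b]
  · have h := tprod_one_add_ne_zero_of_summable (fun q => ?_) (summable_norm_expTerm hab ha hb w)
    · simp only [← sub_eq_add_neg] at h
      exact h
    · rw [← sub_eq_add_neg]
      exact sub_ne_zero.mpr (expTerm_ne_one (pair_dirVec_ne_zero hab ha) fun k =>
        hw _ (add_zsmul_dirVec_mem_conePM (out_mem_conePM q) k)).symm
  · rw [numProd_eq_one (conePM_eq_empty ha hb hab)]
    exact one_ne_zero

theorem NotPole.numProd_ne_zero {w : ℂ} (hw : NotPole a b w x) (ha : 0 < pair a (imCross x))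
    (hb : 0 < pair b (imCross x)) : numProd b a w x ≠ 0 :=
  EllGamma.numProd_ne_zero hb ha (coneMP_eq a b ▸ hw)

theorem wedgeGamma_eq (ha : 0 < pair a (imCross x)) (hb : 0 < pair b (imCross x)) (w : ℂ) :
    wedgeGamma a b w x = numProd a b w x / numProd b a w x := by
  by_cases hab : LinearIndependent ℤ ![a, b]
  · rw [wedgeGamma, if_pos hab, tprod_denFactor, ← numProd]
  · have hba : ¬ LinearIndependent ℤ ![b, a] := mt LinearIndependent.pair_symm_iff.mp hab
    rw [wedgeGamma, if_neg hab, numProd_eq_one (conePM_eq_empty ha hb hab),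
      numProd_eq_one (conePM_eq_empty hb ha hba), div_one]

end Convergence

/-! ### Coplanar wedges -/

section Coplanar

variable {a b c : Lattice3} {x : Fin 3 → ℂ} {w : ℂ}

theorem tprod_classFactor_union {γ : Lattice3} {C D : Set Lattice3} {g : Lattice3 → ℂ}
    (hCD : ∀ δ ∈ C, ∀ k : ℤ, δ + k • γ ∉ D) (hC : Multipliable (classFactor C γ g))
    (hD : Multipliable (classFactor D γ g)) :
    ∏' q, classFactor (C ∪ D) γ g q = (∏' q, classFactor C γ g q) * ∏' q, classFactor D γ g q := by
  have hdisj : Disjoint (classes C γ) (classes D γ) := by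
    rw [Set.disjoint_left]
    rintro _ ⟨δ, hδ, rfl⟩ ⟨ε, hε, h⟩
    obtain ⟨k, hk⟩ := QuotientAddGroup.eq.mp h.symm
    refine hCD δ hδ k ?_
    rwa [show k • γ = -δ + ε from hk, add_neg_cancel_left]
  have hunion : classes (C ∪ D) γ = classes C γ ∪ classes D γ := Set.image_union ..
  unfold classFactor
  rw [hunion]
  exact Multipliable.tprod_union_disjoint
    (f := fun q : Lattice3 ⧸ AddSubgroup.zmultiples γ => 1 - g (Quotient.out q)) hdisj hC hD

theorem pair_eq_of_smul_eq {r m n : ℤ} (h : r • b = m • a + n • c) (δ : Lattice3) :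
    r * pair δ b = m * pair δ a + n * pair δ c := by
  have hδ := congrArg (δ ⬝ᵥ ·) h
  simp only [dotProduct_add, dotProduct_smul, smul_eq_mul] at hδ
  exact hδ

theorem conePM_union {r m n : ℤ} (hr : 0 < r) (hm : 0 ≤ m) (hn : 0 ≤ n) (hmn : 0 < m + n)
    (h : r • b = m • a + n • c) : conePM a b ∪ conePM b c = conePM a c := by
  ext δ
  have hδ := pair_eq_of_smul_eq h δ
  simp only [conePM, Set.mem_union, Set.mem_ofPred_eq]
  constructor
  · rintro (⟨ha, hb⟩ | ⟨hb, hc⟩)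
    · refine ⟨ha, ?_⟩
      by_contra! hc
      nlinarith
    · refine ⟨?_, hc⟩
      by_contra! ha
      nlinarith
  · rintro ⟨ha, hc⟩
    exact (le_or_gt (pair δ b) 0).imp (⟨ha, ·⟩) (⟨·, hc⟩)

theorem not_linearIndependent_or_dirVec_eq {r m n : ℤ} (hr : 0 < r) (hn : 0 ≤ n)
    (h : r • b = m • a + n • c) : ¬ LinearIndependent ℤ ![a, b] ∨ dirVec a b = dirVec a c := by
  rcases hn.eq_or_lt with rfl | hn
  · refine .inl fun hab => hr.ne' ?_
    refine neg_eq_zero.mp (LinearIndependent.pair_iff.mp hab m (-r) ?_).2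
    rw [neg_smul, h, zero_smul, add_zero, add_neg_cancel]
  · refine .inr (dirVec_congr hr hn ?_)
    rw [← map_smul, h, map_add, map_smul, map_smul, cross_self, smul_zero, zero_add]

/-- The cone of `(a, c)` is cut into those of `(a, b)` and `(b, c)` by the wall `δ(b) = 0`. -/
theorem numProd_mul_of_between (ha : 0 < pair a (imCross x)) (hb : 0 < pair b (imCross x))
    (hc : 0 < pair c (imCross x)) {r m n : ℤ} (hr : 0 < r) (hm : 0 ≤ m) (hn : 0 ≤ n)
    (hmn : 0 < m + n) (h : r • b = m • a + n • c) (w : ℂ) :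
    numProd a b w x * numProd b c w x = numProd a c w x := by
  have hunion := conePM_union hr hm hn hmn h
  have hab : conePM a b = ∅ ∨ dirVec a b = dirVec a c :=
    (not_linearIndependent_or_dirVec_eq hr hn h).imp_left (conePM_eq_empty ha hb)
  have hbc : conePM b c = ∅ ∨ dirVec b c = dirVec a c := by
    rw [dirVec_swap c b, dirVec_swap c a, neg_inj]
    exact (not_linearIndependent_or_dirVec_eq hr hm (add_comm (m • a) _ ▸ h)).imp_left fun hcb =>
      conePM_eq_empty hb hc (mt LinearIndependent.pair_symm_iff.mp hcb)
  rcases hab with hab | hab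
  · rw [hab, Set.empty_union] at hunion
    rw [numProd_eq_one hab, one_mul]
    rcases hbc with hbc | hbc
    · rw [numProd_eq_one hbc, numProd_eq_one (hunion ▸ hbc)]
    · rw [numProd_eq_tprod, numProd_eq_tprod, hunion, hbc]
  rcases hbc with hbc | hbc
  · rw [hbc, Set.union_empty] at hunion
    rw [numProd_eq_one hbc, mul_one, numProd_eq_tprod, numProd_eq_tprod, hunion, hab]
  have hMab := multipliable_numFactor ha hb w
  have hMbc := multipliable_numFactor hb hc w
  rw [numFactor_eq_classFactor, hab] at hMab
  rw [numFactor_eq_classFactor, hbc] at hMbc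
  rw [numProd_eq_tprod, numProd_eq_tprod, numProd_eq_tprod, ← hunion, hab, hbc]
  refine (tprod_classFactor_union (fun δ hδ k hmem => ?_) hMab hMbc).symm
  rw [← hab] at hmem
  exact hmem.1.not_ge (pair_add_zsmul_of_eq_zero (pair_dirVec_right a b) δ k ▸ hδ.2)

theorem wedgeGamma_mul_of_between (ha : 0 < pair a (imCross x)) (hb : 0 < pair b (imCross x))
    (hc : 0 < pair c (imCross x)) {r m n : ℤ} (hr : 0 < r) (hm : 0 ≤ m) (hn : 0 ≤ n)
    (hmn : 0 < m + n) (h : r • b = m • a + n • c) (hab : NotPole a b w x) (hbc : NotPole b c w x)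
    (hca : NotPole c a w x) :
    wedgeGamma a b w x * wedgeGamma b c w x * wedgeGamma c a w x = 1 := by
  have hba := hab.numProd_ne_zero ha hb
  have hcb := hbc.numProd_ne_zero hb hc
  have hac := hca.numProd_ne_zero hc ha
  rw [wedgeGamma_eq ha hb, wedgeGamma_eq hb hc, wedgeGamma_eq hc ha,
    ← numProd_mul_of_between hc hb ha hr hn hm (add_comm m n ▸ hmn) (add_comm (m • a) _ ▸ h)]
  rw [← numProd_mul_of_between ha hb hc hr hm hn hmn h] at hac ⊢
  have hab := left_ne_zero_of_mul hac
  have hbc := right_ne_zero_of_mul hac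
  field_simp

theorem eq_zero_of_smul_add_eq_zero (ha : 0 < pair a (imCross x)) (hb : 0 < pair b (imCross x))
    (hc : 0 < pair c (imCross x)) {p q s : ℤ} (hp : 0 ≤ p) (hq : 0 ≤ q) (hs : 0 ≤ s)
    (h : p • a + q • b + s • c = 0) : p = 0 ∧ q = 0 ∧ s = 0 := by
  have hx := congrArg (pair · (imCross x)) h
  simp only [pair_add, pair_smul, pair_zero] at hx
  have hpa := smul_nonneg hp ha.le
  have hqb := smul_nonneg hq hb.le
  have hsc := smul_nonneg hs hc.le
  rw [add_eq_zero_iff_of_nonneg (add_nonneg hpa hqb) hsc,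
    add_eq_zero_iff_of_nonneg hpa hqb] at hx
  simpa only [smul_eq_zero, ha.ne', hb.ne', hc.ne', or_false, and_assoc] using hx

theorem exists_between (ha : 0 < pair a (imCross x)) (hb : 0 < pair b (imCross x))
    (hc : 0 < pair c (imCross x)) (habc : ¬ LinearIndependent ℤ ![a, b, c]) :
    ∃ r m n : ℤ, 0 < r ∧ 0 ≤ m ∧ 0 ≤ n ∧ 0 < m + n ∧
      (r • b = m • a + n • c ∨ r • c = m • b + n • a ∨ r • a = m • c + n • b) := by
  obtain ⟨p, q, s, h, hne⟩ : ∃ p q s : ℤ, p • a + q • b + s • c = 0 ∧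
      ¬ (p = 0 ∧ q = 0 ∧ s = 0) := by
    obtain ⟨g, hg, i, hi⟩ := Fintype.not_linearIndependent_iff.mp habc
    rw [Fin.sum_univ_three] at hg
    exact ⟨g 0, g 1, g 2, hg, fun ⟨h0, h1, h2⟩ => hi (by fin_cases i <;> assumption)⟩
  wlog hsign : 0 ≤ p ∧ 0 ≤ s ∨ 0 ≤ q ∧ 0 ≤ p ∨ 0 ≤ s ∧ 0 ≤ q generalizing p q s
  · refine this (-p) (-q) (-s) ?_ (by omega) (by omega)
    rw [neg_smul, neg_smul, neg_smul, ← neg_add, ← neg_add, h, neg_zero]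
  have hneg : ¬ (0 ≤ p ∧ 0 ≤ q ∧ 0 ≤ s) := fun ⟨hp, hq, hs⟩ =>
    hne (eq_zero_of_smul_add_eq_zero ha hb hc hp hq hs h)
  have hpos : ¬ (p ≤ 0 ∧ q ≤ 0 ∧ s ≤ 0) := fun ⟨hp, hq, hs⟩ => by
    have h0 := eq_zero_of_smul_add_eq_zero ha hb hc (neg_nonneg.mpr hp) (neg_nonneg.mpr hq)
      (neg_nonneg.mpr hs)
      (by rw [neg_smul, neg_smul, neg_smul, ← neg_add, ← neg_add, h, neg_zero])
    omega
  rcases hsign with hsign | hsign | hsign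
  · refine ⟨-q, p, s, by omega, by omega, by omega, by omega, .inl ?_⟩
    rw [neg_smul, eq_comm, ← add_eq_zero_iff_eq_neg, ← h]
    abel
  · refine ⟨-s, q, p, by omega, by omega, by omega, by omega, .inr (.inl ?_)⟩
    rw [neg_smul, eq_comm, ← add_eq_zero_iff_eq_neg, ← h]
    abel
  · refine ⟨-p, s, q, by omega, by omega, by omega, by omega, .inr (.inr ?_)⟩
    rw [neg_smul, eq_comm, ← add_eq_zero_iff_eq_neg, ← h]
    abel

theorem wedgeGamma_mul_of_dependent (ha : 0 < pair a (imCross x)) (hb : 0 < pair b (imCross x))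
    (hc : 0 < pair c (imCross x)) (habc : ¬ LinearIndependent ℤ ![a, b, c])
    (hab : NotPole a b w x) (hbc : NotPole b c w x) (hca : NotPole c a w x) :
    wedgeGamma a b w x * wedgeGamma b c w x * wedgeGamma c a w x = 1 := by
  obtain ⟨r, m, n, hr, hm, hn, hmn, h | h | h⟩ := exists_between ha hb hc habc
  · exact wedgeGamma_mul_of_between ha hb hc hr hm hn hmn h hab hbc hca
  · rw [mul_rotate, wedgeGamma_mul_of_between hb hc ha hr hm hn hmn h hbc hca hab]
  · rw [← mul_rotate, wedgeGamma_mul_of_between hc ha hb hr hm hn hmn h hca hab hbc]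

end Coplanar

/-! ### Dual families and lattice points of a parallelepiped -/

/-- The forms `ξ₀, ξ₁, ξ₂` are, up to positive factors, the dual basis of `v₀, v₁, v₂`. -/
structure IsDualFamily (v ξ : Fin 3 → Lattice3) : Prop where
  pos : ∀ i, 0 < pair (ξ i) (v i)
  eq_zero : ∀ i j, i ≠ j → pair (ξ i) (v j) = 0

/-- The lattice points of the half-open parallelepiped spanned by a dual family `ξ` of `v`. -/
def fundDomain (v ξ : Fin 3 → Lattice3) : Set Lattice3 :=
  {δ | ∀ i, pair δ (v i) ∈ Set.Ico 0 (pair (ξ i) (v i))}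

theorem eq_of_mul_sub_eq_mul_sub {e m n s t : ℤ} (hs : s ∈ Set.Ico 0 e) (ht : t ∈ Set.Ico 0 e)
    (h : m * e - s = n * e - t) : m = n := by
  have hzero := Int.eq_zero_of_abs_lt_dvd (m := e) (x := s - t) ⟨m - n, by linear_combination -h⟩
    (abs_sub_lt_of_nonneg_of_lt hs.1 hs.2 ht.1 ht.2)
  exact mul_right_cancel₀ (hs.1.trans_lt hs.2).ne' (by linear_combination h + hzero)

namespace IsDualFamily

variable {v ξ : Fin 3 → Lattice3}

theorem pair_sum_smul (h : IsDualFamily v ξ) (n : Fin 3 → ℤ) (j : Fin 3) :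
    pair (∑ i, n i • ξ i) (v j) = n j * pair (ξ j) (v j) := by
  rw [pair_eq_dotProduct, sum_dotProduct, Finset.sum_eq_single j]
  · rw [smul_dotProduct, smul_eq_mul, pair_eq_dotProduct]
  · intro i _ hij
    rw [smul_dotProduct, ← pair_eq_dotProduct, h.eq_zero i j hij, smul_zero]
  · simp

theorem exists_sum_smul_sub_mem (h : IsDualFamily v ξ) (δ : Lattice3) :
    ∃ n : Fin 3 → ℤ, ∑ i, n i • ξ i - δ ∈ fundDomain v ξ := by
  refine ⟨fun i => -(-pair δ (v i) / pair (ξ i) (v i)), fun j => ?_⟩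
  have hmod : -(-pair δ (v j) / pair (ξ j) (v j)) * pair (ξ j) (v j) - pair δ (v j) =
      -pair δ (v j) % pair (ξ j) (v j) := by
    rw [Int.emod_def]
    ring
  rw [pair_sub, h.pair_sum_smul, hmod]
  exact ⟨Int.emod_nonneg _ (h.pos j).ne', Int.emod_lt_of_pos _ (h.pos j)⟩

theorem eq_of_sum_smul_sub_eq (h : IsDualFamily v ξ) {δ ε : Lattice3} (hδ : δ ∈ fundDomain v ξ)
    (hε : ε ∈ fundDomain v ξ) {m n : Fin 3 → ℤ}
    (hmn : ∑ i, m i • ξ i - δ = ∑ i, n i • ξ i - ε) : m = n ∧ δ = ε := by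
  have hm : m = n := funext fun j => by
    have hj := congrArg (pair · (v j)) hmn
    simp only [pair_sub, h.pair_sum_smul] at hj
    exact eq_of_mul_sub_eq_mul_sub (hδ j) (hε j) hj
  exact ⟨hm, sub_right_injective (hm ▸ hmn)⟩

theorem det_mul_det (h : IsDualFamily v ξ) :
    (Matrix.of ξ).det * (Matrix.of v).det = ∏ i, pair (ξ i) (v i) := by
  have hdiag : Matrix.of ξ * (Matrix.of v)ᵀ = Matrix.diagonal fun i => pair (ξ i) (v i) := by
    ext i j
    rcases eq_or_ne i j with rfl | hij
    · rw [Matrix.diagonal_apply_eq]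
      rfl
    · rw [Matrix.diagonal_apply_ne _ hij]
      exact h.eq_zero i j hij
  rw [← Matrix.det_transpose (Matrix.of v), ← Matrix.det_mul, hdiag, Matrix.det_diagonal]

theorem det_ne_zero (h : IsDualFamily v ξ) : (Matrix.of ξ).det ≠ 0 :=
  left_ne_zero_of_mul (h.det_mul_det ▸ (Finset.prod_pos fun i _ => h.pos i).ne')

/-- The fundamental domain represents the quotient of `ℤ³` by the span of `ξ`, whose order is the
determinant of the inclusion. -/
theorem natCard_fundDomain (h : IsDualFamily v ξ) :
    Nat.card (fundDomain v ξ) = (Matrix.of ξ).det.natAbs := by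
  have hLI : LinearIndependent ℤ ξ := Matrix.linearIndependent_rows_of_det_ne_zero h.det_ne_zero
  have hcard := Submodule.natAbs_det_basis_change (Pi.basisFun ℤ (Fin 3))
    (Submodule.span ℤ (Set.range ξ)) (Module.Basis.span hLI)
  have hcoe : ((↑) ∘ Module.Basis.span hLI : Fin 3 → Lattice3) = ξ :=
    funext fun i => congrArg Subtype.val (Module.Basis.span_apply hLI i)
  rw [hcoe, Pi.basisFun_det_apply] at hcard
  refine Eq.trans ?_ hcard.symm
  refine Nat.card_congr (Equiv.ofBijective (fun δ => Submodule.Quotient.mk δ.1) ⟨?_, ?_⟩)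
  · rintro ⟨δ, hδ⟩ ⟨ε, hε⟩ hδε
    obtain ⟨n, hn⟩ := (Submodule.mem_span_range_iff_exists_fun ℤ).mp
      ((Submodule.Quotient.eq _).mp hδε)
    refine Subtype.ext (h.eq_of_sum_smul_sub_eq (m := n) (n := 0) hδ hε ?_).2
    simp only [hn, Pi.zero_apply, zero_smul, Finset.sum_const_zero]
    abel
  · intro q
    obtain ⟨δ, rfl⟩ := Submodule.Quotient.mk_surjective _ q
    obtain ⟨n, hn⟩ := h.exists_sum_smul_sub_mem (-δ)
    refine ⟨⟨_, hn⟩, (Submodule.Quotient.eq _).mpr ?_⟩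
    exact (Submodule.mem_span_range_iff_exists_fun ℤ).mpr
      ⟨n, by simp only [sub_neg_eq_add, add_sub_cancel_right]⟩

theorem finite_fundDomain (h : IsDualFamily v ξ) : (fundDomain v ξ).Finite :=
  Nat.finite_of_card_ne_zero (h.natCard_fundDomain ▸ Int.natAbs_ne_zero.mpr h.det_ne_zero)

end IsDualFamily

/-! ### Classes of a cone and lattice points -/

section ClassMap

variable {v ξ : Fin 3 → Lattice3} {i j k : Fin 3} {γ : Lattice3}

/-- The map `(δ, m, n) ↦ (m + 1) ξᵢ - n ξⱼ - δ`, which enumerates the classes modulo the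
third vector `ξₖ` in the cone `C_{+-}(vᵢ, vⱼ)` when `δ` runs over the fundamental domain. -/
def coneElem (ξ : Fin 3 → Lattice3) (i j : Fin 3) (δ : Lattice3) (m n : ℕ) : Lattice3 :=
  (m + 1 : ℤ) • ξ i - (n : ℤ) • ξ j - δ

theorem sum_eq_add_add_of_ne {M : Type*} [AddCommMonoid M] (hij : i ≠ j) (hik : i ≠ k)
    (hjk : j ≠ k) (f : Fin 3 → M) : ∑ l, f l = f i + f j + f k := by
  have huniv : Finset.univ = {i, j, k} := by
    revert i j k
    decide
  rw [huniv, Finset.sum_insert (by simp [hij, hik]), Finset.sum_pair hjk, add_assoc]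

namespace IsDualFamily

theorem coneElem_mem_conePM (h : IsDualFamily v ξ) (hij : i ≠ j) {δ : Lattice3}
    (hδ : δ ∈ fundDomain v ξ) (m n : ℕ) : coneElem ξ i j δ m n ∈ conePM (v i) (v j) := by
  have hi := hδ i
  have hj := hδ j
  constructor
  · rw [coneElem, pair_sub, pair_sub, pair_smul, pair_smul, h.eq_zero j i hij.symm, smul_eq_mul,
      smul_zero]
    nlinarith [hi.2, h.pos i]
  · rw [coneElem, pair_sub, pair_sub, pair_smul, pair_smul, h.eq_zero i j hij, smul_eq_mul,
      smul_eq_mul]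
    nlinarith [hj.1, h.pos j]

theorem coneElem_inj_mod (h : IsDualFamily v ξ) (hij : i ≠ j) (hik : i ≠ k) (hjk : j ≠ k)
    {δ ε : Lattice3} (hδ : δ ∈ fundDomain v ξ) (hε : ε ∈ fundDomain v ξ) {m n m' n' : ℕ} {l : ℤ}
    (hl : coneElem ξ i j δ m n + l • ξ k = coneElem ξ i j ε m' n') :
    δ = ε ∧ m = m' ∧ n = n' := by
  have hcomb (δ : Lattice3) (m n : ℕ) (l : ℤ) : coneElem ξ i j δ m n + l • ξ k =
      ∑ s, (Pi.single i (m + 1 : ℤ) + Pi.single j (-n : ℤ) + Pi.single k l : Fin 3 → ℤ) s • ξ s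
        - δ := by
    rw [sum_eq_add_add_of_ne hij hik hjk, coneElem]
    simp only [Pi.add_apply, Pi.single_eq_same, Pi.single_eq_of_ne hij, Pi.single_eq_of_ne hik,
      Pi.single_eq_of_ne hjk, Pi.single_eq_of_ne hij.symm, Pi.single_eq_of_ne hik.symm,
      Pi.single_eq_of_ne hjk.symm, add_zero, zero_add, neg_smul]
    abel
  rw [hcomb, ← add_zero (coneElem ξ i j ε m' n'), ← zero_smul ℤ (ξ k), hcomb] at hl
  obtain ⟨hcoef, hδε⟩ := h.eq_of_sum_smul_sub_eq hδ hε hl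
  have hi := congrFun hcoef i
  have hj := congrFun hcoef j
  simp only [Pi.add_apply, Pi.single_eq_same, Pi.single_eq_of_ne hij, Pi.single_eq_of_ne hik,
    Pi.single_eq_of_ne hjk, Pi.single_eq_of_ne hij.symm] at hi hj
  exact ⟨hδε, by omega, by omega⟩

theorem exists_coneElem_eq (h : IsDualFamily v ξ) (hij : i ≠ j) (hik : i ≠ k) (hjk : j ≠ k)
    {ε : Lattice3} (hε : ε ∈ conePM (v i) (v j)) : ∃ δ ∈ fundDomain v ξ, ∃ (m n : ℕ) (l : ℤ),
      coneElem ξ i j δ m n + l • ξ k = ε := by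
  obtain ⟨c, hc⟩ := h.exists_sum_smul_sub_mem ε
  have hi := hc i
  have hj := hc j
  rw [pair_sub, h.pair_sum_smul] at hi hj
  have hci : 0 < c i := pos_of_mul_pos_left (by linarith [hi.1, hε.1]) (h.pos i).le
  have hcj : c j ≤ 0 := by nlinarith [hj.2, hε.2, h.pos j]
  refine ⟨_, hc, (c i - 1).toNat, (-c j).toNat, c k, ?_⟩
  rw [coneElem, Int.toNat_of_nonneg (by omega), Int.toNat_of_nonneg (by omega), sub_add_cancel,
    neg_smul, sum_eq_add_add_of_ne hij hik hjk]
  abel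

/-- The class modulo `γ` of `coneElem ξ i j δ m n`; here `γ` is `ξₖ` or `-ξₖ`. -/
def classMap (h : IsDualFamily v ξ) (hij : i ≠ j) (γ : Lattice3)
    (p : fundDomain v ξ × (ℕ × ℕ)) : classes (conePM (v i) (v j)) γ :=
  ⟨coneElem ξ i j p.1 p.2.1 p.2.2, _, h.coneElem_mem_conePM hij p.1.2 p.2.1 p.2.2, rfl⟩

theorem bijective_classMap (h : IsDualFamily v ξ) (hij : i ≠ j) (hik : i ≠ k) (hjk : j ≠ k)
    (hγ : AddSubgroup.zmultiples γ = AddSubgroup.zmultiples (ξ k)) :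
    Function.Bijective (h.classMap hij γ) := by
  have hmk (δ ε : Lattice3) : (δ : Lattice3 ⧸ AddSubgroup.zmultiples γ) = ε ↔
      ∃ l : ℤ, δ + l • ξ k = ε := by
    simp only [QuotientAddGroup.eq, hγ, AddSubgroup.mem_zmultiples_iff, eq_neg_add_iff_add_eq]
  constructor
  · rintro ⟨⟨δ, hδ⟩, m, n⟩ ⟨⟨ε, hε⟩, m', n'⟩ heq
    obtain ⟨l, hl⟩ := (hmk _ _).mp (Subtype.ext_iff.mp heq)
    obtain ⟨rfl, rfl, rfl⟩ := h.coneElem_inj_mod hij hik hjk hδ hε hl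
    rfl
  · rintro ⟨_, ε, hε, rfl⟩
    obtain ⟨δ, hδ, m, n, l, hl⟩ := h.exists_coneElem_eq hij hik hjk hε
    exact ⟨(⟨δ, hδ⟩, m, n), Subtype.ext ((hmk _ _).mpr ⟨l, hl⟩)⟩

theorem expTerm_out_classMap (h : IsDualFamily v ξ) (hij : i ≠ j) {x : Fin 3 → ℂ}
    (hγ : pair γ x ≠ 0) (w : ℂ) (p : fundDomain v ξ × (ℕ × ℕ)) :
    expTerm γ w x (Quotient.out (h.classMap hij γ p).1) =
      Complex.exp (2 * Real.pi * Complex.I * (w + pair p.1.1 x - (p.2.1 + 1) * pair (ξ i) x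
        + p.2.2 * pair (ξ j) x) / pair γ x) := by
  refine (expTerm_out hγ w _).trans ?_
  rw [expTerm, coneElem, pair_sub, pair_sub, pair_smul, pair_smul, zsmul_eq_mul, zsmul_eq_mul]
  push_cast
  ring_nf

theorem numProd_eq_prod (h : IsDualFamily v ξ) (hij : i ≠ j) (hik : i ≠ k) (hjk : j ≠ k)
    (hv : LinearIndependent ℤ ![v i, v j])
    (hγ : AddSubgroup.zmultiples (dirVec (v i) (v j)) = AddSubgroup.zmultiples (ξ k))
    {x : Fin 3 → ℂ} (hi : 0 < pair (v i) (imCross x)) (hj : 0 < pair (v j) (imCross x)) (w : ℂ) :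
    numProd (v i) (v j) w x = ∏ δ ∈ h.finite_fundDomain.toFinset,
      gammaProd (pair (ξ i) x) (pair (ξ j) x) (pair (dirVec (v i) (v j)) x) (w + pair δ x) := by
  have hbij := h.bijective_classMap hij hik hjk hγ
  have hsum := (summable_norm_expTerm hv hi hj w).comp_injective hbij.injective
  simp only [Function.comp_def, h.expTerm_out_classMap hij (pair_dirVec_ne_zero hv hi)] at hsum
  have htprod := (multipliable_one_add_of_summable hsum).tprod_prod' fun δ =>
    multipliable_one_add_of_summable (hsum.prod_factor δ)
  simp only [← sub_eq_add_neg] at htprod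
  have hmem (δ : Lattice3) : δ ∈ h.finite_fundDomain.toFinset ↔ δ ∈ fundDomain v ξ :=
    h.finite_fundDomain.mem_toFinset
  have := h.finite_fundDomain.fintype
  rw [Finset.prod_subtype (F := this) _ hmem, numProd_eq_tprod,
    ← (Equiv.ofBijective _ hbij).tprod_eq]
  simp only [Equiv.ofBijective_apply, classFactor,
    h.expTerm_out_classMap hij (pair_dirVec_ne_zero hv hi)]
  exact htprod.trans (tprod_fintype _)

end IsDualFamily

end ClassMap

/-! ### The dual family of direction vectors -/

section DualForms

theorem det_cyclic {R : Type*} [CommRing R] (v : Fin 3 → Fin 3 → R) (j : Fin 3) :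
    (Matrix.of ![v (j + 1), v (j + 2), v j]).det = (Matrix.of v).det := by
  have hv : v = ![v 0, v 1, v 2] := by
    funext i
    fin_cases i <;> rfl
  rw [hv]
  fin_cases j
  · exact det_rotate _ _ _
  · exact (det_rotate _ _ _).trans (det_rotate _ _ _)
  · rfl

theorem not_linearIndependent_of_det_eq_zero {v : Fin 3 → Lattice3} (h : (Matrix.of v).det = 0) :
    ¬ LinearIndependent ℤ v := by
  obtain ⟨c, hc, hzero⟩ := Matrix.exists_vecMul_eq_zero_iff.mpr h
  rw [Matrix.vecMul_eq_sum] at hzero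
  obtain ⟨i, hi⟩ := Function.ne_iff.mp hc
  exact Fintype.not_linearIndependent_iff.mpr ⟨c, hzero, i, hi⟩

theorem linearIndependent_pair_of_det_ne_zero {v : Fin 3 → Lattice3} (h : (Matrix.of v).det ≠ 0)
    {i j : Fin 3} (hij : i ≠ j) : LinearIndependent ℤ ![v i, v j] := by
  have hLI : LinearIndependent ℤ v := Matrix.linearIndependent_rows_of_det_ne_zero h
  have hinj : Function.Injective ![i, j] := by
    revert i j
    decide
  convert hLI.comp _ hinj using 1
  exact funext (Fin.forall_fin_two.mpr ⟨rfl, rfl⟩)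

/-- The direction vectors of the wedges `(v₁, v₂)`, `(v₂, v₀)`, `(v₀, v₁)`, with the sign for which
they form a dual family of `v`. -/
def dualForms (v : Fin 3 → Lattice3) (j : Fin 3) : Lattice3 :=
  (Matrix.of v).det.sign • dirVec (v (j + 1)) (v (j + 2))

variable {v : Fin 3 → Lattice3}

theorem dualForms_of_pos (h : 0 < (Matrix.of v).det) (j : Fin 3) :
    dualForms v j = dirVec (v (j + 1)) (v (j + 2)) := by
  rw [dualForms, Int.sign_eq_one_of_pos h, one_smul]

theorem isDualFamily_dualForms (h : (Matrix.of v).det ≠ 0) : IsDualFamily v (dualForms v) := by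
  refine ⟨fun j => ?_, fun i j hij => ?_⟩
  · have hLI := linearIndependent_pair_of_det_ne_zero h (show j + 1 ≠ j + 2 by decide +revert)
    have hdet := det_eq_modulus_mul_pair_dirVec (v (j + 1)) (v (j + 2)) (v j)
    rw [det_cyclic] at hdet
    have hpos : 0 < modulus (v (j + 1)) (v (j + 2)) * pair (dualForms v j) (v j) := by
      rw [dualForms, pair_smul, smul_eq_mul, mul_left_comm, ← hdet, Int.sign_mul_self_eq_abs]
      exact abs_pos.mpr h
    exact pos_of_mul_pos_right hpos (modulus_pos hLI).le
  · have hij : j = i + 1 ∨ j = i + 2 := by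
      revert i j
      decide
    rw [dualForms, pair_smul]
    rcases hij with rfl | rfl
    · rw [pair_dirVec_left, smul_zero]
    · rw [pair_dirVec_right, smul_zero]

theorem parallelepiped_eq_fundDomain {a b c : Lattice3} (h : 0 < (Matrix.of ![a, b, c]).det) :
    parallelepiped a b c = fundDomain ![a, b, c] (dualForms ![a, b, c]) := by
  ext δ
  simp only [fundDomain, dualForms_of_pos h, Set.mem_ofPred_eq]
  refine ⟨fun hδ i => ?_, fun hδ => ⟨hδ 0, hδ 1, hδ 2⟩⟩
  fin_cases i
  exacts [hδ.1, hδ.2.1, hδ.2.2]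

theorem det_comp_perm (v : Fin 3 → Lattice3) (σ : Equiv.Perm (Fin 3)) :
    (Matrix.of (v ∘ σ)).det = (Equiv.Perm.sign σ : ℤ) * (Matrix.of v).det :=
  Matrix.det_permute σ (Matrix.of v)

theorem sign_det_comp_perm (v : Fin 3 → Lattice3) (σ : Equiv.Perm (Fin 3)) :
    (Matrix.of (v ∘ σ)).det.sign = (Equiv.Perm.sign σ : ℤ) * (Matrix.of v).det.sign := by
  rw [det_comp_perm, Int.sign_mul]
  rcases Int.units_eq_one_or (Equiv.Perm.sign σ) with h | h <;> rw [h] <;> rfl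

theorem perm_fin_three (σ : Equiv.Perm (Fin 3)) (j : Fin 3) :
    (Equiv.Perm.sign σ = 1 ∧ σ (j + 1) = σ j + 1 ∧ σ (j + 2) = σ j + 2) ∨
      (Equiv.Perm.sign σ = -1 ∧ σ (j + 1) = σ j + 2 ∧ σ (j + 2) = σ j + 1) := by
  revert σ j
  decide

theorem dualForms_comp_perm (v : Fin 3 → Lattice3) (σ : Equiv.Perm (Fin 3)) :
    dualForms (v ∘ σ) = dualForms v ∘ σ := by
  funext j
  rw [dualForms, sign_det_comp_perm]
  simp only [Function.comp_apply]
  obtain ⟨hσ, h₁, h₂⟩ | ⟨hσ, h₁, h₂⟩ := perm_fin_three σ j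
  · rw [hσ, h₁, h₂, Units.val_one, one_mul, dualForms]
  · rw [hσ, h₁, h₂, Units.val_neg, Units.val_one, neg_one_mul, dirVec_swap, neg_smul_neg, dualForms]

theorem fundDomain_comp_perm (v ξ : Fin 3 → Lattice3) (σ : Equiv.Perm (Fin 3)) :
    fundDomain (v ∘ σ) (ξ ∘ σ) = fundDomain v ξ :=
  Set.ext fun _ => σ.forall_congr fun _ => Iff.rfl

end DualForms

/-! ### The polynomials of the three-term relation -/

section LatticeSum

variable {F : Type*} [Field F]

theorem P₃_comp_perm [CharZero F] (y : Fin 3 → F) (σ : Equiv.Perm (Fin 3)) :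
    P₃ (y (σ 0)) (y (σ 1)) (y (σ 2)) = P₃ (y 0) (y 1) (y 2) := by
  have hsymm (z : Fin 3 → F) : P₃ (z 0) (z 1) (z 2) =
      Polynomial.C (1 / ∏ i, z i) * Polynomial.X ^ 3
        - Polynomial.C (3 * ((∑ i, z i) / (2 * ∏ i, z i))) * Polynomial.X ^ 2
        + Polynomial.C ((3 * (∑ i, z i) ^ 2 - ∑ i, z i ^ 2) / (2 * (2 * ∏ i, z i))) * Polynomial.X
        - Polynomial.C (1 / 4 * (∑ i, z i) * ∑ i, 1 / z i) := by
    have hden : 2 * z 0 * z 1 * z 2 = 2 * ∏ i, z i := by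
      rw [Fin.prod_univ_three, ← mul_assoc, ← mul_assoc]
    have hnum : 2 * (z 0 ^ 2 + z 1 ^ 2 + z 2 ^ 2 + 3 * z 0 * z 1 + 3 * z 1 * z 2 + 3 * z 0 * z 2) =
        3 * (∑ i, z i) ^ 2 - ∑ i, z i ^ 2 := by
      rw [Fin.sum_univ_three, Fin.sum_univ_three]
      ring
    rw [P₃, hden, ← hnum, mul_div_mul_left _ _ (two_ne_zero (α := F)), Fin.prod_univ_three,
      Fin.sum_univ_three, Fin.sum_univ_three]
  have hσ := hsymm (y ∘ σ)
  simp only [Function.comp_apply] at hσ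
  rw [hσ, hsymm, Equiv.prod_comp σ y, Equiv.sum_comp σ y, Equiv.sum_comp σ fun i => y i ^ 2,
    Equiv.sum_comp σ fun i => 1 / y i]

theorem exists_P₃_comp_eq (y₁ y₂ y₃ d : F) : ∃ R : F[X], R.degree ≤ 2 ∧
    (P₃ y₁ y₂ y₃).comp (Polynomial.X + Polynomial.C d) =
      Polynomial.C (1 / (y₁ * y₂ * y₃)) * Polynomial.X ^ 3 + R := by
  simp only [P₃]
  generalize 1 / (y₁ * y₂ * y₃) = A
  generalize 3 * ((y₁ + y₂ + y₃) / (2 * y₁ * y₂ * y₃)) = B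
  generalize (y₁ ^ 2 + y₂ ^ 2 + y₃ ^ 2 + 3 * y₁ * y₂ + 3 * y₂ * y₃ + 3 * y₁ * y₃) /
    (2 * y₁ * y₂ * y₃) = D
  generalize 1 / 4 * (y₁ + y₂ + y₃) * (1 / y₁ + 1 / y₂ + 1 / y₃) = E
  refine ⟨Polynomial.C (3 * A * d - B) * Polynomial.X ^ 2
    + Polynomial.C (3 * A * d ^ 2 - 2 * B * d + D) * Polynomial.X
    + Polynomial.C (A * d ^ 3 - B * d ^ 2 + D * d - E), Polynomial.degree_quadratic_le, ?_⟩
  simp only [Polynomial.sub_comp, Polynomial.add_comp, Polynomial.mul_comp, Polynomial.C_comp,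
    Polynomial.pow_comp, Polynomial.X_comp, map_sub, map_add, map_mul, map_pow, map_ofNat]
  ring

theorem map_P₃ {K : Type*} [Field K] (φ : F →+* K) (y₁ y₂ y₃ : F) :
    (P₃ y₁ y₂ y₃).map φ = P₃ (φ y₁) (φ y₂) (φ y₃) := by
  simp [P₃, map_ofNat φ 2, map_ofNat φ 3, map_ofNat φ 4]

/-- The sum of `P₃(w + δ(x), ξ₀(x), ξ₁(x), ξ₂(x))` over the lattice points `δ` of the
parallelepiped spanned by `ξ`. The point `x` is the generic point `coord` in the statement of the
theorem, and a point of `ℂ³` in the three-term relation. -/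
def latticeSum (v ξ : Fin 3 → Lattice3) (x : Fin 3 → F) : F[X] :=
  ∑ᶠ δ ∈ fundDomain v ξ,
    (P₃ (pair (ξ 0) x) (pair (ξ 1) x) (pair (ξ 2) x)).comp (Polynomial.X + Polynomial.C (pair δ x))

theorem map_polynomial_finsum {K : Type*} [Field K] (φ : F →+* K) {ι : Sort*} (f : ι → F[X]) :
    (∑ᶠ i, f i).map φ = ∑ᶠ i, (f i).map φ :=
  (Polynomial.mapRingHom φ).toAddMonoidHom.map_finsum_of_injective
    (Polynomial.map_injective φ φ.injective) f

theorem map_latticeSum {K : Type*} [Field K] (φ : F →+* K) (v ξ : Fin 3 → Lattice3)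
    (x : Fin 3 → F) : (latticeSum v ξ x).map φ = latticeSum v ξ (φ ∘ x) := by
  have hpair (δ : Lattice3) : φ (pair δ x) = pair δ (φ ∘ x) := by
    simp only [pair, map_sum, map_zsmul, Function.comp_apply]
  simp only [latticeSum, map_polynomial_finsum φ, Polynomial.map_comp, map_P₃,
    Polynomial.map_add, Polynomial.map_X, Polynomial.map_C, hpair]

theorem latticeSum_comp_perm [CharZero F] (v ξ : Fin 3 → Lattice3) (σ : Equiv.Perm (Fin 3))
    (x : Fin 3 → F) : latticeSum (v ∘ σ) (ξ ∘ σ) x = latticeSum v ξ x := by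
  simp only [latticeSum, fundDomain_comp_perm, Function.comp_apply,
    P₃_comp_perm fun i => pair (ξ i) x]

namespace IsDualFamily

variable {v ξ : Fin 3 → Lattice3}

theorem latticeSum_eq_sum (h : IsDualFamily v ξ) (x : Fin 3 → F) :
    latticeSum v ξ x = ∑ δ ∈ h.finite_fundDomain.toFinset,
      (P₃ (pair (ξ 0) x) (pair (ξ 1) x) (pair (ξ 2) x)).comp
        (Polynomial.X + Polynomial.C (pair δ x)) :=
  finsum_mem_eq_finite_toFinset_sum _ _

theorem exists_latticeSum_eq (h : IsDualFamily v ξ) (x : Fin 3 → F) :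
    ∃ R : F[X], R.degree ≤ 2 ∧ latticeSum v ξ x =
      Polynomial.C (((Matrix.of ξ).det.natAbs : F) /
        (pair (ξ 0) x * pair (ξ 1) x * pair (ξ 2) x)) * Polynomial.X ^ 3 + R := by
  choose R hR hP₃ using fun δ : Lattice3 =>
    exists_P₃_comp_eq (pair (ξ 0) x) (pair (ξ 1) x) (pair (ξ 2) x) (pair δ x)
  refine ⟨∑ δ ∈ h.finite_fundDomain.toFinset, R δ,
    (Polynomial.degree_sum_le _ _).trans (Finset.sup_le fun δ _ => hR δ), ?_⟩
  rw [h.latticeSum_eq_sum, Finset.sum_congr rfl fun δ _ => hP₃ δ, Finset.sum_add_distrib,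
    Finset.sum_const, ← Set.ncard_eq_toFinset_card _ h.finite_fundDomain, ← Nat.card_coe_set_eq,
    h.natCard_fundDomain, nsmul_eq_mul, ← mul_assoc, ← Polynomial.C_eq_natCast,
    ← Polynomial.C_mul, mul_one_div]

theorem natDegree_latticeSum_le (h : IsDualFamily v ξ) (x : Fin 3 → F) :
    (latticeSum v ξ x).natDegree ≤ 3 := by
  obtain ⟨R, hR, hsum⟩ := h.exists_latticeSum_eq x
  rw [hsum, Polynomial.natDegree_le_iff_degree_le]
  exact (Polynomial.degree_add_le _ _).trans
    (max_le (Polynomial.degree_C_mul_X_pow_le 3 _) (hR.trans (by norm_num)))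

theorem polyEvalsTo_latticeSum (h : IsDualFamily v ξ) {x : Fin 3 → ℂ}
    (hx : ∀ i, pair (ξ i) x ≠ 0) : PolyEvalsTo x (latticeSum v ξ coord) (latticeSum v ξ x) := by
  rw [h.latticeSum_eq_sum, h.latticeSum_eq_sum]
  exact PolyEvalsTo.sum _ fun δ => (polyEvalsTo_P₃ (evalsTo_pair_coord x _)
    (evalsTo_pair_coord x _) (evalsTo_pair_coord x _) (hx 0) (hx 1) (hx 2)).comp
      (PolyEvalsTo.X.add (.C (evalsTo_pair_coord x δ)))

end IsDualFamily

/-- The polynomial `P_{a,b,c}` for `v = (a, b, c)`, in terms of the coordinates `x`. It vanishes if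
`det(a, b, c) = 0`, since the sign of the determinant does. -/
def cocyclePoly (v : Fin 3 → Lattice3) (x : Fin 3 → F) : F[X] :=
  (Matrix.of v).det.sign * latticeSum v (dualForms v) x

theorem map_cocyclePoly {K : Type*} [Field K] (φ : F →+* K) (v : Fin 3 → Lattice3)
    (x : Fin 3 → F) : (cocyclePoly v x).map φ = cocyclePoly v (φ ∘ x) := by
  rw [cocyclePoly, Polynomial.map_mul, Polynomial.map_intCast, map_latticeSum, cocyclePoly]

theorem cocyclePoly_of_det_eq_zero {v : Fin 3 → Lattice3} (h : (Matrix.of v).det = 0)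
    (x : Fin 3 → F) : cocyclePoly v x = 0 := by
  rw [cocyclePoly, h, Int.sign_zero, Int.cast_zero, zero_mul]

theorem cocyclePoly_of_det_pos {v : Fin 3 → Lattice3} (h : 0 < (Matrix.of v).det)
    (x : Fin 3 → F) : cocyclePoly v x = latticeSum v (dualForms v) x := by
  rw [cocyclePoly, Int.sign_eq_one_of_pos h, Int.cast_one, one_mul]

theorem natDegree_cocyclePoly_le (v : Fin 3 → Lattice3) (x : Fin 3 → F) :
    (cocyclePoly v x).natDegree ≤ 3 := by
  by_cases h : (Matrix.of v).det = 0
  · rw [cocyclePoly_of_det_eq_zero h, Polynomial.natDegree_zero]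
    exact Nat.zero_le 3
  · refine Polynomial.natDegree_mul_le.trans ?_
    rw [Polynomial.natDegree_intCast, zero_add]
    exact (isDualFamily_dualForms h).natDegree_latticeSum_le x

theorem cocyclePoly_eq_sign_mul_comp_perm [CharZero F] (v : Fin 3 → Lattice3)
    (σ : Equiv.Perm (Fin 3)) (x : Fin 3 → F) :
    cocyclePoly v x = (Equiv.Perm.sign σ : ℤ) * cocyclePoly (v ∘ σ) x := by
  rw [cocyclePoly, cocyclePoly, sign_det_comp_perm, dualForms_comp_perm, latticeSum_comp_perm,
    Int.cast_mul, ← mul_assoc, ← mul_assoc, ← Int.cast_mul, Int.units_coe_mul_self, Int.cast_one,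
    one_mul]

theorem polyEvalsTo_cocyclePoly {v : Fin 3 → Lattice3} {x : Fin 3 → ℂ}
    (hx : (Matrix.of v).det ≠ 0 → ∀ i, pair (dualForms v i) x ≠ 0) :
    PolyEvalsTo x (cocyclePoly v coord) (cocyclePoly v x) := by
  by_cases h : (Matrix.of v).det = 0
  · rw [cocyclePoly_of_det_eq_zero h, cocyclePoly_of_det_eq_zero h, ← Polynomial.C_0,
      ← Polynomial.C_0]
    exact .C .zero
  · have hsign := intCast_mem (evalGraph x) (Matrix.of v).det.sign
    rw [mem_evalGraph, Prod.fst_intCast, Prod.snd_intCast] at hsign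
    rw [cocyclePoly, cocyclePoly, ← Polynomial.C_eq_intCast, ← Polynomial.C_eq_intCast]
    exact (PolyEvalsTo.C hsign).mul ((isDualFamily_dualForms h).polyEvalsTo_latticeSum (hx h))

end LatticeSum

/-! ### The three-term relation -/

section ThreeTerm

variable {v : Fin 3 → Lattice3} {x : Fin 3 → ℂ}

theorem pair_dualForms_ne_zero (h : (Matrix.of v).det ≠ 0)
    (hx : ∀ j, 0 < pair (v j) (imCross x)) (j : Fin 3) : pair (dualForms v j) x ≠ 0 := by
  have hLI := linearIndependent_pair_of_det_ne_zero h (show j + 1 ≠ j + 2 by decide +revert)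
  rw [dualForms, pair_smul]
  exact smul_ne_zero (mt Int.sign_eq_zero_iff_zero.mp h) (pair_dirVec_ne_zero hLI (hx _))

theorem isCyclicallyOriented_pair_dualForms (h : 0 < (Matrix.of v).det)
    (hx : ∀ j, 0 < pair (v j) (imCross x)) :
    IsCyclicallyOriented fun j => pair (dualForms v j) x := by
  intro j
  have hdual := isDualFamily_dualForms h.ne'
  have hj : j + 1 + 1 = j + 2 ∧ j + 1 + 2 = j ∧ j ≠ j + 2 := by decide +revert
  have him := modulus_mul_im (v (j + 2)) (v j) (dualForms v j) x
  rw [hdual.eq_zero _ _ hj.2.2, Int.cast_zero, zero_mul, sub_zero] at him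
  have hLI := linearIndependent_pair_of_det_ne_zero h.ne' hj.2.2.symm
  refine pos_of_mul_pos_right (a := (modulus (v (j + 2)) (v j) : ℝ)) ?_
    (mod_cast (modulus_pos hLI).le)
  beta_reduce
  rw [dualForms_of_pos h (j + 1), hj.1, hj.2.1, him]
  exact mul_pos (mod_cast hdual.pos j) (hx _)

theorem eval_latticeSum (h : (Matrix.of v).det ≠ 0) (hx : ∀ j, 0 < pair (v j) (imCross x))
    (w : ℂ) : (latticeSum v (dualForms v) x).eval w =
      ∑ δ ∈ (isDualFamily_dualForms h).finite_fundDomain.toFinset,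
        (multiBernoulli 3 3 fun j => pair (dualForms v j) x).eval (w + pair δ x) := by
  rw [IsDualFamily.latticeSum_eq_sum (isDualFamily_dualForms h), Polynomial.eval_finsetSum,
    ← P₃_eq_multiBernoulli (pair_dualForms_ne_zero h hx)]
  simp only [Polynomial.eval_comp, Polynomial.eval_add, Polynomial.eval_X, Polynomial.eval_C]

theorem prod_numProd_of_det_pos (h : 0 < (Matrix.of v).det)
    (hx : ∀ j, 0 < pair (v j) (imCross x)) (w : ℂ) :
    ∏ j, numProd (v (j + 1)) (v (j + 2)) w x =
      (∏ j, numProd (v (j + 2)) (v (j + 1)) w x) *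
        Complex.exp (-(Real.pi * Complex.I / 3) * (cocyclePoly v x).eval w) := by
  have hdual := isDualFamily_dualForms h.ne'
  have hj (j : Fin 3) : j + 1 ≠ j + 2 ∧ j + 1 ≠ j ∧ j + 2 ≠ j := by decide +revert
  have hγ (j : Fin 3) : dirVec (v (j + 2)) (v (j + 1)) = -dualForms v j := by
    rw [dualForms_of_pos h, dirVec_swap]
  have hLI (j : Fin 3) := linearIndependent_pair_of_det_ne_zero h.ne' (hj j).1
  have hnum (j : Fin 3) := hdual.numProd_eq_prod (hj j).1 (hj j).2.1 (hj j).2.2 (hLI j)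
    (by rw [dualForms_of_pos h]) (hx _) (hx _) w
  have hden (j : Fin 3) := hdual.numProd_eq_prod (hj j).1.symm (hj j).2.2 (hj j).2.1
    (LinearIndependent.pair_symm_iff.mp (hLI j))
    (by rw [hγ, AddSubgroup.zmultiples_neg]) (hx _) (hx _) w
  simp only [← dualForms_of_pos h] at hnum
  simp only [hγ, pair_neg] at hden
  simp only [hnum, hden]
  rw [Finset.prod_comm, Finset.prod_comm (s := Finset.univ), cocyclePoly_of_det_pos h,
    eval_latticeSum h.ne' hx, Finset.mul_sum, Complex.exp_sum, ← Finset.prod_mul_distrib]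
  exact Finset.prod_congr rfl fun δ _ =>
    (isCyclicallyOriented_pair_dualForms h hx).prod_gammaProd (w + pair δ x)

theorem prod_numProd (h : (Matrix.of v).det ≠ 0) (hx : ∀ j, 0 < pair (v j) (imCross x)) (w : ℂ) :
    ∏ j, numProd (v (j + 1)) (v (j + 2)) w x =
      (∏ j, numProd (v (j + 2)) (v (j + 1)) w x) *
        Complex.exp (-(Real.pi * Complex.I / 3) * (cocyclePoly v x).eval w) := by
  rcases h.lt_or_gt with hneg | hpos
  · set σ : Equiv.Perm (Fin 3) := Equiv.swap 0 1
    have hsign : Equiv.Perm.sign σ = -1 := by decide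
    have hj (j : Fin 3) : σ (j + 1) = σ j + 2 ∧ σ (j + 2) = σ j + 1 := by decide +revert
    have hdet : 0 < (Matrix.of (v ∘ σ)).det := by
      rw [det_comp_perm, hsign, Units.val_neg, Units.val_one, neg_one_mul]
      exact neg_pos.mpr hneg
    have hprod := prod_numProd_of_det_pos hdet (fun j => hx (σ j)) w
    simp only [Function.comp_apply, hj] at hprod
    rw [Equiv.prod_comp σ fun j => numProd (v (j + 2)) (v (j + 1)) w x,
      Equiv.prod_comp σ fun j => numProd (v (j + 1)) (v (j + 2)) w x] at hprod
    rw [hprod, mul_assoc, ← Complex.exp_add, cocyclePoly_eq_sign_mul_comp_perm v σ, hsign,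
      Units.val_neg, Units.val_one, Int.cast_neg, Int.cast_one, neg_one_mul, Polynomial.eval_neg,
      mul_neg, add_neg_cancel, Complex.exp_zero, mul_one]
  · exact prod_numProd_of_det_pos hpos hx w

theorem wedgeGamma_mul {a b c : Lattice3} (hx : ∀ j, 0 < pair (![a, b, c] j) (imCross x))
    {w : ℂ} (hab : NotPole a b w x) (hbc : NotPole b c w x) (hca : NotPole c a w x) :
    wedgeGamma a b w x * wedgeGamma b c w x * wedgeGamma c a w x =
      Complex.exp (-(Real.pi * Complex.I / 3) * (cocyclePoly ![a, b, c] x).eval w) := by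
  have ha : 0 < pair a (imCross x) := hx 0
  have hb : 0 < pair b (imCross x) := hx 1
  have hc : 0 < pair c (imCross x) := hx 2
  by_cases h : (Matrix.of ![a, b, c]).det = 0
  · have hLI := not_linearIndependent_of_det_eq_zero h
    rw [wedgeGamma_mul_of_dependent ha hb hc hLI hab hbc hca,
      cocyclePoly_of_det_eq_zero h, Polynomial.eval_zero, mul_zero, Complex.exp_zero]
  · have hprod : numProd b c w x * numProd c a w x * numProd a b w x =
        numProd c b w x * numProd a c w x * numProd b a w x *
          Complex.exp (-(Real.pi * Complex.I / 3) * (cocyclePoly ![a, b, c] x).eval w) := by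
      have hprod := prod_numProd h hx w
      rwa [Fin.prod_univ_three, Fin.prod_univ_three] at hprod
    rw [wedgeGamma_eq ha hb, wedgeGamma_eq hb hc, wedgeGamma_eq hc ha, div_mul_div_comm,
      div_mul_div_comm, div_eq_iff (mul_ne_zero (mul_ne_zero (hab.numProd_ne_zero ha hb)
        (hbc.numProd_ne_zero hb hc)) (hca.numProd_ne_zero hc ha))]
    linear_combination hprod

end ThreeTerm

/-! ### Equivariance -/

section Equivariance

variable (g : Matrix.SpecialLinearGroup (Fin 3) ℤ)

/-- The action `δ ↦ δ ∘ g⁻¹` of `g` on the dual lattice. -/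
def dualAct (δ : Lattice3) : Lattice3 := δ ᵥ* g⁻¹.1

theorem coe_inv_mul_coe : g⁻¹.1 * g.1 = 1 := by
  rw [← Matrix.SpecialLinearGroup.coe_mul, inv_mul_cancel, Matrix.SpecialLinearGroup.coe_one]

theorem coe_mul_coe_inv : g.1 * g⁻¹.1 = 1 := by
  rw [← Matrix.SpecialLinearGroup.coe_mul, mul_inv_cancel, Matrix.SpecialLinearGroup.coe_one]

theorem pair_dualAct_mulVec (δ a : Lattice3) : pair (dualAct g δ) (g.1 *ᵥ a) = pair δ a := by
  rw [pair_eq_dotProduct, dualAct, Matrix.dotProduct_mulVec, Matrix.vecMul_vecMul,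
    coe_inv_mul_coe, Matrix.vecMul_one, pair_eq_dotProduct]

theorem dualAct_bijective : Function.Bijective (dualAct g) :=
  Function.bijective_iff_has_inverse.mpr ⟨fun δ => δ ᵥ* g.1,
    fun δ => by simp only [dualAct, Matrix.vecMul_vecMul, coe_inv_mul_coe, Matrix.vecMul_one],
    fun δ => by simp only [dualAct, Matrix.vecMul_vecMul, coe_mul_coe_inv, Matrix.vecMul_one]⟩

theorem det_mulVec (v : Fin 3 → Lattice3) :
    (Matrix.of fun i => g.1 *ᵥ v i).det = (Matrix.of v).det := by
  have hmul : (Matrix.of fun i => g.1 *ᵥ v i) = Matrix.of v * g.1ᵀ := by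
    ext i j
    rw [Matrix.mul_apply, Matrix.of_apply, Matrix.mulVec, dotProduct_comm]
    rfl
  rw [hmul, Matrix.det_mul, Matrix.det_transpose, g.2, mul_one]

theorem cross_mulVec (a b : Lattice3) :
    crossProduct (g.1 *ᵥ a) (g.1 *ᵥ b) = dualAct g (crossProduct a b) := by
  refine dotProduct_eq _ _ fun c => ?_
  obtain ⟨c, rfl⟩ : ∃ d, g.1 *ᵥ d = c :=
    ⟨g⁻¹.1 *ᵥ c, by rw [Matrix.mulVec_mulVec, coe_mul_coe_inv, Matrix.one_mulVec]⟩
  have hvec : (![g.1 *ᵥ a, g.1 *ᵥ b, g.1 *ᵥ c] : Fin 3 → Lattice3) =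
      fun i => g.1 *ᵥ (![a, b, c] : Fin 3 → Lattice3) i := by
    funext i
    fin_cases i <;> rfl
  rw [← pair_eq_dotProduct (dualAct g _), pair_dualAct_mulVec, pair_eq_dotProduct, dotProduct_comm,
    ← det_of_three, hvec, det_mulVec, det_of_three, dotProduct_comm]

theorem gcd_vecMul (A : Matrix.SpecialLinearGroup (Fin 3) ℤ) (δ : Lattice3) :
    Finset.univ.gcd (δ ᵥ* A.1) = Finset.univ.gcd δ := by
  have hdvd (B : Matrix (Fin 3) (Fin 3) ℤ) (ε : Lattice3) :
      Finset.univ.gcd ε ∣ Finset.univ.gcd (ε ᵥ* B) :=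
    Finset.dvd_gcd fun i _ => Finset.dvd_sum fun j hj => (Finset.gcd_dvd hj).mul_right (B j i)
  refine dvd_antisymm_of_normalize_eq Finset.normalize_gcd Finset.normalize_gcd ?_ (hdvd _ _)
  have hback := hdvd A⁻¹.1 (δ ᵥ* A.1)
  rwa [Matrix.vecMul_vecMul, coe_mul_coe_inv, Matrix.vecMul_one] at hback

theorem modulus_mulVec (a b : Lattice3) : modulus (g.1 *ᵥ a) (g.1 *ᵥ b) = modulus a b := by
  rw [modulus, cross_mulVec, dualAct, gcd_vecMul, modulus]

theorem dirVec_mulVec (a b : Lattice3) :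
    dirVec (g.1 *ᵥ a) (g.1 *ᵥ b) = dualAct g (dirVec a b) := by
  by_cases h : modulus a b = 0
  · have hzero {c d : Lattice3} (hcd : modulus c d = 0) : dirVec c d = 0 :=
      funext fun i => by rw [dirVec, hcd, Int.ediv_zero, Pi.zero_apply]
    rw [hzero h, hzero ((modulus_mulVec g a b).trans h), dualAct, Matrix.zero_vecMul]
  · apply smul_right_injective Lattice3 h
    beta_reduce
    rw [← modulus_mulVec g, modulus_smul_dirVec, cross_mulVec, modulus_mulVec,
      ← modulus_smul_dirVec, dualAct, dualAct, Matrix.smul_vecMul]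

theorem dualForms_mulVec (v : Fin 3 → Lattice3) :
    (dualForms fun i => g.1 *ᵥ v i) = dualAct g ∘ dualForms v := by
  funext j
  rw [dualForms, det_mulVec, dirVec_mulVec, Function.comp_apply, dualForms, dualAct, dualAct,
    Matrix.smul_vecMul]

theorem fundDomain_mulVec (v ξ : Fin 3 → Lattice3) :
    fundDomain (fun i => g.1 *ᵥ v i) (dualAct g ∘ ξ) = dualAct g '' fundDomain v ξ := by
  ext δ
  obtain ⟨δ, rfl⟩ := (dualAct_bijective g).surjective δ
  rw [(dualAct_bijective g).injective.mem_set_image]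
  simp only [fundDomain, Set.mem_ofPred_eq, Function.comp_apply, pair_dualAct_mulVec]

section Points

variable {F : Type*} [Field F]

theorem pair_dualAct (δ : Lattice3) (x : Fin 3 → F) :
    pair (dualAct g δ) x = pair δ fun i => pair (g⁻¹.1 i) x := by
  simp only [pair, Finset.smul_sum, smul_smul]
  rw [Finset.sum_comm]
  exact Finset.sum_congr rfl fun j _ => by
    rw [dualAct, Matrix.vecMul, dotProduct, Finset.sum_smul]

theorem latticeSum_mulVec (v ξ : Fin 3 → Lattice3) (x : Fin 3 → F) :
    latticeSum (fun i => g.1 *ᵥ v i) (dualAct g ∘ ξ) x =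
      latticeSum v ξ fun i => pair (g⁻¹.1 i) x := by
  rw [latticeSum, fundDomain_mulVec, finsum_mem_image (dualAct_bijective g).injective.injOn]
  simp only [Function.comp_apply, pair_dualAct, latticeSum]

theorem cocyclePoly_mulVec (v : Fin 3 → Lattice3) (x : Fin 3 → F) :
    cocyclePoly (fun i => g.1 *ᵥ v i) x = cocyclePoly v fun i => pair (g⁻¹.1 i) x := by
  rw [cocyclePoly, det_mulVec, dualForms_mulVec, latticeSum_mulVec, cocyclePoly]

end Points

theorem ratSubst_coord (i : Fin 3) : ratSubst g (coord i) = pair (g.1 i) coord := by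
  rw [ratSubst, coord, IsFractionRing.ringEquivOfRingEquiv_algebraMap]
  change algebraMap _ _ (polySubst g (MvPolynomial.X i)) = _
  rw [polySubst, MvPolynomial.aeval_X, pair, pair, map_sum]
  exact Finset.sum_congr rfl fun j _ => map_zsmul _ _ _

theorem cocyclePoly_mulVec_coord (v : Fin 3 → Lattice3) :
    cocyclePoly (fun i => g.1 *ᵥ v i) coord =
      (cocyclePoly v coord).map (ratSubst g⁻¹).toRingHom := by
  rw [cocyclePoly_mulVec, map_cocyclePoly]
  exact congrArg _ (funext fun i => (ratSubst_coord g⁻¹ i).symm)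

end Equivariance

section PositiveDeterminant

variable {F : Type*} [Field F] {a b c : Lattice3}

theorem cocyclePoly_eq_finsum (h : 0 < (Matrix.of ![a, b, c]).det) (x : Fin 3 → F) :
    cocyclePoly ![a, b, c] x = ∑ᶠ δ ∈ parallelepiped a b c,
      (P₃ (pair (dirVec b c) x) (pair (dirVec c a) x) (pair (dirVec a b) x)).comp
        (Polynomial.X + Polynomial.C (pair δ x)) := by
  rw [cocyclePoly_of_det_pos h, latticeSum, parallelepiped_eq_fundDomain h, dualForms_of_pos h,
    dualForms_of_pos h, dualForms_of_pos h]
  rfl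

theorem finite_parallelepiped (h : 0 < (Matrix.of ![a, b, c]).det) :
    (parallelepiped a b c).Finite :=
  parallelepiped_eq_fundDomain h ▸ (isDualFamily_dualForms h.ne').finite_fundDomain

theorem exists_cocyclePoly_eq (h : 0 < (Matrix.of ![a, b, c]).det) (x : Fin 3 → F) :
    ∃ R : F[X], R.degree ≤ 2 ∧ cocyclePoly ![a, b, c] x =
      Polynomial.C (((Matrix.of ![dirVec b c, dirVec c a, dirVec a b]).det : F) /
        (pair (dirVec b c) x * pair (dirVec c a) x * pair (dirVec a b) x)) * Polynomial.X ^ 3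
          + R := by
  have hdual := isDualFamily_dualForms h.ne'
  have hforms : dualForms ![a, b, c] = ![dirVec b c, dirVec c a, dirVec a b] := by
    funext j
    rw [dualForms_of_pos h]
    fin_cases j <;> rfl
  have hpos : 0 < (Matrix.of (dualForms ![a, b, c])).det :=
    pos_of_mul_pos_left (hdual.det_mul_det ▸ Finset.prod_pos fun i _ => hdual.pos i) h.le
  obtain ⟨R, hR, hsum⟩ := hdual.exists_latticeSum_eq x
  refine ⟨R, hR, ?_⟩
  rw [cocyclePoly_of_det_pos h, hsum, ← Int.cast_natCast, Int.natAbs_of_nonneg hpos.le, hforms]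
  rfl

end PositiveDeterminant

end EllGamma

end

open EllGamma in
theorem mainTheorem3_general :
    (∀ a b : Lattice3, a ≠ 0 → b ≠ 0 → ∀ x ∈ U a ∩ U b, ∀ w : ℂ,
        Multipliable (numFactor a b w x) ∧ Multipliable (denFactor a b w x)) ∧
    (∀ y : Fin 3 → RatFun, (∀ i, y i ≠ 0) → P₃ (y 0) (y 1) (y 2) = multiBernoulli 3 3 y) ∧
    ∃ P : (Fin 3 → Lattice3) → Polynomial RatFun,
      (∀ a b c : Lattice3, a ≠ 0 → b ≠ 0 → c ≠ 0 →
        (P ![a, b, c]).natDegree ≤ 3 ∧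
        ∀ x ∈ U a ∩ U b ∩ U c,
          (∀ k, RegularAt ((P ![a, b, c]).coeff k) x) ∧
          ∀ w : ℂ, NotPole a b w x → NotPole b c w x → NotPole c a w x →
            wedgeGamma a b w x * wedgeGamma b c w x * wedgeGamma c a w x =
              Complex.exp (-(Real.pi * Complex.I / 3) * polyEval (P ![a, b, c]) w x)) ∧
      (∀ a b c : Lattice3, ¬ LinearIndependent ℤ ![a, b, c] → P ![a, b, c] = 0) ∧
      (∀ a b c : Lattice3, 0 < (Matrix.of ![a, b, c]).det →
        ∀ α β γ : Lattice3, α = dirVec b c → β = dirVec c a → γ = dirVec a b →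
          (parallelepiped a b c).Finite ∧
          P ![a, b, c] = ∑ᶠ δ ∈ parallelepiped a b c,
            (P₃ (pair α coord) (pair β coord) (pair γ coord)).comp
              (Polynomial.X + Polynomial.C (pair δ coord)) ∧
          ∃ R : Polynomial RatFun, R.degree ≤ 2 ∧
            P ![a, b, c] =
              Polynomial.C (((Matrix.of ![α, β, γ]).det : RatFun) /
                (pair α coord * pair β coord * pair γ coord)) * Polynomial.X ^ 3 + R) ∧
      (∀ (v : Fin 3 → Lattice3) (σ : Equiv.Perm (Fin 3)),
        P v = ((Equiv.Perm.sign σ : ℤ) : Polynomial RatFun) * P (v ∘ σ)) ∧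
      (∀ (v : Fin 3 → Lattice3) (g : Matrix.SpecialLinearGroup (Fin 3) ℤ),
        P (fun i => g.1 *ᵥ v i) = (P v).map (ratSubst g⁻¹).toRingHom) := by
  refine ⟨fun a b ha hb x hx w => ?_, fun y => P₃_eq_multiBernoulli, fun v => cocyclePoly v coord,
    fun a b c ha hb hc => ⟨natDegree_cocyclePoly_le _ _, fun x hx => ?_⟩, fun a b c h => ?_,
    ?_, fun v σ => cocyclePoly_eq_sign_mul_comp_perm v σ coord,
    fun v g => cocyclePoly_mulVec_coord g v⟩
  · have ha := pair_imCross_pos ha hx.1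
    have hb := pair_imCross_pos hb hx.2
    exact ⟨multipliable_numFactor ha hb w, multipliable_denFactor ha hb w⟩
  · have hpos : ∀ j, 0 < pair (![a, b, c] j) (imCross x) := by
      simp [Fin.forall_fin_succ, pair_imCross_pos ha hx.1.1, pair_imCross_pos hb hx.1.2,
        pair_imCross_pos hc hx.2]
    have heval : PolyEvalsTo x (cocyclePoly ![a, b, c] coord) (cocyclePoly ![a, b, c] x) :=
      polyEvalsTo_cocyclePoly fun h => pair_dualForms_ne_zero h hpos
    refine ⟨fun k => (heval.coeff k).1, fun w hab hbc hca => ?_⟩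
    rw [heval.polyEval_eq, wedgeGamma_mul hpos hab hbc hca]
  · exact cocyclePoly_of_det_eq_zero
      (not_not.mp (mt Matrix.linearIndependent_rows_of_det_ne_zero h)) coord
  · rintro a b c h _ _ _ rfl rfl rfl
    exact ⟨finite_parallelepiped h, cocyclePoly_eq_finsum h coord, exists_cocyclePoly_eq h coord⟩

open EllGamma in
theorem mainTheorem3 :
    -- the products that define `Γ_{a,b}` converge on the domain
    (∀ a b : Lattice3, IsPrim a → IsPrim b → LinearIndependent ℤ ![a, b] →
      ∀ x ∈ U a ∩ U b, ∀ w : ℂ,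
        Multipliable (numFactor a b w x) ∧ Multipliable (denFactor a b w x)) ∧
    -- `P₃ = B_{3,3}`
    (∀ y : Fin 3 → RatFun, (∀ i, y i ≠ 0) → P₃ (y 0) (y 1) (y 2) = multiBernoulli 3 3 y) ∧
    ∃ P : (Fin 3 → Lattice3) → Polynomial RatFun,
      -- the three-term relation
      (∀ a b c : Lattice3, IsPrim a → IsPrim b → IsPrim c →
        (P ![a, b, c]).natDegree ≤ 3 ∧
        ∀ x ∈ U a ∩ U b ∩ U c,
          (∀ k, RegularAt ((P ![a, b, c]).coeff k) x) ∧
          ∀ w : ℂ, NotPole a b w x → NotPole b c w x → NotPole c a w x →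
            wedgeGamma a b w x * wedgeGamma b c w x * wedgeGamma c a w x =
              Complex.exp (-(Real.pi * Complex.I / 3) * polyEval (P ![a, b, c]) w x)) ∧
      -- (i)
      (∀ a b c : Lattice3, IsPrim a → IsPrim b → IsPrim c →
        ¬ LinearIndependent ℤ ![a, b, c] → P ![a, b, c] = 0) ∧
      -- (ii)
      (∀ a b c : Lattice3, IsPrim a → IsPrim b → IsPrim c → 0 < (Matrix.of ![a, b, c]).det →
        ∀ α β γ : Lattice3, α = dirVec b c → β = dirVec c a → γ = dirVec a b →
          (parallelepiped a b c).Finite ∧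
          P ![a, b, c] = ∑ᶠ δ ∈ parallelepiped a b c,
            (P₃ (pair α coord) (pair β coord) (pair γ coord)).comp
              (Polynomial.X + Polynomial.C (pair δ coord)) ∧
          ∃ R : Polynomial RatFun, R.degree ≤ 2 ∧
            P ![a, b, c] =
              Polynomial.C (((Matrix.of ![α, β, γ]).det : RatFun) /
                (pair α coord * pair β coord * pair γ coord)) * Polynomial.X ^ 3 + R) ∧
      -- (iii)
      (∀ v : Fin 3 → Lattice3, (∀ i, IsPrim (v i)) → ∀ σ : Equiv.Perm (Fin 3),
        P v = ((Equiv.Perm.sign σ : ℤ) : Polynomial RatFun) * P (v ∘ σ)) ∧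
      -- equivariance
      (∀ v : Fin 3 → Lattice3, (∀ i, IsPrim (v i)) →
        ∀ g : Matrix.SpecialLinearGroup (Fin 3) ℤ,
          P (fun i => g.1 *ᵥ v i) = (P v).map (ratSubst g⁻¹).toRingHom) := by
  obtain ⟨hconv, hP₃, P, hthree, hdep, hpos, hperm, hg⟩ := mainTheorem3_general
  exact ⟨fun a b ha hb _ => hconv a b ha.ne_zero hb.ne_zero, hP₃, P,
    fun a b c ha hb hc => hthree a b c ha.ne_zero hb.ne_zero hc.ne_zero,
    fun a b c _ _ _ => hdep a b c, fun a b c _ _ _ => hpos a b c, fun v _ => hperm v,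
    fun v _ => hg v⟩
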